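/- Let $a\in\mathbb C$ with $\operatorname{Re}a>-1$. For $t>0$ let $p_n(x;t)=\gamma_n x^n+\gamma_{n,1}x^{n-1}+\cdots$ $(n\ge 0)$ be the orthonormal polynomials for the deformed Laguerre weight $w(x;t)=x^2(x+t)^a e^{-x}$ on $(0,\infty)$, i.e. $\int_0^\infty w\,p_n x^m\,dx=0$ for $m<n$ and $\gamma_n\int_0^\infty w\,p_n x^n\,dx=1$ (for complex $a$ they are defined when the relevant Hankel determinants do not vanish). Put $\Gamma_n(t)=\gamma_{n,1}/\gamma_n$ (with $\gamma_{0,1}=0$), $b_n=\Gamma_n-\Gamma_{n+1}$ and $\theta_n(t)=2n+a+3-t-b_n(t)$. There are functions $\mu,\nu,\sigma$ on the cut plane $\{|\arg s|<\pi\}$, with $\nu$ meromorphic there, such that for every $s>0$ that is not a pole of $\nu$ $$\nu(s)=\lim_{n\to\infty}\Big(n(n+a+2)+\Gamma_n\big(\tfrac{s}{4n}\big)\Big),\qquad \mu(s)=\lim_{n\to\infty}4n\,\theta_n\big(\tfrac{s}{4n}\big);$$ if $a$ is real, $\nu$ has no poles on $(0,\infty)$, so both limits exist for all $s>0$. At every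 $s$ of the cut plane that is not a pole of $\nu$ one has $$\nu(s)=-\sigma(s)+\tfrac14 s-a-2,\qquad \mu(s)=4s\nu'(s)-s,$$ where $\sigma$ satisfies the Jimbo–Miwa–Okamoto $\sigma$-form of Painlevé III$'$ $$(s\sigma'')^2-v_1v_2(\sigma')^2+\sigma'(4\sigma'-1)(\sigma-s\sigma')-\tfrac1{4^3}(v_1-v_2)^2=0,\qquad v_1=a+2,\ v_2=a-2,$$ equivalently $$s^2(\nu'')^2-(a+2)^2(\nu')^2+\nu'(4\nu'-1)(s\nu'-\nu)+\tfrac12a(a+2)\nu'-\tfrac1{16}a^2=0.\qquad(*)$$ If moreover $a\notin\mathbb Z_{\ge0}$, then as $s\to0$ with $|\arg s|<\pi$ $$\nu(s)=A(s)-\frac{2}{4^{a+3}(a+2)(a+1)\Gamma(a+3)\Gamma(a+4)}\,s^{a+3}B(s)+O(s^{2a+6})\qquad(**)$$ with $A,B$ analytic at $0$, $A(s)=\frac{a}{a+2}\frac s4-\frac{a}{8(a+3)(a+2)^2(a+1)}s^2+O(s^3)$ and $B(s)=1+O(s)$; and this boundary condition determines $\nu$ uniquely: if $r>0$ and $f$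 is analytic on $\{0<|s|<r,\ |\arg s|<\pi\}$, satisfies $(*)$ there, and has an expansion of the form $(**)$ (with its own $A,B$ of the stated form), then $f=\nu$ on that domain. -/

import Mathlib

open Filter Topology Asymptotics Polynomial MeasureTheory

namespace HardEdge

noncomputable section

/-- The deformed Laguerre weight `w(x;t) = x² (x+t)^a e^{-x}` on `x > 0` (for `t > 0`), with a
complex exponent `a`; the power is the principal one of the positive number `x + t`. -/
def weight (a : ℂ) (t x : ℝ) : ℂ :=
  ((x ^ 2 : ℝ) : ℂ) * ((x + t : ℝ) : ℂ) ^ a * ((Real.exp (-x) : ℝ) : ℂ)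

/-- `p` is an orthonormal polynomial of degree `n` for the complex-valued weight `w` on `(0,∞)`:
`∫ w p xᵐ = 0` for `m < n`, and `∫ w p xⁿ = h_n` with `γ_n h_n = 1`, where `γ_n` is the leading
coefficient of `p` (equivalently `∫ w p² = 1`; there is no complex conjugation). -/
structure IsOrthonormalPoly (w : ℝ → ℂ) (n : ℕ) (p : ℂ[X]) : Prop where
  degree_eq : p.degree = n
  orthogonal : ∀ m < n, ∫ x in Set.Ioi (0 : ℝ), w x * p.eval (x : ℂ) * (x : ℂ) ^ m = 0
  normalized :
    p.leadingCoeff * ∫ x in Set.Ioi (0 : ℝ), w x * p.eval (x : ℂ) * (x : ℂ) ^ n = 1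

open Classical in
/-- The orthonormal polynomial `p_n(x;t)` of the deformed Laguerre weight, determined by
orthonormality up to sign when the Hankel determinants of orders `n` and `n+1` do not vanish
(always so for real `a > -1`, `t > 0`); `0` if there is no such polynomial. -/
def orthoPoly (a : ℂ) (t : ℝ) (n : ℕ) : ℂ[X] :=
  if h : ∃ p, IsOrthonormalPoly (weight a t) n p then h.choose else 0

/-- `Γ_n(t) = γ_{n,1} / γ_n`, for `p_n = γ_n xⁿ + γ_{n,1} xⁿ⁻¹ + ⋯` (with `γ_{0,1} = 0`). -/
def bigGamma (a : ℂ) (t : ℝ) (n : ℕ) : ℂ :=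
  (orthoPoly a t n).nextCoeff / (orthoPoly a t n).leadingCoeff

/-- The diagonal three-term recurrence coefficient
`b_n = γ_{n,1} / γ_n - γ_{n+1,1} / γ_{n+1}`. -/
def recB (a : ℂ) (t : ℝ) (n : ℕ) : ℂ :=
  bigGamma a t n - bigGamma a t (n + 1)

/-- `θ_n(t) = 2n + a + 3 - t - b_n(t)`. -/
def theta (a : ℂ) (t : ℝ) (n : ℕ) : ℂ :=
  2 * n + a + 3 - t - recB a t n

/-- The Jimbo–Miwa–Okamoto σ-form of the Painlevé III′ equation with parameters `v₁, v₂`,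
at the point `s`. -/
def SigmaPIIIPrimeAt (v₁ v₂ : ℂ) (σ : ℂ → ℂ) (s : ℂ) : Prop :=
  (s * deriv (deriv σ) s) ^ 2 - v₁ * v₂ * (deriv σ s) ^ 2
      + deriv σ s * (4 * deriv σ s - 1) * (σ s - s * deriv σ s)
      - (1 / 4 ^ 3) * (v₁ - v₂) ^ 2 = 0

/-- The second-order equation for `ν`, at the point `s`. -/
def NuEquationAt (a : ℂ) (ν : ℂ → ℂ) (s : ℂ) : Prop :=
  s ^ 2 * (deriv (deriv ν) s) ^ 2 - (a + 2) ^ 2 * (deriv ν s) ^ 2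
      + deriv ν s * (4 * deriv ν s - 1) * (s * deriv ν s - ν s)
      + (1 / 2) * a * (a + 2) * deriv ν s - (1 / 16) * a ^ 2 = 0

/-- The small-`s` expansion
`ν(s) = a/(a+2) · s/4 - a/(8(a+3)(a+2)²(a+1)) · s² + O(s³)`
`  - 2/(4^{a+3}(a+2)(a+1)Γ(a+3)Γ(a+4)) · s^{a+3} (1 + O(s)) + O(s^{2a+6})`
as `s → 0` with `|arg s| < π`. The terms before `s^{a+3}` form a function `A` analytic at `0`, and
the factor `1 + O(s)` is a function `B` analytic at `0`. -/
def HasSmallExpansion (a : ℂ) (ν : ℂ → ℂ) : Prop :=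
  ∃ A B : ℂ → ℂ, AnalyticAt ℂ A 0 ∧ AnalyticAt ℂ B 0 ∧
    (fun s : ℂ => A s - (a / (a + 2) * (s / 4)
        - a / (8 * (a + 3) * (a + 2) ^ 2 * (a + 1)) * s ^ 2)) =O[𝓝 0] (fun s : ℂ => s ^ 3) ∧
    (fun s : ℂ => B s - 1) =O[𝓝 0] (fun s : ℂ => s) ∧
    (fun s : ℂ => ν s - (A s
        - 2 / ((4 : ℂ) ^ (a + 3) * (a + 2) * (a + 1) * Complex.Gamma (a + 3)
            * Complex.Gamma (a + 4)) * s ^ (a + 3) * B s))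
      =O[𝓝[Complex.slitPlane] 0] (fun s : ℂ => s ^ (2 * a + 6))

end

end HardEdge

/-! Write D_N(t) for `weightDet a N t` and H_N = N(N+a+2) + Γ_N. Two facts reduce everything to one
determinant. First, the moments satisfy t m_k' = (k+3+a) m_k - m_{k+1}, whence t D_N'/D_N = H_N
(`trace_adjugate_hankel`). Second, D_N is itself essentially a derivative: the matrix of incomplete
integrals ∫_t^∞ y^{j+k+a} e^{-y} dy has a rank-one t-derivative, and the cofactor this produces is
D_N (`hasDerivAt_det_upperMatrix`). Dividing by the complete Gamma determinant and putting s = 4Nt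
gives E_N = `detN a N` with D_N proportional to t^{-a} e^{(N+1)t} E_N'(4Nt) (`weightDet_eq`), so H_N
= (N+1)t - a + s E_N''/E_N' (`nextCoeff_eq_hardH`).

Limit: Chu–Vandermonde inverts the Gamma Hankel matrix explicitly (`gamma_add_eq`,
`gammaMatrixInv_mul`). E_N is then a sum of principal minors over finite subsets of ℕ. The rescaled
entries converge and are dominated uniformly in N, so E_N tends to E = `detInf a` locally uniformly
on the cut plane (`tendstoLocallyUniformlyOn_detN`). All derivatives converge too, and ν = s/4 - a +
s E''/E' (`nuFun`).

Painlevé equation: at finite N, the ratio β of consecutive norms and the two quantities R, R' =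
a∫wp²/(x+t) for consecutive normalised p satisfy algebraic relations with H, H', H''
(`finite_relations`); two of them are `quotient_identity` at the points -t and 0. Eliminating R and
R' and letting N → ∞ with t = s/4N gives (*) on the positive axis and the limit of θ_N
(`limit_relations`). With denominators cleared, (*) is an analytic identity in E, so it holds on the
whole cut plane (`nuEquation_hardH`).

Poles: they are the zeros of E', simple, with residue m·s at a zero s of order m (`nuFun_pole`). For
real a, H_N is a times a nonnegative number (`nextCoeff_of_real`), so ν keeps one sign on (0,∞),
while a simple pole with positive residue would change it.

Behaviour at 0: minors of size p carry s^{p(a+1)}, and column k carries s^k. After division by the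
leading behaviour of E', size one gives A, size two gives the s^{a+3} term and the remaining sizes
fall into the error (`exists_deriv_detInf_expansion`, `hasSmallExpansion_of_nuFun`).

Uniqueness: the difference of two solutions satisfies a linear equation with a regular singularity
at 0 and indicial roots a+3 and -(a+1). Since a+3 is not an integer ≥ 3, the Taylor coefficients of
the two functions A agree far enough to make the difference smaller than s^{a+3}, which forces it to
vanish (`eventually_eq_of_hasSmallExpansion`). -/

open Filter Topology Asymptotics Polynomial MeasureTheory

namespace HardEdge

noncomputable section

/-! ### Orthogonal polynomials of a moment functional -/

/-- The linear functional on polynomials with prescribed moments. -/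
def momentFunctional (m : ℕ → ℂ) : ℂ[X] →ₗ[ℂ] ℂ :=
  Polynomial.lsum fun k => m k • LinearMap.id

@[simp] lemma momentFunctional_monomial (m : ℕ → ℂ) (k : ℕ) (c : ℂ) :
    momentFunctional m (monomial k c) = m k * c := by
  simp [momentFunctional, Polynomial.lsum_apply, Polynomial.sum_monomial_index]

@[simp] lemma momentFunctional_X_pow (m : ℕ → ℂ) (k : ℕ) :
    momentFunctional m (X ^ k) = m k := by
  rw [X_pow_eq_monomial]; simp

lemma momentFunctional_eq_sum (m : ℕ → ℂ) (p : ℂ[X]) :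
    momentFunctional m p = ∑ k ∈ Finset.range (p.natDegree + 1), p.coeff k * m k := by
  conv_lhs => rw [p.as_sum_range]
  simp [mul_comm]

lemma degree_lt_succ {n : ℕ} {S : ℂ[X]} (hS : S.natDegree ≤ n) :
    S.degree < ((n + 1 : ℕ) : WithBot ℕ) :=
  lt_of_le_of_lt degree_le_natDegree (by exact_mod_cast Nat.lt_succ_of_le hS)

/-- Monic orthogonal polynomial of degree `n` for a linear functional. -/
structure MonicOrth (L : ℂ[X] →ₗ[ℂ] ℂ) (n : ℕ) (P : ℂ[X]) : Prop where
  monic : P.Monic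
  natDegree_eq : P.natDegree = n
  orth : ∀ k < n, L (P * X ^ k) = 0

namespace MonicOrth

variable {L : ℂ[X] →ₗ[ℂ] ℂ} {n : ℕ} {P : ℂ[X]}

lemma orth_of_degree_lt (hP : MonicOrth L n P) {S : ℂ[X]} (hS : S.degree < n) :
    L (P * S) = 0 := by
  by_cases h0 : S = 0
  · simp [h0]
  rw [S.as_sum_range' n (by rwa [natDegree_lt_iff_degree_lt h0]), Finset.mul_sum, map_sum]
  refine Finset.sum_eq_zero fun k hk => ?_
  rw [← C_mul_X_pow_eq_monomial, mul_left_comm, ← smul_eq_C_mul, map_smul,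
    hP.orth k (Finset.mem_range.1 hk), smul_zero]

lemma eq_one (hP : MonicOrth L 0 P) : P = 1 :=
  eq_one_of_monic_natDegree_zero hP.monic hP.natDegree_eq

lemma coeff_self (hP : MonicOrth L n P) : P.coeff n = 1 := by
  rw [← hP.natDegree_eq]; exact hP.monic

lemma degree_lt_of_coeff_eq_zero {S : ℂ[X]} (hS : S.natDegree ≤ n) (h0 : S.coeff n = 0) :
    S.degree < n := by
  rw [degree_lt_iff_coeff_zero]
  intro m hm
  rcases hm.lt_or_eq with h | h
  · exact coeff_eq_zero_of_natDegree_lt (lt_of_le_of_lt hS h)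
  · rw [← h]; exact h0

/-- Subtracting S.coeff n times P lowers the degree of S below n. All later evaluations of L on
products are instances of this or of `orth_of_degree_lt`. -/
lemma mul_eq (hP : MonicOrth L n P) {S : ℂ[X]} (hS : S.natDegree ≤ n) :
    L (P * S) = S.coeff n * L (P * P) := by
  have h1 : (S - C (S.coeff n) * P).degree < n := by
    apply degree_lt_of_coeff_eq_zero
    · refine (natDegree_sub_le _ _).trans (max_le hS ((natDegree_C_mul_le _ _).trans ?_))
      exact hP.natDegree_eq.le
    · simp [hP.coeff_self]
  have h2 := hP.orth_of_degree_lt h1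
  rw [mul_sub, map_sub, sub_eq_zero] at h2
  rw [h2, mul_left_comm, ← smul_eq_C_mul, map_smul, smul_eq_mul]

lemma mul_X_pow (hP : MonicOrth L n P) : L (P * X ^ n) = L (P * P) := by
  rw [hP.mul_eq (by simp)]; simp

end MonicOrth

/-- Christoffel–type identity: division by `X - c`. -/
lemma functional_div {L K : ℂ[X] →ₗ[ℂ] ℂ} {c : ℂ} (hK : ∀ p, K ((X - C c) * p) = L p)
    (P S : ℂ[X]) : K (P * S) = S.eval c * K P + L (P * (S /ₘ (X - C c))) := by
  have h := modByMonic_add_div S (X - C c)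
  rw [modByMonic_X_sub_C_eq_C_eval] at h
  conv_lhs => rw [← h]
  rw [mul_add, map_add, mul_comm P (C _), ← smul_eq_C_mul, map_smul, smul_eq_mul, ← hK]
  congr 2
  ring

/-- Dividing by X - c and using orthogonality, K(P²) = P(c)K(P), K(PQ) = Q(c)K(P), K(Q²) = Q(c)K(Q),
while K(QP) = P(c)K(Q) + L(Q²). Both sides equal P(c)Q(c)K(P)K(Q). -/
lemma quotient_identity {L K : ℂ[X] →ₗ[ℂ] ℂ} {c : ℂ} (hK : ∀ p, K ((X - C c) * p) = L p)
    {n : ℕ} {P Q : ℂ[X]} (hP : MonicOrth L (n + 1) P) (hQ : MonicOrth L n Q) :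
    K (P * P) * K (Q * Q) = K (P * Q) * (K (P * Q) - L (Q * Q)) := by
  have hmon : (X - C c : ℂ[X]).Monic := monic_X_sub_C c
  have degP : (P /ₘ (X - C c)).natDegree = n := by
    rw [natDegree_divByMonic _ hmon, hP.natDegree_eq, natDegree_X_sub_C]; rfl
  have degQ : (Q /ₘ (X - C c)).natDegree ≤ n := by
    rw [natDegree_divByMonic _ hmon, hQ.natDegree_eq, natDegree_X_sub_C]; omega
  have e1 := functional_div hK P P
  have e2 := functional_div hK P Q
  have e3 := functional_div hK Q P
  have e4 := functional_div hK Q Q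
  rw [hP.orth_of_degree_lt (degree_lt_succ degP.le)] at e1
  rw [hP.orth_of_degree_lt (degree_lt_succ degQ)] at e2
  rw [hQ.mul_eq degP.le] at e3
  have hc : (P /ₘ (X - C c)).coeff n = 1 := by
    have : (P /ₘ (X - C c)).leadingCoeff = P.leadingCoeff :=
      leadingCoeff_divByMonic_of_monic hmon (by
        rw [degree_X_sub_C, degree_eq_natDegree hP.monic.ne_zero, hP.natDegree_eq]
        exact_mod_cast Nat.succ_le_succ (Nat.zero_le n))
    rw [leadingCoeff, degP, hP.monic] at this
    exact this
  have hq : L (Q * (Q /ₘ (X - C c))) = 0 := by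
    -- For n = 0 the truncated degree bound is not strictly below n; the quotient is then zero.
    rcases n with _ | n
    · have : Q /ₘ (X - C c) = 0 := by
        rw [divByMonic_eq_zero_iff hmon, degree_X_sub_C]
        exact (degree_le_natDegree.trans_lt (by rw [hQ.natDegree_eq]; norm_num))
      simp [this]
    · apply hQ.orth_of_degree_lt
      refine lt_of_le_of_lt degree_le_natDegree ?_
      rw [natDegree_divByMonic _ hmon, hQ.natDegree_eq, natDegree_X_sub_C]
      exact_mod_cast Nat.lt_succ_self n
  rw [hq] at e4
  rw [hc, mul_comm Q P] at e3
  have : K (P * Q) - L (Q * Q) = P.eval c * K Q := by rw [e3]; ring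
  rw [this, e1, e4, e2]
  ring

/-! ### Consequences of integration by parts -/

/-- The functionals attached to the weight `x² (x+t)^a e^{-x}`: `L` is integration against the
weight, `K` against the weight divided by `x+t`, `N` against the weight divided by `x`. -/
structure Semiclassical (a t : ℂ) (L K N : ℂ[X] →ₗ[ℂ] ℂ) : Prop where
  shift : ∀ p, K ((X - C (-t)) * p) = L p
  origin : ∀ p, N ((X - C 0) * p) = L p
  parts : ∀ p, L (derivative p) + 2 * N p + a * K p = L p

namespace Semiclassical

variable {a t : ℂ} {L K N : ℂ[X] →ₗ[ℂ] ℂ} {n : ℕ} {P Q : ℂ[X]}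

lemma K_X_mul (h : Semiclassical a t L K N) (p : ℂ[X]) : K (X * p) = L p - t * K p := by
  rw [← h.shift p, sub_mul, map_sub, ← smul_eq_C_mul, map_smul, smul_eq_mul]; ring

lemma N_X_mul (h : Semiclassical a t L K N) (p : ℂ[X]) : N (X * p) = L p := by
  rw [← h.origin p, C_0, sub_zero]

lemma sq_parts (h : Semiclassical a t L K N) (hP : MonicOrth L n P) :
    2 * N (P * P) + a * K (P * P) = L (P * P) := by
  have h1 := h.parts (P * P)
  have h2 : L (P * derivative P) = 0 := by
    rcases Nat.eq_zero_or_pos n with h0 | h0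
    · subst h0
      have : P = 1 := hP.eq_one
      simp [this]
    · refine hP.orth_of_degree_lt ?_
      have := degree_derivative_lt hP.monic.ne_zero
      rwa [degree_eq_natDegree hP.monic.ne_zero, hP.natDegree_eq] at this
  rw [derivative_mul, map_add, mul_comm (derivative P), h2] at h1
  linear_combination h1

lemma natDegree_derivative_le' (hP : MonicOrth L (n + 1) P) : (derivative P).natDegree ≤ n :=
  (natDegree_derivative_le P).trans (by rw [hP.natDegree_eq]; rfl)

/-- Together with `sq_parts` this trades N for K, so that the quotient identity at the origin
becomes a second relation between the same unknowns as the one at -t. -/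
lemma mul_parts (h : Semiclassical a t L K N) (hP : MonicOrth L (n + 1) P) (hQ : MonicOrth L n Q) :
    (n + 1) * L (Q * Q) + 2 * N (P * Q) + a * K (P * Q) = 0 := by
  have h1 := h.parts (P * Q)
  have h2 : L (P * derivative Q) = 0 := hP.orth_of_degree_lt (degree_lt_succ
    ((natDegree_derivative_le Q).trans (by rw [hQ.natDegree_eq]; omega)))
  have h3 : L (P * Q) = 0 := hP.orth_of_degree_lt (degree_lt_succ hQ.natDegree_eq.le)
  have h4 : L (derivative P * Q) = (n + 1) * L (Q * Q) := by
    rw [mul_comm, hQ.mul_eq (natDegree_derivative_le' hP), coeff_derivative, hP.coeff_self]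
    ring
  rw [derivative_mul, map_add, h2, h3, h4] at h1
  linear_combination h1

/-- The factor X in the test polynomial X·P·Q brings in the subleading coefficient of P; this
expresses the ratio of consecutive norms through Γ and K(PQ). -/
lemma X_mul_parts (h : Semiclassical a t L K N) (hP : MonicOrth L (n + 1) P)
    (hQ : MonicOrth L n Q) :
    L (P * P) = -(P.nextCoeff * L (Q * Q)) - t * (a * K (P * Q)) := by
  have h1 := h.parts (X * (P * Q))
  have h3 : L (P * Q) = 0 := hP.orth_of_degree_lt (degree_lt_succ hQ.natDegree_eq.le)
  have h2 : L (P * (X * derivative Q)) = 0 := by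
    refine hP.orth_of_degree_lt (degree_lt_succ ?_)
    by_cases hn : n = 0
    · subst hn
      have : Q = 1 := hQ.eq_one
      simp [this]
    · refine natDegree_mul_le.trans ?_
      have := natDegree_derivative_le Q
      rw [hQ.natDegree_eq] at this
      rw [natDegree_X]; omega
  have hnext : P.nextCoeff = P.coeff n := by
    rw [nextCoeff_of_natDegree_pos (by rw [hP.natDegree_eq]; omega), hP.natDegree_eq]; rfl
  -- Subtracting (n+1)P, which is orthogonal to Q, cancels the top coefficient of X·P' and leaves nΓ
  -- - (n+1)Γ = -Γ in degree n.
  have h4 : L (Q * (X * derivative P - C ((n : ℂ) + 1) * P)) = -P.nextCoeff * L (Q * Q) := by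
    have hd : (X * derivative P - C ((n : ℂ) + 1) * P).natDegree ≤ n := by
      have : (X * derivative P - C ((n : ℂ) + 1) * P).degree < ((n + 1 : ℕ) : WithBot ℕ) := by
        apply MonicOrth.degree_lt_of_coeff_eq_zero
        · refine (natDegree_sub_le _ _).trans (max_le ?_ ?_)
          · refine natDegree_mul_le.trans ?_
            have := natDegree_derivative_le' hP
            rw [natDegree_X]; omega
          · exact (natDegree_C_mul_le _ _).trans hP.natDegree_eq.le
        · rw [coeff_sub, coeff_C_mul, coeff_X_mul, coeff_derivative, hP.coeff_self]
          ring
      exact Nat.lt_succ_iff.1 (by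
        by_cases h0 : X * derivative P - C ((n : ℂ) + 1) * P = 0
        · rw [h0]; simp
        · rwa [natDegree_lt_iff_degree_lt h0])
    rw [hQ.mul_eq hd, hnext, coeff_sub, coeff_C_mul]
    congr 1
    rcases n with _ | n
    · simp
    · rw [coeff_X_mul, coeff_derivative]; push_cast; ring
  have h5 : L (Q * (X * derivative P)) = -P.nextCoeff * L (Q * Q) := by
    rw [← h4, mul_sub, map_sub, mul_left_comm Q (C _), ← smul_eq_C_mul, map_smul, mul_comm Q P, h3]
    simp
  have h6 : L (X * (P * Q)) = L (P * P) := by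
    have hd : (X * Q).natDegree ≤ n + 1 := natDegree_mul_le.trans (by
      rw [natDegree_X, hQ.natDegree_eq]; omega)
    rw [mul_left_comm, hP.mul_eq hd, coeff_X_mul, hQ.coeff_self, one_mul]
  rw [h.K_X_mul, h.N_X_mul, h3, h6] at h1
  have h7 : derivative (X * (P * Q))
      = P * Q + (Q * (X * derivative P) + P * (X * derivative Q)) := by
    rw [derivative_mul, derivative_mul, derivative_X]; ring
  rw [h7, map_add, map_add, h2, h3, h5] at h1
  linear_combination -h1

/-- Combined with `nextCoeff_sub` this reads θ_n = t(R - 1) with R = aK(P²)/L(P²). -/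
lemma X_mul_sq_parts (h : Semiclassical a t L K N) (hP : MonicOrth L n P) :
    (2 * n + 3 + a) * L (P * P) - t * (a * K (P * P)) = L (X * (P * P)) := by
  have h1 := h.parts (X * (P * P))
  have h2 : L (P * (X * derivative P)) = n * L (P * P) := by
    rcases n with _ | n
    · have : P = 1 := hP.eq_one
      simp [this]
    · have hd : (X * derivative P).natDegree ≤ n + 1 := natDegree_mul_le.trans (by
        have := natDegree_derivative_le' hP
        rw [natDegree_X]; omega)
      rw [hP.mul_eq hd, coeff_X_mul, coeff_derivative, hP.coeff_self]
      push_cast; ring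
  have h7 : derivative (X * (P * P))
      = P * P + (P * (X * derivative P) + P * (X * derivative P)) := by
    rw [derivative_mul, derivative_mul, derivative_X]; ring
  rw [h.K_X_mul, h.N_X_mul, h7, map_add, map_add, h2] at h1
  linear_combination h1

end Semiclassical

lemma MonicOrth.nextCoeff_sub {L : ℂ[X] →ₗ[ℂ] ℂ} {n : ℕ} {P P' : ℂ[X]}
    (hP : MonicOrth L n P) (hP' : MonicOrth L (n + 1) P') :
    L (X * (P * P)) = (P.nextCoeff - P'.nextCoeff) * L (P * P) := by
  have hnext : P'.nextCoeff = P'.coeff n := by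
    rw [nextCoeff_of_natDegree_pos (by rw [hP'.natDegree_eq]; omega), hP'.natDegree_eq]; rfl
  have hd0 : (X * P - P').degree < ((n + 1 : ℕ) : WithBot ℕ) := by
    apply MonicOrth.degree_lt_of_coeff_eq_zero
    · refine (natDegree_sub_le _ _).trans (max_le ?_ hP'.natDegree_eq.le)
      exact natDegree_mul_le.trans (by rw [natDegree_X, hP.natDegree_eq]; omega)
    · rw [coeff_sub, coeff_X_mul, hP.coeff_self, hP'.coeff_self, sub_self]
  have hd : (X * P - P').natDegree ≤ n := Nat.lt_succ_iff.1 (by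
    by_cases h0 : X * P - P' = 0
    · rw [h0]; simp
    · rwa [natDegree_lt_iff_degree_lt h0])
  have h1 := hP.mul_eq hd
  have h2 : L (P * P') = 0 := by
    rw [mul_comm]
    exact hP'.orth_of_degree_lt (degree_lt_succ hP.natDegree_eq.le)
  rw [mul_sub, map_sub, h2, sub_zero, mul_left_comm] at h1
  rw [h1, coeff_sub, hnext]
  congr 2
  -- In degree 0 the value 0 of `nextCoeff` on constants agrees with the convention γ_{0,1} = 0.
  rcases n with _ | n
  · have : P = 1 := hP.eq_one
    simp [this, nextCoeff]
  · rw [coeff_X_mul, nextCoeff_of_natDegree_pos (by rw [hP.natDegree_eq]; omega),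
      hP.natDegree_eq]; rfl


/-! ### The integrals of the weight and their dependence on t -/

/-- The integrand `x^j (x+t)^b e^{-x}`. -/
def shiftIntegrand (t : ℝ) (j : ℕ) (b : ℂ) (x : ℝ) : ℂ :=
  (x : ℂ) ^ j * ((x + t : ℝ) : ℂ) ^ b * ((Real.exp (-x) : ℝ) : ℂ)

/-- The integral `∫₀^∞ x^j (x+t)^b e^{-x} dx`. -/
def shiftMoment (t : ℝ) (j : ℕ) (b : ℂ) : ℂ :=
  ∫ x in Set.Ioi (0 : ℝ), shiftIntegrand t j b x

lemma norm_shiftIntegrand {t x : ℝ} (ht : 0 < t) (hx : 0 ≤ x) (j : ℕ) (b : ℂ) :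
    ‖shiftIntegrand t j b x‖ = x ^ j * (x + t) ^ b.re * Real.exp (-x) := by
  rw [shiftIntegrand, norm_mul, norm_mul, norm_pow, Complex.norm_real, Complex.norm_real,
    Complex.norm_cpow_eq_rpow_re_of_pos (by positivity), Real.norm_of_nonneg hx,
    Real.norm_of_nonneg (Real.exp_pos _).le]

lemma continuousOn_shiftIntegrand {t : ℝ} (ht : 0 < t) (j : ℕ) (b : ℂ) :
    ContinuousOn (shiftIntegrand t j b) (Set.Ici 0) := by
  unfold shiftIntegrand
  refine ContinuousOn.mul (ContinuousOn.mul (by fun_prop) ?_) (by fun_prop)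
  refine ContinuousOn.cpow (by fun_prop) continuousOn_const fun x hx => ?_
  rw [Complex.ofReal_mem_slitPlane]
  exact add_pos_of_nonneg_of_pos hx ht

lemma isBigO_shiftIntegrand {t : ℝ} (ht : 0 < t) (j : ℕ) (b : ℂ) :
    shiftIntegrand t j b =O[atTop] fun x => Real.exp (-(1 / 2) * x) := by
  have h1 := (isLittleO_rpow_exp_pos_mul_atTop (j + b.re) (b := 1 / 2) (by norm_num)).isBigO
  have h2 := h1.comp_tendsto (tendsto_atTop_add_const_right atTop t
    (tendsto_id (α := ℝ) (x := atTop)))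
  rw [isBigO_iff] at h2 ⊢
  obtain ⟨c, hc⟩ := h2
  refine ⟨c * Real.exp (t / 2), ?_⟩
  filter_upwards [hc, eventually_ge_atTop 0] with x hx hx0
  rw [norm_shiftIntegrand ht hx0]
  simp only [Function.comp_apply, id_eq] at hx
  have hpos : 0 < x + t := by positivity
  rw [Real.norm_of_nonneg (by positivity), Real.norm_of_nonneg (by positivity)] at hx
  rw [Real.norm_of_nonneg (by positivity)]
  have h3 : x ^ j ≤ (x + t) ^ (j : ℝ) := by
    rw [Real.rpow_natCast]; exact pow_le_pow_left₀ hx0 (by linarith) _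
  calc x ^ j * (x + t) ^ b.re * Real.exp (-x)
      ≤ (x + t) ^ (j : ℝ) * (x + t) ^ b.re * Real.exp (-x) := by gcongr
    _ = (x + t) ^ (j + b.re) * Real.exp (-x) := by rw [Real.rpow_add hpos]
    _ ≤ c * Real.exp (1 / 2 * (x + t)) * Real.exp (-x) := by gcongr
    _ = _ := by
      rw [mul_assoc, mul_assoc, ← Real.exp_add, ← Real.exp_add]; ring_nf

lemma integrableOn_shiftIntegrand {t : ℝ} (ht : 0 < t) (j : ℕ) (b : ℂ) :
    IntegrableOn (shiftIntegrand t j b) (Set.Ioi 0) := by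
  have hc := continuousOn_shiftIntegrand ht j b
  refine (integrable_norm_iff ((hc.mono Set.Ioi_subset_Ici_self).aestronglyMeasurable
    measurableSet_Ioi)).1 ?_
  exact integrable_of_isBigO_exp_neg (b := 1 / 2) (by norm_num) hc.norm
    (isBigO_shiftIntegrand ht j b).norm_left

lemma tendsto_shiftIntegrand_atTop {t : ℝ} (ht : 0 < t) (j : ℕ) (b : ℂ) :
    Tendsto (shiftIntegrand t j b) atTop (𝓝 0) := by
  refine (isBigO_shiftIntegrand ht j b).trans_tendsto ?_
  refine Real.tendsto_exp_atBot.comp ?_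
  exact tendsto_id.const_mul_atTop_of_neg (by norm_num)

lemma shiftIntegrand_add_one {t x : ℝ} (h : 0 < x + t) (j : ℕ) (b : ℂ) :
    shiftIntegrand t j (b + 1) x
      = shiftIntegrand t (j + 1) b x + t * shiftIntegrand t j b x := by
  unfold shiftIntegrand
  rw [Complex.cpow_add _ _ (by exact_mod_cast h.ne'), Complex.cpow_one]
  push_cast; ring

lemma shiftMoment_add_one {t : ℝ} (ht : 0 < t) (j : ℕ) (b : ℂ) :
    shiftMoment t j (b + 1) = shiftMoment t (j + 1) b + t * shiftMoment t j b := by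
  unfold shiftMoment
  rw [← integral_const_mul, ← integral_add (integrableOn_shiftIntegrand ht _ _)
    ((integrableOn_shiftIntegrand ht _ _).const_mul _)]
  refine setIntegral_congr_fun measurableSet_Ioi fun x hx => ?_
  exact shiftIntegrand_add_one (add_pos hx ht) j b

lemma hasDerivAt_ofReal_cpow {y : ℝ} (hy : 0 < y) (b : ℂ) :
    HasDerivAt (fun y : ℝ => (y : ℂ) ^ b) (b * (y : ℂ) ^ (b - 1)) y := by
  have h : (y : ℂ) ∈ Complex.slitPlane := Complex.ofReal_mem_slitPlane.2 hy
  have := ((hasDerivAt_id (y : ℂ)).cpow_const (c := b) h).comp_ofReal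
  simpa using this

lemma hasDerivAt_shiftIntegrand {t x : ℝ} (h : 0 < x + t) (j : ℕ) (b : ℂ) :
    HasDerivAt (shiftIntegrand t (j + 1) b)
      ((j + 1) * shiftIntegrand t j b x + b * shiftIntegrand t (j + 1) (b - 1) x
        - shiftIntegrand t (j + 1) b x) x := by
  have h1 : HasDerivAt (fun x : ℝ => (x : ℂ) ^ (j + 1)) (((j : ℂ) + 1) * (x : ℂ) ^ j) x := by
    have := ((hasDerivAt_id (x : ℂ)).pow (j + 1)).comp_ofReal
    simpa using this
  have h2 : HasDerivAt (fun x : ℝ => ((x + t : ℝ) : ℂ) ^ b)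
      (b * ((x + t : ℝ) : ℂ) ^ (b - 1)) x :=
    HasDerivAt.comp_add_const x t (hasDerivAt_ofReal_cpow h b)
  have h3 : HasDerivAt (fun x : ℝ => ((Real.exp (-x) : ℝ) : ℂ)) (-(Real.exp (-x) : ℝ)) x := by
    have := ((hasDerivAt_neg x).exp).ofReal_comp
    simpa [Function.comp_def] using this
  have := (h1.mul h2).mul h3
  refine this.congr_deriv ?_
  unfold shiftIntegrand
  simp only [Pi.mul_apply]
  ring

/-- Integral of the derivative of x^{j+1}(x+t)^b e^{-x}; the boundary term at 0 vanishes because of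
the factor x^{j+1}. -/
lemma shiftMoment_parts {t : ℝ} (ht : 0 < t) (j : ℕ) (b : ℂ) :
    (j + 1) * shiftMoment t j b + b * shiftMoment t (j + 1) (b - 1)
      - shiftMoment t (j + 1) b = 0 := by
  have hi := fun j b => integrableOn_shiftIntegrand ht j b
  have h := integral_Ioi_of_hasDerivAt_of_tendsto (a := (0 : ℝ)) (m := 0)
    (f := shiftIntegrand t (j + 1) b)
    ((continuousOn_shiftIntegrand ht _ _).continuousWithinAt (Set.mem_Ici.2 le_rfl))
    (fun x hx => hasDerivAt_shiftIntegrand (add_pos hx ht) j b)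
    ((((hi _ _).const_mul _).add ((hi _ _).const_mul _)).sub (hi _ _))
    (tendsto_shiftIntegrand_atTop ht _ _)
  rw [integral_sub (f := fun x => (j + 1) * shiftIntegrand t j b x
      + b * shiftIntegrand t (j + 1) (b - 1) x)
      (((hi _ _).const_mul _).add ((hi _ _).const_mul _)) (hi _ _),
    integral_add ((hi _ _).const_mul _) ((hi _ _).const_mul _), integral_const_mul,
    integral_const_mul] at h
  unfold shiftMoment
  rw [h]
  simp [shiftIntegrand]

lemma hasDerivAt_shiftMoment {t : ℝ} (ht : 0 < t) (j : ℕ) (b : ℂ) :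
    HasDerivAt (fun t => shiftMoment t j b) (b * shiftMoment t j (b - 1)) t := by
  have hi := fun (t : ℝ) (ht : 0 < t) j b => integrableOn_shiftIntegrand ht j b
  -- The norm of the differentiated integrand depends on the parameter through (x+s)^{Re b - 1},
  -- which is monotone in s. Hence the sum of its values at t/2 and 2t dominates it, whatever the
  -- sign of the exponent.
  let c : ℂ := ((b.re - 1 : ℝ) : ℂ)
  have key := hasDerivAt_integral_of_dominated_loc_of_deriv_le (μ := volume.restrict (Set.Ioi 0))
    (F := fun t x => shiftIntegrand t j b x) (x₀ := t)
    (F' := fun t x => b * shiftIntegrand t j (b - 1) x)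
    (s := Set.Ioo (t / 2) (2 * t)) (Ioo_mem_nhds (by linarith) (by linarith))
    (bound := fun x => ‖b‖ * (‖shiftIntegrand (t / 2) j c x‖ + ‖shiftIntegrand (2 * t) j c x‖))
    ?_ ?_ ?_ ?_ ?_ ?_
  · have := key.2
    rwa [integral_const_mul] at this
  · filter_upwards [lt_mem_nhds ht] with s hs
    exact (hi s hs j b).aestronglyMeasurable
  · exact hi t ht j b
  · exact ((hi t ht j (b - 1)).const_mul _).aestronglyMeasurable
  · refine (ae_restrict_iff' measurableSet_Ioi).2 (Eventually.of_forall fun x hx s hs => ?_)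
    have hx : (0 : ℝ) < x := hx
    have hs0 : 0 < s := by have := hs.1; linarith
    rw [norm_mul]
    refine mul_le_mul_of_nonneg_left ?_ (norm_nonneg _)
    rw [norm_shiftIntegrand hs0 hx.le, norm_shiftIntegrand (by linarith) hx.le,
      norm_shiftIntegrand (by linarith) hx.le, ← add_mul, ← mul_add]
    refine mul_le_mul_of_nonneg_right (mul_le_mul_of_nonneg_left ?_ (by positivity))
      (by positivity)
    have hc : (b - 1).re = c.re := by simp [c]
    rw [hc]
    have p1 : 0 < (x + t / 2) ^ c.re := Real.rpow_pos_of_pos (by positivity) _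
    have p2 : 0 < (x + 2 * t) ^ c.re := Real.rpow_pos_of_pos (by positivity) _
    rcases le_total 0 c.re with h | h
    · have : (x + s) ^ c.re ≤ (x + 2 * t) ^ c.re :=
        Real.rpow_le_rpow (by positivity) (by linarith [hs.2]) h
      linarith
    · have : (x + s) ^ c.re ≤ (x + t / 2) ^ c.re :=
        Real.rpow_le_rpow_of_nonpos (by positivity) (by linarith [hs.1]) h
      linarith
  · exact ((hi _ (by linarith) j c).norm.add (hi _ (by linarith) j c).norm).const_mul _
  · refine (ae_restrict_iff' measurableSet_Ioi).2 (Eventually.of_forall fun x hx s hs => ?_)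
    have hx : (0 : ℝ) < x := hx
    have hs0 : 0 < s := by have := hs.1; linarith
    have h2 : HasDerivAt (fun s : ℝ => ((x + s : ℝ) : ℂ) ^ b)
        (b * ((x + s : ℝ) : ℂ) ^ (b - 1)) s :=
      HasDerivAt.comp_const_add x s (hasDerivAt_ofReal_cpow (add_pos hx hs0) b)
    have := (h2.const_mul ((x : ℂ) ^ j)).mul_const ((Real.exp (-x) : ℝ) : ℂ)
    refine this.congr_deriv ?_
    unfold shiftIntegrand
    ring

/-- The moment functional of the weight `x^j (x+t)^b e^{-x}`. -/
def shiftFunctional (t : ℝ) (j : ℕ) (b : ℂ) : ℂ[X] →ₗ[ℂ] ℂ :=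
  momentFunctional fun k => shiftMoment t (k + j) b

lemma shiftFunctional_apply {t : ℝ} (ht : 0 < t) (j : ℕ) (b : ℂ) (p : ℂ[X]) :
    shiftFunctional t j b p
      = ∫ x in Set.Ioi (0 : ℝ), shiftIntegrand t j b x * p.eval (x : ℂ) := by
  have h : ∀ x : ℝ, shiftIntegrand t j b x * p.eval (x : ℂ)
      = ∑ k ∈ Finset.range (p.natDegree + 1), p.coeff k * shiftIntegrand t (k + j) b x := by
    intro x
    rw [eval_eq_sum_range, Finset.mul_sum]
    refine Finset.sum_congr rfl fun k _ => ?_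
    unfold shiftIntegrand; ring
  simp_rw [h]
  rw [integral_finsetSum _ fun k _ => (integrableOn_shiftIntegrand ht _ _).const_mul _,
    shiftFunctional, momentFunctional_eq_sum]
  simp_rw [integral_const_mul]
  rfl

/-- The field `parts` encodes w'/w = 2/x + a/(x+t) - 1; dividing w by x or by x+t lowers one of its
two exponents by one. -/
lemma semiclassical_shiftFunctional {t : ℝ} (ht : 0 < t) (a : ℂ) :
    Semiclassical a t (shiftFunctional t 2 a) (shiftFunctional t 2 (a - 1))
      (shiftFunctional t 1 a) := by
  constructor
  · intro p
    induction p using Polynomial.induction_on' with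
    | add p q hp hq => rw [mul_add, map_add, map_add, hp, hq]
    | monomial k c =>
      have := shiftMoment_add_one ht (k + 2) (a - 1)
      rw [sub_add_cancel] at this
      rw [C_neg, sub_neg_eq_add, add_mul, X_mul_monomial, C_mul_monomial, map_add]
      simp only [shiftFunctional, momentFunctional_monomial]
      rw [this, show k + 2 + 1 = k + 1 + 2 by ring]; ring
  · intro p
    induction p using Polynomial.induction_on' with
    | add p q hp hq => rw [mul_add, map_add, map_add, hp, hq]
    | monomial k c =>
      rw [C_0, sub_zero, X_mul_monomial]
      simp only [shiftFunctional, momentFunctional_monomial]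
  · intro p
    induction p using Polynomial.induction_on' with
    | add p q hp hq =>
      simp only [map_add]; linear_combination hp + hq
    | monomial k c =>
      rw [derivative_monomial]
      simp only [shiftFunctional, momentFunctional_monomial]
      have h1 := shiftMoment_parts ht (k + 1) a
      rcases k with _ | k
      · simp at h1 ⊢
        linear_combination c * h1
      · simp only [Nat.add_sub_cancel]
        push_cast at h1 ⊢
        rw [show k + 1 + 2 = k + 1 + 1 + 1 by ring, show k + 2 = k + 1 + 1 by ring]
        linear_combination c * h1

lemma weight_eq (a : ℂ) (t x : ℝ) : weight a t x = shiftIntegrand t 2 a x := by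
  unfold weight shiftIntegrand; push_cast; ring


/-! ### Hankel determinants and their derivatives in a parameter -/

lemma natDegree_le_of_degree_lt_succ {n : ℕ} {S : ℂ[X]} (hS : S.degree < ((n + 1 : ℕ) : WithBot ℕ)) :
    S.natDegree ≤ n := by
  by_cases h0 : S = 0
  · simp [h0]
  · exact Nat.lt_succ_iff.1 ((natDegree_lt_iff_degree_lt h0).2 hS)

/-- Hankel matrix of a moment sequence. -/
def hankel (m : ℕ → ℂ) (n : ℕ) : Matrix (Fin n) (Fin n) ℂ :=
  Matrix.of fun i j => m (i + j)

/-- The coefficient vector of S lies in the kernel of the Hankel matrix. For complex weights this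
replaces positivity as the source of uniqueness and of nonzero norms. -/
lemma eq_zero_of_hankel {m : ℕ → ℂ} {N : ℕ} (hD : (hankel m N).det ≠ 0) {S : ℂ[X]}
    (hdeg : S.degree < N) (hS : ∀ k < N, momentFunctional m (S * X ^ k) = 0) : S = 0 := by
  have hv : (hankel m N).mulVec (fun j : Fin N => S.coeff j) = 0 := by
    funext i
    have h := hS i i.2
    by_cases h0 : S = 0
    · simp [h0, Matrix.mulVec, dotProduct]
    rw [S.as_sum_range' N (by rwa [natDegree_lt_iff_degree_lt h0]), Finset.sum_mul, map_sum] at h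
    simp only [monomial_mul_X_pow, momentFunctional_monomial] at h
    rw [Finset.sum_range (fun k => m (k + i) * S.coeff k)] at h
    simp only [Matrix.mulVec, dotProduct, hankel, Matrix.of_apply, Pi.zero_apply]
    rw [← h]
    exact Finset.sum_congr rfl fun j _ => by rw [add_comm]
  have h0 := Matrix.eq_zero_of_mulVec_eq_zero hD hv
  ext k
  by_cases hk : k < N
  · simpa using congrFun h0 ⟨k, hk⟩
  · rw [coeff_zero]
    exact coeff_eq_zero_of_degree_lt (lt_of_lt_of_le hdeg (by exact_mod_cast not_lt.1 hk))

lemma MonicOrth.unique {m : ℕ → ℂ} {n : ℕ} (hD : (hankel m n).det ≠ 0) {P P' : ℂ[X]}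
    (hP : MonicOrth (momentFunctional m) n P) (hP' : MonicOrth (momentFunctional m) n P') :
    P = P' := by
  refine sub_eq_zero.1 (eq_zero_of_hankel hD ?_ fun k hk => ?_)
  · apply degree_lt_of_coeff_eq_zero
    · exact (natDegree_sub_le _ _).trans (max_le hP.natDegree_eq.le hP'.natDegree_eq.le)
    · rw [coeff_sub, hP.coeff_self, hP'.coeff_self, sub_self]
  · rw [sub_mul, map_sub, hP.orth k hk, hP'.orth k hk, sub_self]

lemma MonicOrth.norm_ne_zero {m : ℕ → ℂ} {n : ℕ} (hD : (hankel m (n + 1)).det ≠ 0) {P : ℂ[X]}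
    (hP : MonicOrth (momentFunctional m) n P) : momentFunctional m (P * P) ≠ 0 := by
  intro h0
  refine hP.monic.ne_zero (eq_zero_of_hankel hD (degree_lt_succ hP.natDegree_eq.le) fun k hk => ?_)
  rcases Nat.lt_succ_iff_lt_or_eq.1 hk with h | h
  · exact hP.orth k h
  · rw [h, hP.mul_X_pow, h0]

/-- Lower coefficients (up to sign) of the monic orthogonal polynomial, by Cramer's rule. -/
def orthCoeff (m : ℕ → ℂ) (n : ℕ) (j : Fin n) : ℂ :=
  (hankel m n).det⁻¹ * (hankel m n).cramer (fun i : Fin n => m (n + i)) j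

lemma hankel_mulVec_orthCoeff {m : ℕ → ℂ} {n : ℕ} (hD : (hankel m n).det ≠ 0) :
    (hankel m n).mulVec (orthCoeff m n) = fun i : Fin n => m (n + i) := by
  have : orthCoeff m n = (hankel m n).det⁻¹ • (hankel m n).cramer (fun i : Fin n => m (n + i)) := rfl
  rw [this, Matrix.mulVec_smul, Matrix.mulVec_cramer, smul_smul, inv_mul_cancel₀ hD, one_smul]

/-- Monic polynomial of degree `n` with given lower coefficients (up to sign). -/
def monicOf {n : ℕ} (c : Fin n → ℂ) : ℂ[X] := X ^ n - ∑ j, C (c j) * X ^ (j : ℕ)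

lemma degree_lower {n : ℕ} (c : Fin n → ℂ) :
    (∑ j, C (c j) * X ^ (j : ℕ) : ℂ[X]).degree < n := by
  refine lt_of_le_of_lt (degree_sum_le _ _) ?_
  rw [Finset.sup_lt_iff (WithBot.bot_lt_coe _)]
  intro j _
  exact lt_of_le_of_lt (degree_C_mul_X_pow_le _ _) (by exact_mod_cast j.2)

/-- The monic orthogonal polynomial of a moment sequence. -/
def monicOrthPoly (m : ℕ → ℂ) (n : ℕ) : ℂ[X] := monicOf (orthCoeff m n)

lemma natDegree_monicOf {n : ℕ} (c : Fin n → ℂ) : (monicOf c).natDegree = n := by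
  apply natDegree_eq_of_degree_eq_some
  rw [monicOf, degree_sub_eq_left_of_degree_lt]
  · exact degree_X_pow n
  · rw [degree_X_pow]; exact degree_lower c

lemma monic_monicOf {n : ℕ} (c : Fin n → ℂ) : (monicOf c).Monic := by
  rw [Monic, leadingCoeff, natDegree_monicOf, monicOf, coeff_sub, coeff_X_pow_self,
    coeff_eq_zero_of_degree_lt (degree_lower c), sub_zero]

lemma coeff_lower {n : ℕ} (c : Fin n → ℂ) (j : Fin n) :
    (∑ j, C (c j) * X ^ (j : ℕ) : ℂ[X]).coeff j = c j := by
  simp only [finsetSum_coeff, coeff_C_mul, coeff_X_pow]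
  rw [Finset.sum_eq_single j]
  · simp
  · intro b _ hb
    rw [if_neg (fun h => hb (Fin.ext h.symm)), mul_zero]
  · simp

lemma nextCoeff_monicOf {n : ℕ} (c : Fin (n + 1) → ℂ) :
    (monicOf c).nextCoeff = -c (Fin.last n) := by
  rw [nextCoeff_of_natDegree_pos (by rw [natDegree_monicOf]; omega), natDegree_monicOf]
  have := coeff_lower c (Fin.last n)
  rw [Fin.val_last] at this
  rw [Nat.add_sub_cancel, monicOf, coeff_sub, this, coeff_X_pow, if_neg (by omega), zero_sub]

lemma functional_monicOf (L : ℂ[X] →ₗ[ℂ] ℂ) {n : ℕ} (c : Fin n → ℂ) (S : ℂ[X]) :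
    L (monicOf c * S) = L (X ^ n * S) - ∑ j, c j * L (X ^ (j : ℕ) * S) := by
  rw [monicOf, sub_mul, map_sub, Finset.sum_mul, map_sum]
  congr 1
  refine Finset.sum_congr rfl fun j _ => ?_
  rw [mul_assoc, ← smul_eq_C_mul, map_smul, smul_eq_mul]

lemma monicOrth_monicOrthPoly {m : ℕ → ℂ} {n : ℕ} (hD : (hankel m n).det ≠ 0) :
    MonicOrth (momentFunctional m) n (monicOrthPoly m n) := by
  refine ⟨monic_monicOf _, natDegree_monicOf _, fun k hk => ?_⟩
  have h := congrFun (hankel_mulVec_orthCoeff hD) ⟨k, hk⟩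
  rw [monicOrthPoly, functional_monicOf]
  simp only [← pow_add, momentFunctional_X_pow]
  rw [sub_eq_zero, ← h]
  simp only [Matrix.mulVec, dotProduct, hankel, Matrix.of_apply]
  exact Finset.sum_congr rfl fun j _ => by rw [mul_comm, add_comm k]

/-- Jacobi's formula: differentiating the permutation expansion column by column gives determinants
with one column replaced, which are Cramer's. The adjugate form needs no invertibility. -/
lemma hasDerivAt_det {n : Type*} [Fintype n] [DecidableEq n] {M : ℝ → Matrix n n ℂ}
    {M' : Matrix n n ℂ} {t : ℝ} (h : ∀ i j, HasDerivAt (fun t => M t i j) (M' i j) t) :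
    HasDerivAt (fun t => (M t).det) (Matrix.trace ((M t).adjugate * M')) t := by
  have h1 : HasDerivAt (fun t => ∑ σ : Equiv.Perm n, ((Equiv.Perm.sign σ : ℤ) : ℂ) *
      ∏ i, M t (σ i) i) (∑ σ : Equiv.Perm n, ((Equiv.Perm.sign σ : ℤ) : ℂ) *
        ∑ i, (∏ j ∈ Finset.univ.erase i, M t (σ j) j) • M' (σ i) i) t :=
    HasDerivAt.fun_sum fun σ _ => (HasDerivAt.fun_finsetProd fun i _ => h (σ i) i).const_mul _
  simp only [Matrix.det_apply']
  refine h1.congr_deriv ?_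
  simp only [Finset.mul_sum]
  rw [Finset.sum_comm, Matrix.trace]
  refine Finset.sum_congr rfl fun i _ => ?_
  have : ((M t).adjugate * M').diag i = (M t).cramer (fun k => M' k i) i := by
    rw [Matrix.cramer_eq_adjugate_mulVec]; rfl
  rw [this, Matrix.cramer_apply, Matrix.det_apply']
  refine Finset.sum_congr rfl fun σ _ => ?_
  congr 1
  rw [← Finset.mul_prod_erase Finset.univ _ (Finset.mem_univ i), Matrix.updateCol_self,
    smul_eq_mul, mul_comm]
  congr 1
  exact Finset.prod_congr rfl fun j hj => by
    rw [Matrix.updateCol_ne (Finset.ne_of_mem_erase hj)]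

section Derivative

variable {m : ℝ → ℕ → ℂ} {m' : ℕ → ℂ} {t : ℝ} {n : ℕ}

lemma hasDerivAt_hankel_det (hm : ∀ k, HasDerivAt (fun t => m t k) (m' k) t) (n : ℕ) :
    HasDerivAt (fun t => (hankel (m t) n).det)
      (Matrix.trace ((hankel (m t) n).adjugate * hankel m' n)) t :=
  hasDerivAt_det fun _ _ => hm _

lemma differentiableAt_orthCoeff (hm : ∀ k, HasDerivAt (fun t => m t k) (m' k) t)
    (hD : (hankel (m t) n).det ≠ 0) (j : Fin n) :
    DifferentiableAt ℝ (fun t => orthCoeff (m t) n j) t := by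
  unfold orthCoeff
  refine DifferentiableAt.mul ?_ ?_
  · exact (hasDerivAt_hankel_det hm n).differentiableAt.inv hD
  · simp only [Matrix.cramer_apply]
    refine (hasDerivAt_det (M' := (hankel m' n).updateCol j (fun i : Fin n => m' (n + i)))
      fun i k => ?_).differentiableAt
    by_cases hk : k = j
    · subst hk; simpa using hm _
    · simp only [Matrix.updateCol_ne hk]
      exact hm (i + k)

lemma hasDerivAt_momentFunctional (hm : ∀ k, HasDerivAt (fun t => m t k) (m' k) t) (S : ℂ[X]) :
    HasDerivAt (fun t => momentFunctional (m t) S) (momentFunctional m' S) t := by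
  simp only [momentFunctional_eq_sum]
  exact HasDerivAt.fun_sum fun k _ => (hm k).const_mul _

lemma hasDerivAt_functional_monicOrthPoly (hm : ∀ k, HasDerivAt (fun t => m t k) (m' k) t)
    {c' : Fin n → ℂ} (hc : ∀ j, HasDerivAt (fun t => orthCoeff (m t) n j) (c' j) t) (S : ℂ[X]) :
    HasDerivAt (fun τ => momentFunctional (m τ) (monicOrthPoly (m τ) n * S))
      (momentFunctional m' (monicOrthPoly (m t) n * S)
        - momentFunctional (m t) ((∑ j, C (c' j) * X ^ (j : ℕ)) * S)) t := by
  simp only [monicOrthPoly, functional_monicOf]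
  have h1 := hasDerivAt_momentFunctional hm (X ^ n * S)
  have h2 : HasDerivAt (fun τ => ∑ j, orthCoeff (m τ) n j * momentFunctional (m τ) (X ^ (j : ℕ) * S))
      (∑ j, (c' j * momentFunctional (m t) (X ^ (j : ℕ) * S)
        + orthCoeff (m t) n j * momentFunctional m' (X ^ (j : ℕ) * S))) t :=
    HasDerivAt.fun_sum fun j _ => (hc j).mul (hasDerivAt_momentFunctional hm _)
  refine (h1.sub h2).congr_deriv ?_
  rw [Finset.sum_mul, map_sum, Finset.sum_add_distrib]
  have : ∀ j : Fin n, momentFunctional (m t) (C (c' j) * X ^ (j : ℕ) * S)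
      = c' j * momentFunctional (m t) (X ^ (j : ℕ) * S) := fun j => by
    rw [mul_assoc, ← smul_eq_C_mul, map_smul, smul_eq_mul]
  simp only [this]
  ring

lemma eventually_hankel_det_ne_zero (hm : ∀ k, HasDerivAt (fun t => m t k) (m' k) t)
    (hD : (hankel (m t) n).det ≠ 0) : ∀ᶠ τ in 𝓝 t, (hankel (m τ) n).det ≠ 0 :=
  (hasDerivAt_hankel_det hm n).continuousAt.eventually_ne hD

/-- One factor may be frozen at t, since nearby monic polynomials of the same degree have the same
pairing. The derivative of the other has lower degree and is killed, so only the moments are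
differentiated. -/
lemma hasDerivAt_norm_monicOrthPoly (hm : ∀ k, HasDerivAt (fun t => m t k) (m' k) t)
    (hD : (hankel (m t) n).det ≠ 0) :
    HasDerivAt (fun τ => momentFunctional (m τ) (monicOrthPoly (m τ) n * monicOrthPoly (m τ) n))
      (momentFunctional m' (monicOrthPoly (m t) n * monicOrthPoly (m t) n)) t := by
  have hc := fun j => (differentiableAt_orthCoeff hm hD j).hasDerivAt
  have h := hasDerivAt_functional_monicOrthPoly hm hc (monicOrthPoly (m t) n)
  have hP := monicOrth_monicOrthPoly hD
  rw [mul_comm (∑ j, _) (monicOrthPoly (m t) n), hP.orth_of_degree_lt (degree_lower _),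
    sub_zero] at h
  refine h.congr_of_eventuallyEq ?_
  filter_upwards [eventually_hankel_det_ne_zero hm hD] with τ hτ
  rw [(monicOrth_monicOrthPoly hτ).mul_eq hP.natDegree_eq.le, hP.coeff_self, one_mul]

/-- Differentiate the orthogonality L(P·Q) = 0 with Q frozen; the derivative of P has degree at most
n and pairs with Q through its coefficient of X^n alone. -/
lemma hasDerivAt_nextCoeff (hm : ∀ k, HasDerivAt (fun t => m t k) (m' k) t)
    (hD : (hankel (m t) n).det ≠ 0) (hD' : (hankel (m t) (n + 1)).det ≠ 0) :
    HasDerivAt (fun τ => (monicOrthPoly (m τ) (n + 1)).nextCoeff)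
      (-(momentFunctional m' (monicOrthPoly (m t) (n + 1) * monicOrthPoly (m t) n)
        / momentFunctional (m t) (monicOrthPoly (m t) n * monicOrthPoly (m t) n))) t := by
  have hc := fun j => (differentiableAt_orthCoeff hm hD' j).hasDerivAt
  have h := hasDerivAt_functional_monicOrthPoly hm hc (monicOrthPoly (m t) n)
  have hQ := monicOrth_monicOrthPoly hD
  have h0 : HasDerivAt (fun τ => momentFunctional (m τ)
      (monicOrthPoly (m τ) (n + 1) * monicOrthPoly (m t) n)) 0 t := by
    refine (hasDerivAt_const t (0 : ℂ)).congr_of_eventuallyEq ?_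
    filter_upwards [eventually_hankel_det_ne_zero hm hD'] with τ hτ
    exact (monicOrth_monicOrthPoly hτ).orth_of_degree_lt (degree_lt_succ hQ.natDegree_eq.le)
  have h1 := h.unique h0
  have hlow := degree_lower (fun j : Fin (n + 1) => deriv (fun t => orthCoeff (m t) (n + 1) j) t)
  have hnat : (∑ j : Fin (n + 1), C (deriv (fun t => orthCoeff (m t) (n + 1) j) t)
      * X ^ (j : ℕ) : ℂ[X]).natDegree ≤ n := by
    exact natDegree_le_of_degree_lt_succ hlow
  have hcoeff := coeff_lower (fun j : Fin (n + 1) => deriv (fun t => orthCoeff (m t) (n + 1) j) t)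
    (Fin.last n)
  rw [Fin.val_last] at hcoeff
  rw [mul_comm (∑ j, _) (monicOrthPoly (m t) n), hQ.mul_eq hnat, hcoeff] at h1
  have hne := hQ.norm_ne_zero hD'
  simp only [monicOrthPoly, nextCoeff_monicOf] at h1 hne ⊢
  refine (hc (Fin.last n)).neg.congr_deriv ?_
  field_simp
  linear_combination h1

end Derivative

/-- The recurrence says tH' = dH + Hd + cH - HK with d = diag(0,…,n) and K a companion matrix, so by
Jacobi's formula the logarithmic derivative is 2 tr d + c(n+1) - tr K. The trace of K is minus the
subleading coefficient. -/
lemma trace_adjugate_hankel {m m' : ℕ → ℂ} {n : ℕ} {t c : ℂ}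
    (hD : (hankel m (n + 1)).det ≠ 0)
    (hm : ∀ k, t * m' k = (k + c) * m k - m (k + 1)) :
    t * Matrix.trace ((hankel m (n + 1)).adjugate * hankel m' (n + 1))
      = (hankel m (n + 1)).det * ((n + 1) * (n + c) + (monicOrthPoly m (n + 1)).nextCoeff) := by
  set H := hankel m (n + 1) with hH
  let d : Matrix (Fin (n + 1)) (Fin (n + 1)) ℂ := Matrix.diagonal fun i => ((i : ℕ) : ℂ)
  -- Right multiplication by K moves each column of H to the next one. The column beyond the last is
  -- a combination of the existing ones, with the coefficients of the orthogonal polynomial.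
  let K : Matrix (Fin (n + 1)) (Fin (n + 1)) ℂ := Matrix.of fun i j =>
    if (j : ℕ) < n then (if (i : ℕ) = j + 1 then 1 else 0) else orthCoeff m (n + 1) i
  have hK : H * K = Matrix.of fun i j : Fin (n + 1) => m (i + j + 1) := by
    ext i j
    rw [Matrix.mul_apply]
    by_cases hj : (j : ℕ) < n
    · rw [Finset.sum_eq_single (⟨j + 1, by omega⟩ : Fin (n + 1))]
      · simp [K, hj, hH, hankel, add_assoc]
      · intro b _ hb
        have : (b : ℕ) ≠ j + 1 := fun h => hb (Fin.ext h)
        simp [K, hj, this]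
      · simp
    · have h := congrFun (hankel_mulVec_orthCoeff hD) i
      have hjn : (j : ℕ) = n := by omega
      simp only [K, Matrix.of_apply, hj, if_false]
      rw [Matrix.mulVec, dotProduct] at h
      rw [h, hjn]; congr 1; omega
  have hM : t • hankel m' (n + 1) = d * H + H * d + c • H - H * K := by
    rw [hK]
    ext i j
    simp only [d, hH, hankel, Matrix.smul_apply, Matrix.sub_apply, Matrix.add_apply,
      Matrix.diagonal_mul, Matrix.mul_diagonal, Matrix.of_apply, smul_eq_mul]
    rw [hm]; push_cast; ring
  have htr : Matrix.trace K = orthCoeff m (n + 1) (Fin.last n) := by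
    rw [Matrix.trace, Finset.sum_eq_single (Fin.last n)]
    · simp [K]
    · intro b _ hb
      have : (b : ℕ) < n := by
        rcases Nat.lt_succ_iff_lt_or_eq.1 b.2 with h | h
        · exact h
        · exact absurd (Fin.ext h) hb
      simp [K, this]
    · simp
  have hd : Matrix.trace d = (n + 1) * n / 2 := by
    simp only [d, Matrix.trace_diagonal]
    rw [Fin.sum_univ_eq_sum_range (fun i => (i : ℂ)) (n + 1)]
    have := Finset.sum_range_id_mul_two (n + 1)
    have h2 : (∑ i ∈ Finset.range (n + 1), (i : ℂ)) * 2 = (n + 1) * n := by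
      have : (((∑ i ∈ Finset.range (n + 1), i) * 2 : ℕ) : ℂ) = (((n + 1) * (n + 1 - 1) : ℕ) : ℂ) :=
        congrArg _ this
      push_cast at this
      simpa using this
    linear_combination h2 / 2
  rw [← smul_eq_mul, ← Matrix.trace_smul, ← Matrix.mul_smul, hM, Matrix.mul_sub, Matrix.mul_add,
    Matrix.mul_add, Matrix.trace_sub, Matrix.trace_add, Matrix.trace_add, ← Matrix.mul_assoc,
    Matrix.trace_mul_comm, ← Matrix.mul_assoc, Matrix.mul_adjugate, ← Matrix.mul_assoc,
    Matrix.adjugate_mul, ← Matrix.mul_assoc, Matrix.adjugate_mul, Matrix.mul_smul,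
    Matrix.adjugate_mul]
  simp only [Matrix.smul_mul, Matrix.one_mul, Matrix.trace_smul, htr, hd, Matrix.trace_one,
    Fintype.card_fin, monicOrthPoly, nextCoeff_monicOf, smul_eq_mul]
  push_cast
  ring


/-! ### The deformed Laguerre weight at finite n -/

/-- The moments of the deformed Laguerre weight. -/
def weightMoment (a : ℂ) (t : ℝ) : ℕ → ℂ := fun k => shiftMoment t (k + 2) a

/-- The Hankel determinants of the deformed Laguerre weight. -/
def weightDet (a : ℂ) (n : ℕ) (t : ℝ) : ℂ := (hankel (weightMoment a t) n).det

lemma momentFunctional_weightMoment (a : ℂ) (t : ℝ) :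
    momentFunctional (weightMoment a t) = shiftFunctional t 2 a := rfl

lemma hasDerivAt_weightMoment {t : ℝ} (ht : 0 < t) (a : ℂ) (k : ℕ) :
    HasDerivAt (fun t => weightMoment a t k) (a * shiftMoment t (k + 2) (a - 1)) t :=
  hasDerivAt_shiftMoment ht _ _

lemma momentFunctional_deriv (a : ℂ) (t : ℝ) (p : ℂ[X]) :
    momentFunctional (fun k => a * shiftMoment t (k + 2) (a - 1)) p
      = a * shiftFunctional t 2 (a - 1) p := by
  rw [shiftFunctional, momentFunctional_eq_sum, momentFunctional_eq_sum, Finset.mul_sum]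
  exact Finset.sum_congr rfl fun k _ => by ring

lemma weightMoment_recurrence {t : ℝ} (ht : 0 < t) (a : ℂ) (k : ℕ) :
    (t : ℂ) * (a * shiftMoment t (k + 2) (a - 1))
      = (k + (3 + a)) * weightMoment a t k - weightMoment a t (k + 1) := by
  have h1 := shiftMoment_parts ht (k + 2) a
  have h2 := shiftMoment_add_one ht (k + 2) (a - 1)
  rw [sub_add_cancel] at h2
  unfold weightMoment
  rw [show k + 1 + 2 = k + 2 + 1 by ring]
  push_cast at h1
  linear_combination -h1 - a * h2

lemma exists_hasDerivAt_weightDet {t : ℝ} (ht : 0 < t) (a : ℂ) (n : ℕ)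
    (hD : weightDet a (n + 1) t ≠ 0) :
    ∃ D' : ℂ, HasDerivAt (weightDet a (n + 1)) D' t ∧
      t * D' = weightDet a (n + 1) t * ((n + 1) * (n + 1 + a + 2)
        + (monicOrthPoly (weightMoment a t) (n + 1)).nextCoeff) := by
  refine ⟨_, hasDerivAt_hankel_det (hasDerivAt_weightMoment ht a) (n + 1), ?_⟩
  rw [trace_adjugate_hankel hD (weightMoment_recurrence ht a), weightDet]
  ring

lemma monicOrth_of_isOrthonormalPoly {a : ℂ} {t : ℝ} (ht : 0 < t) {n : ℕ} {p : ℂ[X]}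
    (hp : IsOrthonormalPoly (weight a t) n p) :
    MonicOrth (momentFunctional (weightMoment a t)) n (C p.leadingCoeff⁻¹ * p) := by
  have hp0 : p ≠ 0 := by
    rintro rfl; have := hp.degree_eq; simp at this
  have hl : p.leadingCoeff ≠ 0 := leadingCoeff_ne_zero.2 hp0
  refine ⟨?_, ?_, fun k hk => ?_⟩
  · rw [Monic, leadingCoeff_mul, leadingCoeff_C, inv_mul_cancel₀ hl]
  · rw [natDegree_C_mul (inv_ne_zero hl)]
    exact natDegree_eq_of_degree_eq_some hp.degree_eq
  · rw [mul_assoc, ← smul_eq_C_mul, map_smul, momentFunctional_weightMoment,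
      shiftFunctional_apply ht]
    have := hp.orthogonal k hk
    simp only [weight_eq] at this
    simp only [eval_mul, eval_pow, eval_X, ← mul_assoc, this, smul_zero]

lemma exists_isOrthonormalPoly {a : ℂ} {t : ℝ} (ht : 0 < t) {n : ℕ}
    (hD : weightDet a n t ≠ 0) (hD' : weightDet a (n + 1) t ≠ 0) :
    ∃ p, IsOrthonormalPoly (weight a t) n p := by
  have hP := monicOrth_monicOrthPoly hD
  have hne := hP.norm_ne_zero hD'
  set P := monicOrthPoly (weightMoment a t) n
  set h := momentFunctional (weightMoment a t) (P * P) with hh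
  obtain ⟨g, hg⟩ := IsAlgClosed.exists_pow_nat_eq h⁻¹ (n := 2) (by norm_num)
  have hg0 : g ≠ 0 := by
    rintro rfl
    rw [zero_pow two_ne_zero] at hg
    exact inv_ne_zero hne hg.symm
  have hint : ∀ k, ∫ x in Set.Ioi (0 : ℝ), weight a t x * (C g * P).eval (x : ℂ) * (x : ℂ) ^ k
      = g * momentFunctional (weightMoment a t) (P * X ^ k) := by
    intro k
    rw [momentFunctional_weightMoment, shiftFunctional_apply ht, ← integral_const_mul]
    congr 1
    funext x
    simp only [eval_mul, eval_pow, eval_X, eval_C, weight_eq]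
    ring
  refine ⟨C g * P, ?_, fun m hm => ?_, ?_⟩
  · rw [degree_C_mul hg0, degree_eq_natDegree hP.monic.ne_zero, hP.natDegree_eq]
  · rw [hint, hP.orth m hm, mul_zero]
  · rw [hint, hP.mul_X_pow, ← hh, leadingCoeff_mul, leadingCoeff_C, hP.monic.leadingCoeff, mul_one,
      ← mul_assoc, ← sq, hg, inv_mul_cancel₀ hne]

/-- The sign left open in the choice of p_n drops out of Γ_n: division by the leading coefficient
gives the unique monic orthogonal polynomial. The second determinant ensures that its norm is
nonzero, so that p_n exists. -/
lemma bigGamma_eq {a : ℂ} {t : ℝ} (ht : 0 < t) {n : ℕ}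
    (hD : weightDet a n t ≠ 0) (hD' : weightDet a (n + 1) t ≠ 0) :
    bigGamma a t n = (monicOrthPoly (weightMoment a t) n).nextCoeff := by
  have hex := exists_isOrthonormalPoly ht hD hD'
  have hp : IsOrthonormalPoly (weight a t) n (orthoPoly a t n) := by
    unfold orthoPoly
    rw [dif_pos hex]
    exact hex.choose_spec
  have hP := monicOrth_of_isOrthonormalPoly ht hp
  rw [← hP.unique hD (monicOrth_monicOrthPoly hD), bigGamma]
  set p := orthoPoly a t n
  have hp0 : p ≠ 0 := by
    intro h0; have := hp.degree_eq; rw [h0] at this; simp at this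
  have hl : p.leadingCoeff ≠ 0 := leadingCoeff_ne_zero.2 hp0
  rw [nextCoeff, nextCoeff, natDegree_C_mul (inv_ne_zero hl)]
  split_ifs
  · simp
  · rw [coeff_C_mul, div_eq_inv_mul]

/-- The finite-`n` differential relations for `H = N (N + a + 2) + Γ_N`. -/
lemma finite_relations {a : ℂ} {t : ℝ} (ht : 0 < t) {n : ℕ} (h0 : weightDet a n t ≠ 0)
    (h1 : weightDet a (n + 1) t ≠ 0) (h2 : weightDet a (n + 2) t ≠ 0)
    {H H1 : ℝ → ℂ} {H2 c : ℂ}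
    (hH : ∀ᶠ τ in 𝓝 t, H τ = c + (monicOrthPoly (weightMoment a τ) (n + 1)).nextCoeff)
    (hH1 : ∀ᶠ τ in 𝓝 t, HasDerivAt H (H1 τ) τ) (hH2 : HasDerivAt H1 H2 t) :
    ∃ R R' β : ℂ, β ≠ 0 ∧ β = t * H1 t - H t + c ∧ t * H2 = β * (R - R') ∧
      β * (R * R') = H1 t ^ 2 + a * H1 t ∧
      β * ((1 - R) * (1 - R')) = (n + 1 - H1 t) * (n + 3 - H1 t) ∧
      ∀ P', MonicOrth (momentFunctional (weightMoment a t)) (n + 2) P' →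
        t * R = 2 * (n + 1) + 3 + a
          - ((monicOrthPoly (weightMoment a t) (n + 1)).nextCoeff - P'.nextCoeff) := by
  have hm : ∀ τ : ℝ, 0 < τ → ∀ k, HasDerivAt (fun t => weightMoment a t k)
    (a * shiftMoment τ (k + 2) (a - 1)) τ := fun τ hτ => hasDerivAt_weightMoment hτ a
  -- facts valid for all nearby parameters
  have hnear : ∀ᶠ τ in 𝓝 t, 0 < τ ∧ weightDet a n τ ≠ 0 ∧ weightDet a (n + 1) τ ≠ 0 := by
    filter_upwards [lt_mem_nhds ht, eventually_hankel_det_ne_zero (hm t ht) h0,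
      eventually_hankel_det_ne_zero (hm t ht) h1] with τ e1 e2 e3 using ⟨e1, e2, e3⟩
  let P : ℝ → ℂ[X] := fun τ => monicOrthPoly (weightMoment a τ) (n + 1)
  let Q : ℝ → ℂ[X] := fun τ => monicOrthPoly (weightMoment a τ) n
  let L : ℝ → ℂ[X] →ₗ[ℂ] ℂ := fun τ => momentFunctional (weightMoment a τ)
  let K : ℝ → ℂ[X] →ₗ[ℂ] ℂ := fun τ => shiftFunctional τ 2 (a - 1)
  -- Needed in a neighbourhood of t, because the formula for β is differentiated below.
  have rel : ∀ᶠ τ in 𝓝 t, H1 τ = -(a * K τ (P τ * Q τ) / L τ (Q τ * Q τ)) ∧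
      L τ (P τ * P τ) / L τ (Q τ * Q τ) = τ * H1 τ - H τ + c := by
    filter_upwards [hnear, hH.eventually_nhds, hH1] with τ hτ hHτ hH1τ
    obtain ⟨hτ0, hD0, hD1⟩ := hτ
    have hP := monicOrth_monicOrthPoly hD1
    have hQ := monicOrth_monicOrthPoly hD0
    have hQne := hQ.norm_ne_zero hD1
    have hΓ := (hasDerivAt_nextCoeff (hm τ hτ0) hD0 hD1).const_add c
    have e1 := hH1τ.unique (hΓ.congr_of_eventuallyEq hHτ)
    rw [momentFunctional_deriv] at e1
    refine ⟨e1, ?_⟩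
    have hX := (semiclassical_shiftFunctional hτ0 a).X_mul_parts hP hQ
    rw [← momentFunctional_weightMoment] at hX
    rw [e1, hHτ.self_of_nhds]
    simp only [L, P, Q]
    rw [hX]
    field_simp
    ring
  have hP := monicOrth_monicOrthPoly h1
  have hQ := monicOrth_monicOrthPoly h0
  have hQne : L t (Q t * Q t) ≠ 0 := hQ.norm_ne_zero h1
  have hPne : L t (P t * P t) ≠ 0 := hP.norm_ne_zero h2
  have hsc := semiclassical_shiftFunctional ht a
  obtain ⟨r1, r2⟩ := rel.self_of_nhds
  refine ⟨a * K t (P t * P t) / L t (P t * P t), a * K t (Q t * Q t) / L t (Q t * Q t),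
    L t (P t * P t) / L t (Q t * Q t), div_ne_zero hPne hQne, r2, ?_, ?_, ?_, ?_⟩
  -- As a ratio of norms β has logarithmic derivative R - R'; as tH' - H + c it has derivative tH''.
  · have d1 := hasDerivAt_norm_monicOrthPoly (hm t ht) h1
    have d2 := hasDerivAt_norm_monicOrthPoly (hm t ht) h0
    rw [momentFunctional_deriv] at d1 d2
    have d3 := d1.div d2 hQne
    have d4 : HasDerivAt (fun τ : ℝ => (τ : ℂ) * H1 τ - H τ + c) (t * H2) t := by
      have := ((((hasDerivAt_id t).ofReal_comp).mul hH2).sub hH1.self_of_nhds).add_const c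
      refine this.congr_deriv ?_
      simp
    have d5 := d4.unique (d3.congr_of_eventuallyEq
      (rel.mono fun τ h => h.2.symm))
    rw [d5]
    change (a * K t (P t * P t) * L t (Q t * Q t) - L t (P t * P t) * (a * K t (Q t * Q t)))
      / L t (Q t * Q t) ^ 2 = _
    field_simp
  -- Quotient identity at the point -t.
  · have hq := quotient_identity hsc.shift hP hQ
    change K t (P t * P t) * K t (Q t * Q t)
      = K t (P t * Q t) * (K t (P t * Q t) - L t (Q t * Q t)) at hq
    rw [r1]
    field_simp
    linear_combination a ^ 2 * hq
  -- Quotient identity at 0, with the values of N rewritten through K by integration by parts.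
  · have hq := quotient_identity hsc.origin hP hQ
    have s1 := hsc.sq_parts hP
    have s2 := hsc.sq_parts hQ
    have s3 := hsc.mul_parts hP hQ
    set N := shiftFunctional t 1 a
    change N (P t * P t) * N (Q t * Q t)
      = N (P t * Q t) * (N (P t * Q t) - L t (Q t * Q t)) at hq
    change 2 * N (P t * P t) + a * K t (P t * P t) = L t (P t * P t) at s1
    change 2 * N (Q t * Q t) + a * K t (Q t * Q t) = L t (Q t * Q t) at s2
    change (n + 1) * L t (Q t * Q t) + 2 * N (P t * Q t) + a * K t (P t * Q t) = 0 at s3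
    have e1 : 1 - a * K t (P t * P t) / L t (P t * P t)
        = 2 * N (P t * P t) / L t (P t * P t) := by
      field_simp; linear_combination -s1
    have e2 : 1 - a * K t (Q t * Q t) / L t (Q t * Q t)
        = 2 * N (Q t * Q t) / L t (Q t * Q t) := by
      field_simp; linear_combination -s2
    have e3 : (n + 1 - H1 t) = -(2 * N (P t * Q t)) / L t (Q t * Q t) := by
      rw [r1]; field_simp; linear_combination s3
    have e4 : (n + 3 - H1 t) = -(2 * N (P t * Q t)) / L t (Q t * Q t) + 2 := by
      rw [← e3]; ring
    rw [e1, e2, e3, e4]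
    field_simp
    linear_combination hq
  · intro P' hP'
    have s1 := hsc.X_mul_sq_parts hP
    have s2 := hP.nextCoeff_sub hP'
    rw [← momentFunctional_weightMoment] at s1
    rw [s2] at s1
    change (2 * ((n + 1 : ℕ) : ℂ) + 3 + a) * L t (P t * P t) - t * (a * K t (P t * P t))
      = ((P t).nextCoeff - P'.nextCoeff) * L t (P t * P t) at s1
    push_cast at s1
    change _ = 2 * ((n : ℂ) + 1) + 3 + a - ((P t).nextCoeff - P'.nextCoeff)
    field_simp
    linear_combination -s1


/-! ### Incomplete Gamma integrals and a determinant with rank-one derivative -/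

/-- The integrand `e^{-y} y^b` of the Gamma function. -/
def gammaIntegrand (b : ℂ) (y : ℝ) : ℂ := ((Real.exp (-y) : ℝ) : ℂ) * (y : ℂ) ^ b

lemma integrableOn_gammaIntegrand {b : ℂ} (hb : -1 < b.re) :
    IntegrableOn (gammaIntegrand b) (Set.Ioi 0) := by
  have := Complex.GammaIntegral_convergent (s := b + 1) (by simp; linarith)
  refine this.congr_fun (fun x _ => ?_) measurableSet_Ioi
  simp [gammaIntegrand]

lemma integral_gammaIntegrand {b : ℂ} (hb : -1 < b.re) :
    ∫ y in Set.Ioi 0, gammaIntegrand b y = Complex.Gamma (b + 1) := by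
  rw [Complex.Gamma_eq_integral (by simp; linarith), Complex.GammaIntegral]
  simp [gammaIntegrand]

/-- The lower incomplete Gamma integral. -/
def lowerGamma (b : ℂ) (t : ℝ) : ℂ := ∫ y in (0 : ℝ)..t, gammaIntegrand b y

lemma exp_mul_shiftMoment {b : ℂ} (hb : -1 < b.re) {t : ℝ} (ht : 0 < t) :
    ((Real.exp (-t) : ℝ) : ℂ) * shiftMoment t 0 b = Complex.Gamma (b + 1) - lowerGamma b t := by
  have h1 : ((Real.exp (-t) : ℝ) : ℂ) * shiftMoment t 0 b
      = ∫ x in Set.Ioi (0 : ℝ), gammaIntegrand b (x + t) := by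
    rw [shiftMoment, ← integral_const_mul]
    congr 1
    funext x
    rw [shiftIntegrand, gammaIntegrand, neg_add, Real.exp_add]
    push_cast; ring
  have h2 : ∫ x in Set.Ioi (0 : ℝ), gammaIntegrand b (x + t)
      = ∫ y in Set.Ioi t, gammaIntegrand b y := by
    rw [← (measurePreserving_add_right volume t).setIntegral_preimage_emb
      (measurableEmbedding_addRight t) (gammaIntegrand b) (Set.Ioi t)]
    simp
  have h3 := intervalIntegral.integral_interval_add_Ioi (a := 0) (b := t) (μ := volume)
    (f := gammaIntegrand b) (integrableOn_gammaIntegrand hb)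
    ((integrableOn_gammaIntegrand hb).mono_set (Set.Ioi_subset_Ioi ht.le))
  rw [h1, h2, ← integral_gammaIntegrand hb, ← h3, lowerGamma]
  ring

lemma hasDerivAt_lowerGamma {b : ℂ} (hb : -1 < b.re) {t : ℝ} (ht : 0 < t) :
    HasDerivAt (lowerGamma b) (gammaIntegrand b t) t := by
  have hc : ∀ y : ℝ, 0 < y → ContinuousAt (gammaIntegrand b) y := fun y hy =>
    ContinuousAt.mul (by fun_prop) (hasDerivAt_ofReal_cpow hy b).continuousAt
  refine intervalIntegral.integral_hasDerivAt_right ?_ ?_ (hc t ht)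
  · rw [intervalIntegrable_iff_integrableOn_Ioc_of_le ht.le]
    exact (integrableOn_gammaIntegrand hb).mono_set Set.Ioc_subset_Ioi_self
  · exact ContinuousAt.stronglyMeasurableAtFilter (s := Set.Ioi 0) isOpen_Ioi hc t ht

/-- The entire function `∫₀¹ u^b e^{-zu} du`. -/
def expMoment (b : ℂ) (z : ℂ) : ℂ := ∫ u in (0 : ℝ)..1, (u : ℂ) ^ b * Complex.exp (-(z * u))

/-- Separates the branch point at 0 from an entire factor; this is what allows complex s later. -/
lemma lowerGamma_eq {b : ℂ} {t : ℝ} (ht : 0 < t) :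
    lowerGamma b t = (t : ℂ) ^ (b + 1) * expMoment b t := by
  have h := intervalIntegral.integral_comp_mul_left (gammaIntegrand b) ht.ne' (a := 0) (b := 1)
  rw [mul_zero, mul_one] at h
  have h1 : lowerGamma b t = t * ∫ x in (0 : ℝ)..1, gammaIntegrand b (t * x) := by
    rw [h, lowerGamma, Complex.real_smul, ← mul_assoc, Complex.ofReal_inv,
      mul_inv_cancel₀ (by exact_mod_cast ht.ne'), one_mul]
  rw [h1, expMoment, Complex.cpow_add _ _ (by exact_mod_cast ht.ne'), Complex.cpow_one,
    mul_comm ((t : ℂ) ^ b), mul_assoc, ← intervalIntegral.integral_const_mul ((t : ℂ) ^ b)]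
  congr 1
  refine intervalIntegral.integral_congr fun u hu => ?_
  rw [Set.uIcc_of_le zero_le_one] at hu
  simp only [gammaIntegrand]
  push_cast
  rw [Complex.mul_cpow_ofReal_nonneg ht.le hu.1]
  ring

lemma intervalIntegrable_expMoment {b : ℂ} (hb : -1 < b.re) (z : ℂ) :
    IntervalIntegrable (fun u : ℝ => (u : ℂ) ^ b * Complex.exp (-(z * u))) volume 0 1 :=
  (intervalIntegral.intervalIntegrable_cpow' hb).mul_continuousOn (by fun_prop)

lemma norm_expMoment_integrand_le (b z : ℂ) {u : ℝ} (hu : u ∈ Set.Ioc (0 : ℝ) 1) :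
    ‖(u : ℂ) ^ b * Complex.exp (-(z * u))‖ ≤ Real.exp ‖z‖ * u ^ b.re := by
  rw [norm_mul, Complex.norm_cpow_eq_rpow_re_of_pos hu.1, mul_comm]
  refine mul_le_mul_of_nonneg_right ?_ (Real.rpow_nonneg hu.1.le _)
  refine (Complex.norm_exp_le_exp_norm _).trans (Real.exp_le_exp.2 ?_)
  rw [norm_neg, norm_mul, Complex.norm_real, Real.norm_of_nonneg hu.1.le]
  exact mul_le_of_le_one_right (norm_nonneg _) hu.2

lemma norm_expMoment_le {b : ℂ} (hb : -1 < b.re) (z : ℂ) :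
    ‖expMoment b z‖ ≤ Real.exp ‖z‖ / (b.re + 1) := by
  have h := intervalIntegral.norm_integral_le_of_norm_le (μ := volume) (a := 0) (b := 1)
    (f := fun u : ℝ => (u : ℂ) ^ b * Complex.exp (-(z * u)))
    (g := fun u : ℝ => Real.exp ‖z‖ * u ^ b.re) zero_le_one
    (Eventually.of_forall fun u hu => norm_expMoment_integrand_le b z hu)
    ((intervalIntegral.intervalIntegrable_rpow' hb).const_mul _)
  refine h.trans (le_of_eq ?_)
  rw [intervalIntegral.integral_const_mul, integral_rpow (Or.inl hb), Real.one_rpow,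
    Real.zero_rpow (by linarith)]
  ring

lemma hasDerivAt_expMoment {b : ℂ} (hb : -1 < b.re) (z : ℂ) :
    HasDerivAt (expMoment b) (-expMoment (b + 1) z) z := by
  have hb1 : -1 < (b + 1).re := by simp; linarith
  have key := intervalIntegral.hasDerivAt_integral_of_dominated_loc_of_deriv_le
    (𝕜 := ℂ) (μ := volume) (a := 0) (b := 1)
    (F := fun z (u : ℝ) => (u : ℂ) ^ b * Complex.exp (-(z * u))) (x₀ := z)
    (F' := fun z (u : ℝ) => -((u : ℂ) ^ (b + 1) * Complex.exp (-(z * u))))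
    (s := Metric.ball z 1) (Metric.ball_mem_nhds z one_pos)
    (bound := fun u => Real.exp (‖z‖ + 1) * u ^ (b + 1).re) ?_ ?_ ?_ ?_ ?_ ?_
  · have := key.2
    rwa [intervalIntegral.integral_neg] at this
  · exact Eventually.of_forall fun z =>
      (intervalIntegrable_iff.1 (intervalIntegrable_expMoment hb z)).aestronglyMeasurable
  · exact intervalIntegrable_expMoment hb z
  · exact (intervalIntegrable_iff.1 (intervalIntegrable_expMoment hb1 z)).aestronglyMeasurable.neg
  · refine Eventually.of_forall fun u hu w hw => ?_
    rw [Set.uIoc_of_le zero_le_one] at hu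
    rw [norm_neg]
    refine (norm_expMoment_integrand_le _ _ hu).trans ?_
    refine mul_le_mul_of_nonneg_right (Real.exp_le_exp.2 ?_) (Real.rpow_nonneg hu.1.le _)
    have : ‖w - z‖ < 1 := by simpa [dist_eq_norm] using hw
    linarith [norm_le_norm_add_norm_sub' w z]
  · exact (intervalIntegral.intervalIntegrable_rpow' hb1).const_mul _
  · refine Eventually.of_forall fun u hu w hw => ?_
    rw [Set.uIoc_of_le zero_le_one] at hu
    have h1 : HasDerivAt (fun w : ℂ => Complex.exp (-(w * u)))
        (Complex.exp (-(w * u)) * -(1 * u)) w :=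
      (((hasDerivAt_id w).mul_const (u : ℂ)).neg).cexp
    refine (h1.const_mul ((u : ℂ) ^ b)).congr_deriv ?_
    rw [Complex.cpow_add _ _ (by exact_mod_cast hu.1.ne'), Complex.cpow_one]
    ring

lemma expMoment_zero {b : ℂ} (hb : -1 < b.re) : expMoment b 0 = 1 / (b + 1) := by
  have h0 : b + 1 ≠ 0 := fun h => by
    have := congrArg Complex.re h; simp at this; linarith
  simp only [expMoment, zero_mul, neg_zero, Complex.exp_zero, mul_one]
  rw [integral_cpow (Or.inl hb)]
  simp [Complex.zero_cpow h0]

/-- The matrix `∫_t^∞ y^{j+k+a} e^{-y} dy` of incomplete moments. -/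
def upperMatrix (a : ℂ) (n : ℕ) (t : ℝ) : Matrix (Fin (n + 1)) (Fin (n + 1)) ℂ :=
  Matrix.of fun j k => Complex.Gamma (((j : ℕ) + (k : ℕ) : ℕ) + a + 1)
    - lowerGamma (((j : ℕ) + (k : ℕ) : ℕ) + a) t

/-- The unipotent matrix of the substitution `y = x + t`. -/
def shiftMatrix (n : ℕ) (t : ℂ) : Matrix (Fin (n + 1)) (Fin (n + 1)) ℂ :=
  Matrix.of fun j i => (Nat.choose j i : ℂ) * t ^ ((j : ℕ) - i)

lemma det_shiftMatrix (n : ℕ) (t : ℂ) : (shiftMatrix n t).det = 1 := by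
  rw [Matrix.det_of_isLowerTriangular]
  · simp [shiftMatrix]
  · intro i j hij
    have : (i : ℕ) < j := hij
    simp [shiftMatrix, Nat.choose_eq_zero_of_lt this]

lemma add_pow_shift (n : ℕ) (x t : ℂ) (j : Fin (n + 1)) :
    (x + t) ^ (j : ℕ) = ∑ i : Fin (n + 1), shiftMatrix n t j i * x ^ (i : ℕ) := by
  rw [add_pow]
  simp only [shiftMatrix, Matrix.of_apply]
  rw [Fin.sum_univ_eq_sum_range (fun i => (Nat.choose j i : ℂ) * t ^ ((j : ℕ) - i) * x ^ i) (n + 1)]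
  rw [← Finset.sum_subset (s₁ := Finset.range (j + 1))
    (Finset.range_mono (by omega : (j : ℕ) + 1 ≤ n + 1))]
  · exact Finset.sum_congr rfl fun i _ => by ring
  · intro i _ hi
    rw [Nat.choose_eq_zero_of_lt (by simpa using hi)]; simp

lemma re_natCast_add {a : ℂ} (ha : -1 < a.re) (p : ℕ) : -1 < ((p : ℂ) + a).re := by
  have : (0 : ℝ) ≤ p := p.cast_nonneg
  simp; linarith

lemma shiftMoment_expand {a : ℂ} {n : ℕ} {t : ℝ} (ht : 0 < t)
    (j k : Fin (n + 1)) :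
    shiftMoment t 0 (((j : ℕ) + (k : ℕ) : ℕ) + a)
      = ∑ i, ∑ l, shiftMatrix n t j i * shiftMatrix n t k l * shiftMoment t ((i : ℕ) + l) a := by
  have hint := fun i : ℕ => integrableOn_shiftIntegrand ht i a
  have h : ∀ x ∈ Set.Ioi (0 : ℝ), shiftIntegrand t 0 (((j : ℕ) + (k : ℕ) : ℕ) + a) x
      = ∑ i, ∑ l, shiftMatrix n t j i * shiftMatrix n t k l
        * shiftIntegrand t ((i : ℕ) + l) a x := by
    intro x hx
    have hx' : ((x + t : ℝ) : ℂ) ≠ 0 := by exact_mod_cast (add_pos hx ht).ne'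
    simp only [shiftIntegrand]
    rw [Complex.cpow_add _ _ hx', Complex.cpow_natCast, pow_add]
    have e1 := add_pow_shift n x t j
    have e2 := add_pow_shift n x t k
    push_cast
    rw [e1, e2, Finset.sum_mul_sum]
    simp only [Finset.sum_mul, Finset.mul_sum]
    refine Finset.sum_congr rfl fun i _ => Finset.sum_congr rfl fun l _ => ?_
    rw [pow_add]; ring
  rw [shiftMoment, setIntegral_congr_fun measurableSet_Ioi h,
    integral_finsetSum _ fun i _ => integrable_finsetSum _ fun l _ => (hint _).const_mul _]
  refine Finset.sum_congr rfl fun i _ => ?_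
  rw [integral_finsetSum _ fun l _ => (hint _).const_mul _]
  exact Finset.sum_congr rfl fun l _ => integral_const_mul _ _

/-- Substitute y = x + t and expand (x+t)^j and (x+t)^k by the binomial theorem: a congruence by a
unipotent matrix. -/
lemma upperMatrix_eq {a : ℂ} (ha : -1 < a.re) {n : ℕ} {t : ℝ} (ht : 0 < t) :
    upperMatrix a n t = ((Real.exp (-t) : ℝ) : ℂ) •
      (shiftMatrix n t * (Matrix.of fun i l : Fin (n + 1) => shiftMoment t ((i : ℕ) + l) a)
        * (shiftMatrix n t).transpose) := by
  ext j k
  rw [Matrix.smul_apply, Matrix.mul_apply, upperMatrix, Matrix.of_apply,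
    ← exp_mul_shiftMoment (re_natCast_add ha _) ht, shiftMoment_expand ht, smul_eq_mul]
  congr 1
  simp only [Matrix.mul_apply, Matrix.of_apply, Matrix.transpose_apply, Finset.sum_mul]
  rw [Finset.sum_comm]
  exact Finset.sum_congr rfl fun l _ => Finset.sum_congr rfl fun i _ => by ring

/-- Moving the lower limit of integration changes the matrix by -t^a e^{-t} vvᵀ with v_j = t^j.
Since v is the image of the first basis vector under the unipotent matrix, Jacobi's formula leaves a
single cofactor, the Hankel determinant with x² added to the weight. -/
lemma hasDerivAt_det_upperMatrix {a : ℂ} (ha : -1 < a.re) (n : ℕ) {t : ℝ} (ht : 0 < t) :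
    HasDerivAt (fun t => (upperMatrix a n t).det)
      (-((t : ℂ) ^ a * ((Real.exp (-t) : ℝ) : ℂ) ^ (n + 1) * weightDet a n t)) t := by
  let v : Fin (n + 1) → ℂ := fun j => (t : ℂ) ^ (j : ℕ)
  have hd := hasDerivAt_det (M := upperMatrix a n) (t := t)
    (M' := (-((t : ℂ) ^ a * ((Real.exp (-t) : ℝ) : ℂ))) • Matrix.vecMulVec v v) (fun j k => by
      have := (hasDerivAt_lowerGamma (re_natCast_add ha ((j : ℕ) + k)) ht).const_sub
        (Complex.Gamma (((j : ℕ) + (k : ℕ) : ℕ) + a + 1))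
      refine this.congr_deriv ?_
      rw [gammaIntegrand, Complex.cpow_add _ _ (by exact_mod_cast ht.ne'), Complex.cpow_natCast,
        pow_add]
      simp only [Matrix.smul_apply, Matrix.vecMulVec_apply, smul_eq_mul, v]
      ring)
  refine hd.congr_deriv ?_
  set N := Matrix.of fun i l : Fin (n + 1) => shiftMoment t ((i : ℕ) + l) a
  set U := shiftMatrix n t
  have hv : v = U.mulVec (Pi.single 0 1) := by
    funext j
    rw [Matrix.mulVec_single_one]
    simp [v, U, shiftMatrix]
  have hadjv : U.adjugate.mulVec v = Pi.single 0 1 := by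
    rw [hv, Matrix.mulVec_mulVec, Matrix.adjugate_mul, det_shiftMatrix, one_smul,
      Matrix.one_mulVec]
  -- Deleting the first row and column raises both indices by one, which is the factor x² of the
  -- weight.
  have hN : N.adjugate 0 0 = weightDet a n t := by
    rw [Matrix.adjugate_fin_succ_eq_det_submatrix]
    simp only [Fin.val_zero, add_zero, pow_zero, one_mul]
    rw [weightDet]
    congr 1
    ext i l
    simp only [N, hankel, weightMoment, Matrix.submatrix_apply, Matrix.of_apply,
      Fin.zero_succAbove, Fin.val_succ]
    congr 1
    omega
  have hM : (upperMatrix a n t).adjugate = ((Real.exp (-t) : ℝ) : ℂ) ^ n •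
      (U.adjugate.transpose * (N.adjugate * U.adjugate)) := by
    rw [upperMatrix_eq ha ht, Matrix.adjugate_smul, Matrix.adjugate_mul_distrib,
      Matrix.adjugate_mul_distrib, Matrix.adjugate_transpose, Fintype.card_fin]
    rfl
  have htr : Matrix.trace ((upperMatrix a n t).adjugate * Matrix.vecMulVec v v)
      = ((Real.exp (-t) : ℝ) : ℂ) ^ n * weightDet a n t := by
    rw [hM, Matrix.smul_mul, Matrix.trace_smul, Matrix.mul_vecMulVec, Matrix.trace_vecMulVec,
      ← Matrix.mulVec_mulVec, ← Matrix.mulVec_mulVec, hadjv, dotProduct_comm,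
      Matrix.dotProduct_mulVec, Matrix.vecMul_transpose, hadjv, ← hN, smul_eq_mul]
    simp
  rw [Matrix.mul_smul, Matrix.trace_smul, htr, smul_eq_mul]
  ring


/-! ### Inverting the Gamma Hankel matrix; the finite-n Fredholm expansion -/

lemma gamma_ne_zero {a : ℂ} (ha : -1 < a.re) (p : ℕ) : Complex.Gamma ((p : ℂ) + a + 1) ≠ 0 := by
  apply Complex.Gamma_ne_zero_of_re_pos
  have := re_natCast_add ha p
  rw [Complex.add_re, Complex.one_re]; linarith

lemma gamma_succ {a : ℂ} (ha : -1 < a.re) (p : ℕ) :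
    Complex.Gamma (((p + 1 : ℕ) : ℂ) + a + 1) = (p + a + 1) * Complex.Gamma ((p : ℂ) + a + 1) := by
  rw [← Complex.Gamma_add_one]
  · congr 1; push_cast; ring
  · intro h
    have := congrArg Complex.re h
    have h2 := re_natCast_add ha p
    simp at this h2; linarith

/-- `l! / Γ(l + a + 1)`. -/
def factGamma (a : ℂ) (l : ℕ) : ℂ := (l.factorial : ℂ) / Complex.Gamma ((l : ℂ) + a + 1)

lemma factGamma_succ {a : ℂ} (ha : -1 < a.re) (l : ℕ) :
    (l + 1 + a) * factGamma a (l + 1) = (l + 1) * factGamma a l := by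
  have h1 := gamma_ne_zero ha l
  have h2 := gamma_ne_zero ha (l + 1)
  have h3 := gamma_succ ha l
  have h4 : (l : ℂ) + a + 1 ≠ 0 := fun h => by rw [h3, h, zero_mul] at h2; exact h2 rfl
  rw [factGamma, factGamma, h3, Nat.factorial_succ]
  push_cast
  field_simp
  ring

/-- Pascal's rule in j produces an extra sum with k.choose (l+1); absorption identities for both
binomials and the recursion of `factGamma` turn it into k times the original sum. -/
lemma vandermonde_step {a : ℂ} (ha : -1 < a.re) (j k : ℕ) :
    (j + a + 1) * ∑ l ∈ Finset.range (k + 1), ((j + 1).choose l : ℂ) * (k.choose l) * factGamma a l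
      = (j + k + a + 1) * ∑ l ∈ Finset.range (k + 1), (j.choose l : ℂ) * (k.choose l)
        * factGamma a l := by
  have e1 : ∑ l ∈ Finset.range (k + 1), ((j + 1).choose l : ℂ) * (k.choose l) * factGamma a l
      = ∑ l ∈ Finset.range (k + 1), (j.choose l : ℂ) * (k.choose l) * factGamma a l
        + ∑ l ∈ Finset.range k, (j.choose l : ℂ) * (k.choose (l + 1)) * factGamma a (l + 1) := by
    rw [Finset.sum_range_succ', Finset.sum_range_succ' _ k, add_right_comm,
      ← Finset.sum_add_distrib]
    congr 1
    · refine Finset.sum_congr rfl fun l _ => ?_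
      rw [Nat.choose_succ_succ]; push_cast; ring
    · simp
  have e2 : (k : ℂ) * ∑ l ∈ Finset.range (k + 1), (j.choose l : ℂ) * (k.choose l) * factGamma a l
      = ∑ l ∈ Finset.range k, (j + a + 1) * ((j.choose l : ℂ) * (k.choose (l + 1))
          * factGamma a (l + 1)) := by
    have e3 : (k : ℂ) * ∑ l ∈ Finset.range (k + 1), (j.choose l : ℂ) * (k.choose l) * factGamma a l
        = ∑ l ∈ Finset.range (k + 1), (j.choose l : ℂ) * ((l + 1) * k.choose (l + 1))
            * factGamma a l
          + ∑ l ∈ Finset.range (k + 1), (l * (j.choose l : ℂ)) * k.choose l * factGamma a l := by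
      rw [Finset.mul_sum, ← Finset.sum_add_distrib]
      refine Finset.sum_congr rfl fun l hl => ?_
      have hlk : l ≤ k := Nat.lt_succ_iff.1 (Finset.mem_range.1 hl)
      have h : ((k.choose (l + 1) : ℕ) : ℂ) * (l + 1) = k.choose l * (k - l) := by
        have := Nat.choose_succ_right_eq k l
        rw [← Nat.cast_sub hlk]
        exact_mod_cast this
      rw [mul_comm ((l : ℂ) + 1), h]; ring
    rw [e3, Finset.sum_range_succ, Finset.sum_range_succ' _ k, Nat.choose_succ_self]
    simp only [Nat.cast_zero, mul_zero, zero_mul, add_zero]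
    rw [← Finset.sum_add_distrib]
    refine Finset.sum_congr rfl fun l _ => ?_
    have h2 := factGamma_succ ha l
    have h : ((l + 1 : ℕ) : ℂ) * (j.choose (l + 1) : ℂ) = (j.choose l : ℂ) * (j - l) := by
      rcases le_or_gt l j with hlj | hlj
      · have := Nat.choose_succ_right_eq j l
        rw [← Nat.cast_sub hlj, mul_comm]
        exact_mod_cast this
      · rw [Nat.choose_eq_zero_of_lt hlj, Nat.choose_eq_zero_of_lt (by omega)]; simp
    rw [h]
    linear_combination -(j.choose l : ℂ) * k.choose (l + 1) * h2
  rw [← Finset.mul_sum] at e2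
  rw [e1]
  linear_combination -e2

/-- Chu–Vandermonde in a form symmetric in j and k: it exhibits the Gamma Hankel matrix as A·d·Aᵀ
with A triangular and binomial, hence invertible in closed form. -/
lemma gamma_add_eq {a : ℂ} (ha : -1 < a.re) (j k : ℕ) :
    Complex.Gamma (((j + k : ℕ) : ℂ) + a + 1)
      = Complex.Gamma ((j : ℂ) + a + 1) * Complex.Gamma ((k : ℂ) + a + 1)
        * ∑ l ∈ Finset.range (k + 1), (j.choose l : ℂ) * (k.choose l) * factGamma a l := by
  induction j with
  | zero =>
    rw [Finset.sum_range_succ', Finset.sum_eq_zero]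
    · have := gamma_ne_zero ha 0
      simp [factGamma] at this ⊢
      field_simp
    · intro l _; simp
  | succ j ih =>
    rw [show j + 1 + k = j + k + 1 by ring, gamma_succ ha, ih, gamma_succ ha]
    have := vandermonde_step ha j k
    push_cast
    linear_combination -Complex.Gamma ((j : ℂ) + a + 1) * Complex.Gamma ((k : ℂ) + a + 1) * this

/-- The Hankel matrix of Gamma values. -/
def gammaMatrix (a : ℂ) (n : ℕ) : Matrix (Fin (n + 1)) (Fin (n + 1)) ℂ :=
  Matrix.of fun j k => Complex.Gamma (((j : ℕ) + (k : ℕ) : ℕ) + a + 1)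

/-- The sums `Σ_{l ≤ n} C(l,j) C(l,m) Γ(l+a+1)/l!`. -/
def binomGammaSum (a : ℂ) (n j m : ℕ) : ℂ :=
  ∑ l ∈ Finset.range (n + 1), (l.choose j : ℂ) * (l.choose m) * (factGamma a l)⁻¹

/-- The inverse of `gammaMatrix`. -/
def gammaMatrixInv (a : ℂ) (n : ℕ) : Matrix (Fin (n + 1)) (Fin (n + 1)) ℂ :=
  Matrix.of fun j m => (-1) ^ ((j : ℕ) + m) * binomGammaSum a n j m
    / (Complex.Gamma ((j : ℕ) + a + 1) * Complex.Gamma ((m : ℕ) + a + 1))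

lemma sum_choose_alternating (n : ℕ) (i j : Fin (n + 1)) :
    ∑ l : Fin (n + 1), (Nat.choose i l : ℂ) * ((-1) ^ ((l : ℕ) + j) * (Nat.choose l j : ℂ))
      = if i = j then 1 else 0 := by
  have h : (X ^ (i : ℕ) : ℂ[X]) = ((X + C (-1)) + 1) ^ (i : ℕ) := by simp
  have h2 := congrArg (fun p : ℂ[X] => p.coeff j) h
  simp only [add_pow (X + C (-1 : ℂ)), one_pow, mul_one, finsetSum_coeff, coeff_X_pow] at h2
  have h3 : (if i = j then (1 : ℂ) else 0) = if (j : ℕ) = i then 1 else 0 := by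
    simp only [Fin.ext_iff, eq_comm]
  rw [h3, h2]
  rw [Fin.sum_univ_eq_sum_range (fun l => (Nat.choose i l : ℂ) * ((-1) ^ (l + (j : ℕ))
    * (Nat.choose l j : ℂ))) (n + 1)]
  rw [← Finset.sum_subset (s₁ := Finset.range ((i : ℕ) + 1))
    (Finset.range_mono (by omega : (i : ℕ) + 1 ≤ n + 1))]
  · refine Finset.sum_congr rfl fun l _ => ?_
    rw [← C_eq_natCast, coeff_mul_C, coeff_X_add_C_pow]
    rcases le_or_gt (j : ℕ) l with hl | hl
    · have : l + (j : ℕ) = (l - j) + 2 * j := by omega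
      rw [this, pow_add, pow_mul]; simp; ring
    · rw [Nat.choose_eq_zero_of_lt hl]; simp
  · intro l _ hl
    rw [Nat.choose_eq_zero_of_lt (by simpa using hl)]; simp

lemma gammaMatrixInv_mul {a : ℂ} (ha : -1 < a.re) (n : ℕ) :
    gammaMatrixInv a n * gammaMatrix a n = 1 := by
  let A : Matrix (Fin (n + 1)) (Fin (n + 1)) ℂ :=
    Matrix.of fun j l => Complex.Gamma ((j : ℕ) + a + 1) * (Nat.choose j l : ℂ)
  let B : Matrix (Fin (n + 1)) (Fin (n + 1)) ℂ :=
    Matrix.of fun l j => (-1) ^ ((l : ℕ) + j) * (Nat.choose l j : ℂ)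
      / Complex.Gamma ((j : ℕ) + a + 1)
  let d : Matrix (Fin (n + 1)) (Fin (n + 1)) ℂ := Matrix.diagonal fun l => factGamma a l
  let d' : Matrix (Fin (n + 1)) (Fin (n + 1)) ℂ := Matrix.diagonal fun l => (factGamma a l)⁻¹
  have hf : ∀ l, factGamma a l ≠ 0 := fun l =>
    div_ne_zero (by exact_mod_cast l.factorial_ne_zero) (gamma_ne_zero ha l)
  have hM : gammaMatrix a n = A * d * A.transpose := by
    ext j k
    rw [Matrix.mul_apply, gammaMatrix, Matrix.of_apply, gamma_add_eq ha]
    simp only [d, Matrix.mul_diagonal, A, Matrix.of_apply, Matrix.transpose_apply]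
    rw [Finset.sum_subset (s₂ := Finset.range (n + 1)) (Finset.range_mono (by omega)),
      ← Fin.sum_univ_eq_sum_range (fun l => (Nat.choose j l : ℂ) * (Nat.choose k l)
        * factGamma a l) (n + 1), Finset.mul_sum]
    · exact Finset.sum_congr rfl fun l _ => by ring
    · intro l _ hl
      rw [Nat.choose_eq_zero_of_lt (n := (k : ℕ)) (by simpa using hl)]; simp
  have hW : gammaMatrixInv a n = B.transpose * d' * B := by
    ext j k
    rw [Matrix.mul_apply, gammaMatrixInv, Matrix.of_apply, binomGammaSum,
      ← Fin.sum_univ_eq_sum_range (fun l => (Nat.choose l j : ℂ) * (Nat.choose l k)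
        * (factGamma a l)⁻¹) (n + 1), Finset.mul_sum, Finset.sum_div]
    simp only [d', Matrix.mul_diagonal, B, Matrix.of_apply, Matrix.transpose_apply]
    refine Finset.sum_congr rfl fun l _ => ?_
    have hs : ((-1 : ℂ)) ^ ((j : ℕ) + k) = (-1) ^ ((l : ℕ) + j) * (-1) ^ ((l : ℕ) + k) := by
      rw [← pow_add, show (l : ℕ) + j + (l + k) = 2 * l + (j + k) by ring, pow_add (-1) (2 * (l : ℕ)),
        pow_mul]
      simp
    rw [hs]
    field_simp
  -- The inverse of Pascal's matrix is Pascal's matrix with alternating signs.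
  have hAB : A * B = 1 := by
    ext i j
    rw [Matrix.mul_apply, Matrix.one_apply]
    have := sum_choose_alternating n i j
    have h2 : ∀ l : Fin (n + 1), A i l * B l j = Complex.Gamma ((i : ℕ) + a + 1)
        / Complex.Gamma ((j : ℕ) + a + 1) * ((Nat.choose i l : ℂ)
          * ((-1) ^ ((l : ℕ) + j) * (Nat.choose l j : ℂ))) := fun l => by
      simp only [A, B, Matrix.of_apply]; ring
    simp only [h2]
    rw [← Finset.mul_sum, this]
    split_ifs with hij
    · subst hij; rw [div_self (gamma_ne_zero ha _), one_mul]
    · rw [mul_zero]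
  have hBA : B * A = 1 := mul_eq_one_comm.1 hAB
  have hd : d' * d = 1 := by
    simp only [d, d', Matrix.diagonal_mul_diagonal]
    rw [← Matrix.diagonal_one]
    congr 1
    funext l
    exact inv_mul_cancel₀ (hf l)
  calc gammaMatrixInv a n * gammaMatrix a n
      = B.transpose * (d' * (B * A) * d) * A.transpose := by
        rw [hW, hM]; simp only [Matrix.mul_assoc]
    _ = (A * B).transpose := by
        rw [hBA, Matrix.mul_one, hd, Matrix.mul_one, Matrix.transpose_mul]
    _ = 1 := by rw [hAB, Matrix.transpose_one]

/-- Principal minor indexed by a finite set of natural numbers. -/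
def minor (Y : ℕ → ℕ → ℂ) (J : Finset ℕ) : ℂ :=
  (Matrix.of fun i j : J => Y i j).det

/-- Multilinearity in the rows: each row is taken either from M or from the identity. -/
lemma det_one_add_eq_sum_minors {N : ℕ} (M : Matrix (Fin N) (Fin N) ℂ) :
    (1 + M).det = ∑ s : Finset (Fin N), (M.submatrix (↑) (↑) : Matrix s s ℂ).det := by
  rw [add_comm]
  have h := (Matrix.detRowAlternating (n := Fin N) (R := ℂ)).map_add_univ M.row
    (1 : Matrix (Fin N) (Fin N) ℂ).row
  change (M + 1).det = _ at h
  rw [h]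
  exact Finset.sum_congr rfl fun s _ => Matrix.det_piecewise_one_eq_submatrix_det M s

lemma minor_eq_zero {Y : ℕ → ℕ → ℂ} {J : Finset ℕ} {i : ℕ} (hi : i ∈ J) (h : ∀ k, Y i k = 0) :
    minor Y J = 0 :=
  Matrix.det_eq_zero_of_row_eq_zero ⟨i, hi⟩ fun k => h k

/-- Since the rows beyond N vanish, the sum may run over all finite subsets of ℕ. This index set
does not depend on N, so the limit can be taken by dominated convergence. -/
lemma det_one_sub_eq_tsum (N : ℕ) (Y : ℕ → ℕ → ℂ) (hY : ∀ i, N ≤ i → ∀ k, Y i k = 0) (z : ℂ) :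
    (1 - z • Matrix.of fun i j : Fin N => Y i j).det
      = ∑' J : Finset ℕ, (-z) ^ J.card * minor Y J := by
  rw [sub_eq_add_neg, ← neg_smul, det_one_add_eq_sum_minors,
    tsum_eq_sum (s := (Finset.univ : Finset (Finset (Fin N))).map
      ⟨fun s => s.map Fin.valEmbedding, Finset.map_injective _⟩), Finset.sum_map]
  · refine Finset.sum_congr rfl fun s _ => ?_
    simp only [Function.Embedding.coeFn_mk, Finset.card_map]
    let e : s ≃ (s.map Fin.valEmbedding : Finset ℕ) :=
      Equiv.ofBijective (fun i => ⟨((i : Fin N) : ℕ), Finset.mem_map_of_mem Fin.valEmbedding i.2⟩)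
        ⟨fun i j h => Subtype.ext (Fin.ext (congrArg Subtype.val h)), fun ⟨x, hx⟩ => by
          obtain ⟨y, hy, rfl⟩ := Finset.mem_map.1 hx
          exact ⟨⟨y, hy⟩, rfl⟩⟩
    rw [minor, ← Matrix.det_submatrix_equiv_self e, ← Fintype.card_coe s, ← Matrix.det_smul]
    rfl
  · intro J hJ
    have : ∃ i ∈ J, N ≤ i := by
      by_contra hcon
      push Not at hcon
      refine hJ (Finset.mem_map.2 ⟨Finset.univ.filter fun i : Fin N => (i : ℕ) ∈ J,
        Finset.mem_univ _, ?_⟩)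
      ext x
      simp only [Function.Embedding.coeFn_mk, Finset.mem_map, Finset.mem_filter, Finset.mem_univ,
        true_and, Fin.valEmbedding_apply]
      exact ⟨fun ⟨y, hy, hyx⟩ => hyx ▸ hy, fun hx => ⟨⟨x, hcon x hx⟩, hx, rfl⟩⟩
    obtain ⟨i, hi, hN⟩ := this
    rw [minor_eq_zero hi (hY i hN), mul_zero]

/-- Rescaled inverse Gamma matrix. -/
def scaledInv (a : ℂ) (n j m : ℕ) : ℂ :=
  (-1) ^ (j + m) * binomGammaSum a n j m
    / (Complex.Gamma (j + a + 1) * Complex.Gamma (m + a + 1))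
    / ((4 * n : ℝ) : ℂ) ^ (((j + m : ℕ) : ℂ) + a + 1)

/-- The finite-`n` kernel matrix. -/
def kernelN (a : ℂ) (n : ℕ) (s : ℂ) (j k : ℕ) : ℂ :=
  ∑ m ∈ Finset.range (n + 1),
    scaledInv a n j m * (s ^ (m + k) * expMoment ((m + k : ℕ) + a) (s / (4 * n)))

lemma scaledInv_eq_zero {a : ℂ} {n j m : ℕ} (h : n < j ∨ n < m) : scaledInv a n j m = 0 := by
  have : binomGammaSum a n j m = 0 := by
    refine Finset.sum_eq_zero fun l hl => ?_
    have hl := Nat.lt_succ_iff.1 (Finset.mem_range.1 hl)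
    rcases h with h | h <;> rw [Nat.choose_eq_zero_of_lt (lt_of_le_of_lt hl h)] <;> simp
  rw [scaledInv, this]; simp

/-- The finite-`n` determinant as a function on the slit plane. -/
def detN (a : ℂ) (n : ℕ) (s : ℂ) : ℂ :=
  ∑' J : Finset ℕ, (-(s ^ (a + 1))) ^ J.card * minor (kernelN a n s) J

/-- The complete minus the lower integrals, with the complete ones factored out. The remaining
determinant is unchanged by a diagonal conjugation. -/
lemma det_upperMatrix {a : ℂ} (ha : -1 < a.re) {n : ℕ} (hn : 0 < n) {s : ℝ} (hs : 0 < s) :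
    (upperMatrix a n (s / (4 * n))).det = (gammaMatrix a n).det * detN a n s := by
  have hn' : (0 : ℝ) < 4 * n := by positivity
  set t : ℝ := s / (4 * n) with ht_def
  have ht : 0 < t := by positivity
  let Q : Matrix (Fin (n + 1)) (Fin (n + 1)) ℂ :=
    Matrix.of fun j k => lowerGamma (((j : ℕ) + (k : ℕ) : ℕ) + a) t
  have h1 : upperMatrix a n t = gammaMatrix a n * (1 - gammaMatrixInv a n * Q) := by
    rw [Matrix.mul_sub, Matrix.mul_one, ← Matrix.mul_assoc,
      mul_eq_one_comm.1 (gammaMatrixInv_mul ha n), Matrix.one_mul]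
    rfl
  let c : ℂ := ((4 * n : ℝ) : ℂ)
  have hc : c ≠ 0 := by simp only [c]; exact_mod_cast hn'.ne'
  -- Conjugation by the powers of 4n replaces the weight (4n)^{m+k} in each entry by (4n)^{j+m},
  -- which matches the growth of the inverse Gamma matrix.
  let Dg : Matrix (Fin (n + 1)) (Fin (n + 1)) ℂ := Matrix.diagonal fun j => c ^ (j : ℕ)
  let Dg' : Matrix (Fin (n + 1)) (Fin (n + 1)) ℂ := Matrix.diagonal fun j => (c ^ (j : ℕ))⁻¹
  have hDg : Dg * Dg' = 1 := by
    simp only [Dg, Dg', Matrix.diagonal_mul_diagonal]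
    rw [← Matrix.diagonal_one]
    congr 1
    funext l
    exact mul_inv_cancel₀ (pow_ne_zero _ hc)
  let Y : Matrix (Fin (n + 1)) (Fin (n + 1)) ℂ := Matrix.of fun i j => kernelN a n s i j
  have h2 : gammaMatrixInv a n * Q = Dg * (((s : ℂ) ^ (a + 1)) • Y) * Dg' := by
    ext j k
    rw [Matrix.mul_apply]
    simp only [Dg, Dg', Matrix.mul_diagonal, Matrix.diagonal_mul,
      Matrix.smul_apply, smul_eq_mul, Y, Matrix.of_apply, kernelN]
    rw [← Fin.sum_univ_eq_sum_range (fun m => scaledInv a n j m * ((s : ℂ) ^ (m + (k : ℕ))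
      * expMoment ((m + k : ℕ) + a) (s / (4 * n)))) (n + 1)]
    simp only [Finset.mul_sum, Finset.sum_mul]
    refine Finset.sum_congr rfl fun m _ => ?_
    simp only [Q, Matrix.of_apply]
    rw [lowerGamma_eq ht, gammaMatrixInv, Matrix.of_apply, scaledInv]
    have hsc : (s : ℂ) ≠ 0 := by exact_mod_cast hs.ne'
    have hpow : (t : ℂ) ^ ((((m : ℕ) + (k : ℕ) : ℕ) : ℂ) + a + 1) = (s : ℂ) ^ ((m : ℕ) + (k : ℕ))
        * (s : ℂ) ^ (a + 1) / (c ^ ((m : ℕ) + (k : ℕ)) * c ^ (a + 1)) := by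
      have : (t : ℂ) = ((s : ℝ) : ℂ) * (((4 * n : ℝ)⁻¹ : ℝ) : ℂ) := by
        rw [ht_def, div_eq_mul_inv]; push_cast; ring
      rw [this, Complex.mul_cpow_ofReal_nonneg hs.le (by positivity), add_assoc,
        Complex.cpow_add _ _ hsc, Complex.cpow_natCast, Complex.ofReal_inv,
        Complex.inv_cpow _ _ (by
          rw [Complex.arg_ofReal_of_nonneg hn'.le]; exact Real.pi_ne_zero.symm),
        Complex.cpow_add _ _ hc, Complex.cpow_natCast]
      rfl
    have hpow2 : ((4 * n : ℝ) : ℂ) ^ ((((j : ℕ) + (m : ℕ) : ℕ) : ℂ) + a + 1)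
        = c ^ ((j : ℕ) + (m : ℕ)) * c ^ (a + 1) := by
      rw [add_assoc, Complex.cpow_add _ _ hc, Complex.cpow_natCast]
    have hca : c ^ (a + 1) ≠ 0 := by rw [Ne, Complex.cpow_eq_zero_iff]; tauto
    have ht2 : (t : ℂ) = (s : ℂ) / (4 * n) := by rw [ht_def]; push_cast; ring
    rw [hpow, hpow2, ht2]
    have g1 := gamma_ne_zero ha j
    have g2 := gamma_ne_zero ha m
    have hcj := pow_ne_zero (j : ℕ) hc
    have hck := pow_ne_zero (k : ℕ) hc
    have hcm := pow_ne_zero (m : ℕ) hc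
    rw [pow_add c, pow_add c]
    field_simp
  have h3 : 1 - Dg * (((s : ℂ) ^ (a + 1)) • Y) * Dg'
      = Dg * (1 - ((s : ℂ) ^ (a + 1)) • Y) * Dg' := by
    rw [Matrix.mul_sub, Matrix.sub_mul, Matrix.mul_one, hDg]
  rw [h1, Matrix.det_mul, h2, h3, Matrix.det_mul, Matrix.det_mul, mul_right_comm Dg.det,
    ← Matrix.det_mul, hDg, Matrix.det_one, one_mul, detN]
  congr 1
  apply det_one_sub_eq_tsum
  intro i hi k
  refine Finset.sum_eq_zero fun m _ => ?_
  rw [scaledInv_eq_zero (Or.inl hi), zero_mul]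

lemma gammaMatrix_det_ne_zero {a : ℂ} (ha : -1 < a.re) (n : ℕ) : (gammaMatrix a n).det ≠ 0 := by
  intro h
  have := congrArg Matrix.det (gammaMatrixInv_mul ha n)
  rw [Matrix.det_mul, h, mul_zero, Matrix.det_one] at this
  exact zero_ne_one this


/-! ### Large-n asymptotics of the matrix coefficients -/

lemma ascProd_mul_gamma {b : ℂ} (hb : 0 < b.re) (n : ℕ) :
    (∏ j ∈ Finset.range n, (b + j)) * Complex.Gamma b = Complex.Gamma (n + b) := by
  induction n with
  | zero => simp
  | succ n ih =>
    rw [Finset.prod_range_succ, mul_right_comm, ih, mul_comm, add_comm b, ← Complex.Gamma_add_one]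
    · congr 1; push_cast; ring
    · intro h
      have := congrArg Complex.re h
      have h2 : (0 : ℝ) ≤ n := n.cast_nonneg
      simp at this; linarith

/-- `Γ(l + b) / l!`. -/
def gammaRatio (b : ℂ) (l : ℕ) : ℂ := Complex.Gamma (l + b) / l.factorial

lemma gammaRatio_ne_zero {b : ℂ} (hb : 0 < b.re) (l : ℕ) : gammaRatio b l ≠ 0 := by
  refine div_ne_zero (Complex.Gamma_ne_zero_of_re_pos ?_) (by exact_mod_cast l.factorial_ne_zero)
  have h2 : (0 : ℝ) ≤ l := l.cast_nonneg
  simp; linarith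

lemma gamma_nat_succ {b : ℂ} (hb : 0 < b.re) (l : ℕ) :
    Complex.Gamma ((l + 1 : ℕ) + b) = (l + b) * Complex.Gamma (l + b) := by
  rw [← Complex.Gamma_add_one]
  · congr 1; push_cast; ring
  · intro h
    have := congrArg Complex.re h
    have h2 : (0 : ℝ) ≤ l := l.cast_nonneg
    simp at this; linarith

lemma sum_gammaRatio {b : ℂ} (hb : 0 < b.re) (n : ℕ) :
    ∑ l ∈ Finset.range (n + 1), gammaRatio b l = (n + b) / b * gammaRatio b n := by
  have hb0 : b ≠ 0 := fun h => by rw [h] at hb; simp at hb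
  induction n with
  | zero => simp [hb0]
  | succ n ih =>
    rw [Finset.sum_range_succ, ih, gammaRatio, gammaRatio, gamma_nat_succ hb, Nat.factorial_succ]
    have h1 : ((n : ℂ) + 1) ≠ 0 := by exact_mod_cast n.succ_ne_zero
    have h2 : (n.factorial : ℂ) ≠ 0 := by exact_mod_cast n.factorial_ne_zero
    push_cast
    field_simp

lemma tendsto_natCast_add_div (b : ℂ) : Tendsto (fun n : ℕ => ((n : ℂ) + b) / n) atTop (𝓝 1) := by
  have h1 : Tendsto (fun n : ℕ => (n : ℂ)⁻¹) atTop (𝓝 0) := by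
    have := (Complex.continuous_ofReal.tendsto 0).comp (tendsto_inv_atTop_nhds_zero_nat (𝕜 := ℝ))
    simpa [Function.comp_def] using this
  have h2 := (h1.const_mul b).const_add 1
  rw [mul_zero, add_zero] at h2
  refine h2.congr' ?_
  filter_upwards [eventually_gt_atTop 0] with n hn
  have : (n : ℂ) ≠ 0 := by exact_mod_cast hn.ne'
  field_simp

/-- Stirling-type asymptotics `Γ(n+b)/n! ~ n^{b-1}`. -/
lemma tendsto_gammaRatio {b : ℂ} (hb : 0 < b.re) :
    Tendsto (fun n : ℕ => (n + b) * gammaRatio b n / (n : ℂ) ^ b) atTop (𝓝 1) := by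
  have hG : Complex.Gamma b ≠ 0 := Complex.Gamma_ne_zero_of_re_pos hb
  have h1 := ((Complex.GammaSeq_tendsto_Gamma b).inv₀ hG).const_mul (Complex.Gamma b)
  rw [mul_inv_cancel₀ hG] at h1
  refine h1.congr fun n => ?_
  have h2 := ascProd_mul_gamma hb (n + 1)
  rw [gamma_nat_succ hb] at h2
  rw [Complex.GammaSeq, gammaRatio, inv_div, mul_div_assoc', mul_comm (Complex.Gamma b), h2]
  field_simp

lemma tendsto_sum_gammaRatio {b : ℂ} (hb : 0 < b.re) :
    Tendsto (fun n : ℕ => (∑ l ∈ Finset.range (n + 1), gammaRatio b l) / (n : ℂ) ^ b) atTop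
      (𝓝 (1 / b)) := by
  refine ((tendsto_gammaRatio hb).div_const b).congr fun n => ?_
  rw [sum_gammaRatio hb]; ring

lemma gammaRatio_ofReal (c : ℝ) (l : ℕ) :
    gammaRatio c l = ((Real.Gamma (l + c) / l.factorial : ℝ) : ℂ) := by
  rw [gammaRatio]
  push_cast
  rw [← Complex.Gamma_ofReal]
  push_cast; rfl

/-- Real version of `gammaRatio`. -/
def realRatio (c : ℝ) (l : ℕ) : ℝ := Real.Gamma (l + c) / l.factorial

lemma realRatio_pos {c : ℝ} (hc : 0 < c) (l : ℕ) : 0 < realRatio c l :=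
  div_pos (Real.Gamma_pos_of_pos (by positivity)) (by exact_mod_cast l.factorial_pos)

lemma tendsto_sum_realRatio {c : ℝ} (hc : 0 < c) :
    Tendsto (fun n : ℕ => (∑ l ∈ Finset.range (n + 1), realRatio c l) / (n : ℝ) ^ c) atTop
      (𝓝 (1 / c)) := by
  have h := tendsto_sum_gammaRatio (b := (c : ℂ)) (by simpa using hc)
  have h2 := (Complex.continuous_re.tendsto _).comp h
  have h3 : (1 / (c : ℂ)).re = 1 / c := by rw [← Complex.ofReal_one, ← Complex.ofReal_div]; simp
  rw [h3] at h2
  refine h2.congr fun n => ?_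
  simp only [Function.comp_apply, gammaRatio_ofReal]
  rw [← Complex.ofReal_sum, ← Complex.ofReal_natCast, ← Complex.ofReal_cpow n.cast_nonneg,
    ← Complex.ofReal_div, Complex.ofReal_re]
  rfl

lemma tendsto_sum_realRatio_atTop {c : ℝ} (hc : 0 < c) :
    Tendsto (fun n : ℕ => ∑ l ∈ Finset.range n, realRatio c l) atTop atTop := by
  rw [← tendsto_add_atTop_iff_nat 1]
  have h1 := (tendsto_rpow_atTop hc).comp (tendsto_natCast_atTop_atTop (R := ℝ))
  have h2 := h1.atTop_mul_pos (by positivity : (0 : ℝ) < 1 / c) (tendsto_sum_realRatio hc)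
  refine h2.congr' ?_
  filter_upwards [eventually_gt_atTop 0] with n hn
  have : (0 : ℝ) < (n : ℝ) ^ c := Real.rpow_pos_of_pos (by exact_mod_cast hn) _
  simp only [Function.comp_apply]
  field_simp

lemma tendsto_gammaRatio_div_realRatio {b : ℂ} (hb : 0 < b.re) :
    Tendsto (fun n : ℕ => ‖gammaRatio b n‖ / realRatio b.re n) atTop (𝓝 1) := by
  have h1 := (tendsto_gammaRatio hb).norm
  have h2 := (tendsto_gammaRatio (b := (b.re : ℂ)) (by simpa using hb)).norm
  have h3 := (tendsto_natCast_add_div b).norm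
  have h4 := (tendsto_natCast_add_div (b.re : ℂ)).norm
  rw [norm_one] at h1 h2 h3 h4
  have h5 := ((h1.div h2 one_ne_zero).mul (h4.div h3 one_ne_zero))
  rw [div_one, one_mul] at h5
  refine h5.congr' ?_
  filter_upwards [eventually_gt_atTop 0] with n hn
  have hn' : (0 : ℝ) < n := by exact_mod_cast hn
  have e1 : ‖(n : ℂ) ^ b‖ = (n : ℝ) ^ b.re := Complex.norm_natCast_cpow_of_pos hn _
  have e2 : ‖(n : ℂ) ^ (b.re : ℂ)‖ = (n : ℝ) ^ b.re := by
    rw [Complex.norm_natCast_cpow_of_pos hn]; simp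
  have e3 : ‖gammaRatio b.re n‖ = realRatio b.re n := by
    rw [gammaRatio_ofReal, Complex.norm_real]; exact Real.norm_of_nonneg (realRatio_pos hb n).le
  have e4 : (n : ℂ) + b ≠ 0 := fun h => by
    have := congrArg Complex.re h; simp at this; linarith
  have e5 : (n : ℂ) + (b.re : ℂ) ≠ 0 := fun h => by
    have := congrArg Complex.re h; simp at this; linarith
  have e6 := (realRatio_pos hb n).ne'
  have e7 : (n : ℝ) ^ b.re ≠ 0 := (Real.rpow_pos_of_pos hn' _).ne'
  simp only [norm_div, norm_mul, e1, e2, e3, Pi.div_apply]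
  have e8 := norm_ne_zero_iff.2 e4
  have e9 := norm_ne_zero_iff.2 e5
  have e10 : ‖(n : ℂ)‖ ≠ 0 := norm_ne_zero_iff.2 (by exact_mod_cast hn.ne')
  field_simp

/-- A sequence asymptotic to `κ Γ(l+b)/l!` has partial sums asymptotic to `κ n^b / b`. -/
lemma tendsto_sum_of_tendsto_div {b κ : ℂ} (hb : 0 < b.re) {f : ℕ → ℂ}
    (hf : Tendsto (fun l => f l / gammaRatio b l) atTop (𝓝 κ)) :
    Tendsto (fun n : ℕ => (∑ l ∈ Finset.range (n + 1), f l) / (n : ℂ) ^ b) atTop (𝓝 (κ / b)) := by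
  -- Summing a little-o needs a nonnegative comparison sequence; Γ(l + Re b)/l! has asymptotically
  -- the same modulus as the complex ratio.
  have hlo : (fun l => f l - κ * gammaRatio b l) =o[atTop] realRatio b.re := by
    refine IsLittleO.of_bound fun ε hε => ?_
    have h1 := (tendsto_iff_norm_sub_tendsto_zero.1 hf).mul (tendsto_gammaRatio_div_realRatio hb)
    rw [zero_mul] at h1
    filter_upwards [h1.eventually (gt_mem_nhds hε)] with l hl
    have hg := gammaRatio_ne_zero hb l
    have hr := realRatio_pos hb l
    have e : f l - κ * gammaRatio b l = (f l / gammaRatio b l - κ) * gammaRatio b l := by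
      field_simp
    rw [e, norm_mul, Real.norm_of_nonneg hr.le]
    rw [← mul_div_assoc, div_lt_iff₀ hr] at hl
    exact hl.le
  have h2 := hlo.sum_range (fun n => (realRatio_pos hb n).le) (tendsto_sum_realRatio_atTop hb)
  have h3 := h2.comp_tendsto (tendsto_add_atTop_nat 1)
  have hbdd : (fun n : ℕ => ∑ l ∈ Finset.range (n + 1), realRatio b.re l) =O[atTop]
      fun n : ℕ => (n : ℝ) ^ b.re := by
    refine isBigO_of_div_tendsto_nhds ?_ _ (tendsto_sum_realRatio hb)
    filter_upwards [eventually_gt_atTop 0] with n hn h0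
    exact absurd h0 (Real.rpow_pos_of_pos (by exact_mod_cast hn) _).ne'
  have h4 : (fun n : ℕ => ∑ l ∈ Finset.range (n + 1), (f l - κ * gammaRatio b l)) =o[atTop]
      fun n : ℕ => (n : ℂ) ^ b := by
    refine (h3.trans_isBigO hbdd).trans_isBigO (IsBigO.of_bound 1 ?_)
    filter_upwards [eventually_gt_atTop 0] with n hn
    rw [Complex.norm_natCast_cpow_of_pos hn, one_mul, Real.norm_of_nonneg (by positivity)]
  have h5 := (h4.tendsto_div_nhds_zero).add ((tendsto_sum_gammaRatio hb).const_mul κ)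
  rw [zero_add, mul_one_div] at h5
  refine h5.congr fun n => ?_
  rw [Finset.sum_sub_distrib, ← Finset.mul_sum]
  ring

lemma factGamma_inv (a : ℂ) (l : ℕ) : (factGamma a l)⁻¹ = gammaRatio (a + 1) l := by
  rw [factGamma, gammaRatio, inv_div, add_assoc]

lemma tendsto_choose_div_pow (k : ℕ) :
    Tendsto (fun n : ℕ => (n.choose k : ℂ) / (n : ℂ) ^ k) atTop (𝓝 (1 / k.factorial)) := by
  have h := ProbabilityTheory.tendsto_choose_mul_pow_atTop k (p := fun n : ℕ => (n : ℝ)⁻¹) (r := 1)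
    (by
      refine tendsto_const_nhds.congr' ?_
      filter_upwards [eventually_gt_atTop 0] with n hn
      rw [mul_inv_cancel₀ (by exact_mod_cast hn.ne')])
  have h2 := (Complex.continuous_ofReal.tendsto _).comp h
  rw [one_pow] at h2
  push_cast at h2
  refine h2.congr fun n => ?_
  simp [div_eq_mul_inv]

lemma tendsto_pow_mul_gammaRatio_div {b : ℂ} (hb : 0 < b.re) (p : ℕ) :
    Tendsto (fun l : ℕ => (l : ℂ) ^ p * gammaRatio b l / gammaRatio (p + b) l) atTop (𝓝 1) := by
  have hpb : 0 < ((p : ℂ) + b).re := by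
    have : (0 : ℝ) ≤ p := p.cast_nonneg
    simp; linarith
  have h1 := (tendsto_gammaRatio hb).div (tendsto_gammaRatio hpb) one_ne_zero
  have h2 := (tendsto_natCast_add_div (p + b)).div (tendsto_natCast_add_div b) one_ne_zero
  have h3 := h1.mul h2
  simp only [div_one, mul_one] at h3
  refine h3.congr' ?_
  filter_upwards [eventually_gt_atTop 0] with n hn
  have hn' : (0 : ℝ) < n := by exact_mod_cast hn
  have hn0 : (n : ℂ) ≠ 0 := by exact_mod_cast hn.ne'
  have e4 : (n : ℂ) + b ≠ 0 := fun h => by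
    have := congrArg Complex.re h; simp at this; linarith
  have e5 : (n : ℂ) + (p + b) ≠ 0 := fun h => by
    have := congrArg Complex.re h
    rw [Complex.add_re, Complex.natCast_re, Complex.zero_re] at this; linarith
  have e6 := gammaRatio_ne_zero hpb n
  have e7 : (n : ℂ) ^ b ≠ 0 := by rw [Ne, Complex.cpow_eq_zero_iff]; tauto
  have e8 := pow_ne_zero p hn0
  simp only [Pi.div_apply]
  rw [Complex.cpow_add _ _ hn0, Complex.cpow_natCast]
  field_simp

lemma re_add_one_pos {a : ℂ} (ha : -1 < a.re) : 0 < (a + 1).re := by simp; linarith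

/-- The summand is asymptotic to Γ(l+j+m+a+1)/l! divided by j!m!, so the general statement on
partial sums applies. -/
lemma tendsto_binomGammaSum {a : ℂ} (ha : -1 < a.re) (j m : ℕ) :
    Tendsto (fun n : ℕ => binomGammaSum a n j m / (n : ℂ) ^ (((j + m : ℕ) : ℂ) + (a + 1))) atTop
      (𝓝 (1 / (j.factorial * m.factorial) / (((j + m : ℕ) : ℂ) + (a + 1)))) := by
  have hb := re_add_one_pos ha
  have hpb : 0 < (((j + m : ℕ) : ℂ) + (a + 1)).re := by
    have : (0 : ℝ) ≤ (j + m : ℕ) := Nat.cast_nonneg _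
    rw [Complex.add_re, Complex.natCast_re]; linarith
  refine tendsto_sum_of_tendsto_div hpb ?_
  have h := ((tendsto_choose_div_pow j).mul (tendsto_choose_div_pow m)).mul
    (tendsto_pow_mul_gammaRatio_div hb (j + m))
  rw [mul_one, div_mul_div_comm, one_mul] at h
  refine h.congr' ?_
  filter_upwards [eventually_gt_atTop 0] with n hn
  have hn0 : (n : ℂ) ≠ 0 := by exact_mod_cast hn.ne'
  rw [factGamma_inv, pow_add]
  field_simp

lemma exists_sum_norm_gammaRatio_le {b : ℂ} (hb : 0 < b.re) :
    ∃ C : ℝ, 0 ≤ C ∧ ∀ n : ℕ, 0 < n →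
      ∑ l ∈ Finset.range (n + 1), ‖gammaRatio b l‖ ≤ C * (n : ℝ) ^ b.re := by
  obtain ⟨C1, hC1⟩ := (tendsto_gammaRatio_div_realRatio hb).bddAbove_range
  obtain ⟨C2, hC2⟩ := (tendsto_sum_realRatio hb).bddAbove_range
  have h1 : ∀ l, ‖gammaRatio b l‖ ≤ C1 * realRatio b.re l := fun l => by
    have := hC1 ⟨l, rfl⟩
    simp only at this
    rwa [div_le_iff₀ (realRatio_pos hb l)] at this
  have hC10 : 0 ≤ C1 := le_trans (div_nonneg (norm_nonneg _) (realRatio_pos hb 0).le) (hC1 ⟨0, rfl⟩)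
  have hC20 : 0 ≤ C2 := le_trans (div_nonneg (Finset.sum_nonneg fun l _ => (realRatio_pos hb l).le)
    (by positivity)) (hC2 ⟨0, rfl⟩)
  refine ⟨C1 * C2, by positivity, fun n hn => ?_⟩
  have hn' : (0 : ℝ) < (n : ℝ) ^ b.re := Real.rpow_pos_of_pos (by exact_mod_cast hn) _
  have h2 := hC2 ⟨n, rfl⟩
  simp only at h2
  rw [div_le_iff₀ hn'] at h2
  calc ∑ l ∈ Finset.range (n + 1), ‖gammaRatio b l‖
      ≤ ∑ l ∈ Finset.range (n + 1), C1 * realRatio b.re l := Finset.sum_le_sum fun l _ => h1 l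
    _ = C1 * ∑ l ∈ Finset.range (n + 1), realRatio b.re l := by rw [Finset.mul_sum]
    _ ≤ C1 * (C2 * (n : ℝ) ^ b.re) := by gcongr
    _ = _ := by ring

/-- The limit of `scaledInv`. -/
def besselCoeff (a : ℂ) (j m : ℕ) : ℂ :=
  (-1) ^ (j + m) / (Complex.Gamma (j + a + 1) * Complex.Gamma (m + a + 1) * j.factorial
    * m.factorial * (((j + m : ℕ) : ℂ) + a + 1) * (4 : ℂ) ^ (((j + m : ℕ) : ℂ) + a + 1))

lemma four_mul_cpow {n : ℕ} (b : ℂ) : ((4 * n : ℝ) : ℂ) ^ b = (4 : ℂ) ^ b * (n : ℂ) ^ b := by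
  rw [Complex.ofReal_mul, Complex.mul_cpow_ofReal_nonneg (by norm_num) n.cast_nonneg]
  push_cast; rfl

lemma tendsto_scaledInv {a : ℂ} (ha : -1 < a.re) (j m : ℕ) :
    Tendsto (fun n => scaledInv a n j m) atTop (𝓝 (besselCoeff a j m)) := by
  have h := (tendsto_binomGammaSum ha j m).const_mul ((-1) ^ (j + m)
    / (Complex.Gamma (j + a + 1) * Complex.Gamma (m + a + 1))
    / (4 : ℂ) ^ (((j + m : ℕ) : ℂ) + a + 1))
  have e : besselCoeff a j m = (-1) ^ (j + m)
    / (Complex.Gamma (j + a + 1) * Complex.Gamma (m + a + 1))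
    / (4 : ℂ) ^ (((j + m : ℕ) : ℂ) + a + 1)
      * (1 / (j.factorial * m.factorial) / (((j + m : ℕ) : ℂ) + (a + 1))) := by
    rw [besselCoeff, ← add_assoc]; field_simp
  rw [e]
  refine h.congr fun n => ?_
  rw [scaledInv, four_mul_cpow, ← add_assoc]
  field_simp

/-- Decay rate of the Bessel coefficients. -/
def coeffBound (a : ℂ) (j : ℕ) : ℝ := (‖Complex.Gamma (j + a + 1)‖ * j.factorial)⁻¹

/-- From C(l,j) ≤ n^j/j! the sum is at most of order n^{j+m+Re a+1}, which the scaling by 4n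
absorbs. The bound is uniform in n and factors into a part in j and a part in m. -/
lemma exists_norm_scaledInv_le {a : ℂ} (ha : -1 < a.re) :
    ∃ C : ℝ, 0 ≤ C ∧ ∀ n j m : ℕ, 0 < n →
      ‖scaledInv a n j m‖ ≤ C * (coeffBound a j * coeffBound a m) := by
  obtain ⟨C, hC0, hC⟩ := exists_sum_norm_gammaRatio_le (re_add_one_pos ha)
  refine ⟨C, hC0, fun n j m hn => ?_⟩
  have hn' : (0 : ℝ) < n := by exact_mod_cast hn
  have h1 : ‖binomGammaSum a n j m‖ ≤ (n : ℝ) ^ (j + m) / (j.factorial * m.factorial)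
      * (C * (n : ℝ) ^ (a + 1).re) := by
    refine (norm_sum_le _ _).trans (le_trans ?_ (mul_le_mul_of_nonneg_left (hC n hn)
      (by positivity)))
    rw [Finset.mul_sum]
    refine Finset.sum_le_sum fun l hl => ?_
    have hl : (l : ℝ) ≤ n := by exact_mod_cast Nat.lt_succ_iff.1 (Finset.mem_range.1 hl)
    rw [factGamma_inv, norm_mul, norm_mul, Complex.norm_natCast, Complex.norm_natCast]
    refine mul_le_mul_of_nonneg_right ?_ (norm_nonneg _)
    have e1 : (l.choose j : ℝ) ≤ (n : ℝ) ^ j / j.factorial :=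
      (Nat.choose_le_pow_div j l).trans (by gcongr)
    have e2 : (l.choose m : ℝ) ≤ (n : ℝ) ^ m / m.factorial :=
      (Nat.choose_le_pow_div m l).trans (by gcongr)
    calc (l.choose j : ℝ) * l.choose m ≤ (n : ℝ) ^ j / j.factorial * ((n : ℝ) ^ m / m.factorial) := by
          gcongr
      _ = _ := by rw [pow_add]; field_simp
  have hre : (((j + m : ℕ) : ℂ) + a + 1).re = (j + m : ℕ) + (a + 1).re := by
    rw [add_assoc, Complex.add_re, Complex.natCast_re]
  have h2 : ‖((4 * n : ℝ) : ℂ) ^ (((j + m : ℕ) : ℂ) + a + 1)‖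
      ≥ (n : ℝ) ^ (j + m) * (n : ℝ) ^ (a + 1).re := by
    rw [Complex.norm_cpow_eq_rpow_re_of_pos (by positivity), hre, ← Real.rpow_natCast,
      ← Real.rpow_add hn']
    refine Real.rpow_le_rpow hn'.le (by linarith) ?_
    have := re_add_one_pos ha
    positivity
  have hpos : 0 < (n : ℝ) ^ (j + m) * (n : ℝ) ^ (a + 1).re := by positivity
  rw [scaledInv, norm_div, norm_div, norm_mul, norm_mul, norm_pow, norm_neg, norm_one, one_pow,
    one_mul]
  have g1 := norm_pos_iff.2 (gamma_ne_zero ha j)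
  have g2 := norm_pos_iff.2 (gamma_ne_zero ha m)
  rw [div_le_iff₀ (lt_of_lt_of_le hpos h2), div_le_iff₀ (by positivity)]
  refine h1.trans ?_
  unfold coeffBound
  refine le_trans (le_of_eq ?_) (mul_le_mul_of_nonneg_right
    (mul_le_mul_of_nonneg_left h2 (by positivity)) (by positivity))
  field_simp


/-! ### Domination of the minors and the hard-edge limit of the determinants -/

lemma card_factorial_le_prod (J : Finset ℕ) : (J.card.factorial : ℝ) ≤ ∏ j ∈ J, ((j : ℝ) + 1) := by
  refine Finset.induction_on_max J (by simp) fun a s ha ih => ?_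
  · have hn : a ∉ s := fun h => lt_irrefl _ (ha a h)
    have hc : s.card ≤ a := by
      have : s ⊆ Finset.range a := fun x hx => Finset.mem_range.2 (ha x hx)
      simpa using Finset.card_le_card this
    rw [Finset.card_insert_of_notMem hn, Finset.prod_insert hn, Nat.factorial_succ]
    push_cast
    gcongr

/-- Every permutation gives the same product of the α's and β's, and the number |J|! of permutations
is at most the product of j+1 over J. The bound is thus multiplicative over J, hence summable over
all finite J as soon as its factors are summable. -/
lemma norm_minor_le {Y : ℕ → ℕ → ℂ} {α β : ℕ → ℝ} (hα : ∀ j, 0 ≤ α j) (hβ : ∀ j, 0 ≤ β j)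
    (h : ∀ j k, ‖Y j k‖ ≤ α j * β k) (J : Finset ℕ) :
    ‖minor Y J‖ ≤ ∏ j ∈ J, (((j : ℝ) + 1) * (α j * β j)) := by
  have h1 : ‖minor Y J‖ ≤ ∑ _σ : Equiv.Perm J, ∏ j ∈ J, (α j * β j) := by
    rw [minor, Matrix.det_apply]
    refine (norm_sum_le _ _).trans (Finset.sum_le_sum fun σ _ => ?_)
    have e : ∏ j ∈ J, (α j * β j) = ∏ i : J, α (σ i) * β i := by
      rw [← Finset.prod_coe_sort J fun j => α j * β j, Finset.prod_mul_distrib,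
        Finset.prod_mul_distrib, Equiv.prod_comp σ fun i : J => α i]
    rw [e]
    have hs : ‖Equiv.Perm.sign σ • ∏ i : J, (Matrix.of fun i j : J => Y i j) (σ i) i‖
        = ‖∏ i : J, Y (σ i) i‖ := by
      rcases Int.units_eq_one_or (Equiv.Perm.sign σ) with hh | hh <;> rw [hh] <;> simp
    rw [hs, norm_prod]
    exact Finset.prod_le_prod (fun _ _ => norm_nonneg _) fun i _ => h _ _
  refine h1.trans ?_
  rw [Finset.sum_const, Finset.card_univ, Fintype.card_perm, Fintype.card_coe, nsmul_eq_mul,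
    Finset.prod_mul_distrib (f := fun j : ℕ => (j : ℝ) + 1)]
  exact mul_le_mul_of_nonneg_right (card_factorial_le_prod J)
    (Finset.prod_nonneg fun j _ => mul_nonneg (hα j) (hβ j))

lemma coeffBound_pos {a : ℂ} (ha : -1 < a.re) (j : ℕ) : 0 < coeffBound a j := by
  have := norm_pos_iff.2 (gamma_ne_zero ha j)
  have h2 : (0 : ℝ) < j.factorial := by exact_mod_cast j.factorial_pos
  unfold coeffBound; positivity

lemma coeffBound_succ {a : ℂ} (ha : -1 < a.re) (j : ℕ) :
    coeffBound a (j + 1) = coeffBound a j * (‖(j : ℂ) + a + 1‖ * (j + 1))⁻¹ := by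
  rw [coeffBound, coeffBound, gamma_succ ha, norm_mul, Nat.factorial_succ, ← mul_inv]
  push_cast
  congr 1; ring

lemma summable_coeffBound {a : ℂ} (ha : -1 < a.re) {R : ℝ} (hR : 0 < R) :
    Summable fun j : ℕ => ((j : ℝ) + 1) * (coeffBound a j * R ^ j) := by
  have hpos : ∀ j : ℕ, 0 < ((j : ℝ) + 1) * (coeffBound a j * R ^ j) := fun j => by
    have := coeffBound_pos ha j
    positivity
  refine summable_of_ratio_test_tendsto_lt_one (l := 0) zero_lt_one
    (Eventually.of_forall fun j => (hpos j).ne') ?_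
  have h1 : Tendsto (fun j : ℕ => ((j : ℝ) + 1 + a.re)) atTop atTop :=
    tendsto_atTop_add_const_right _ _
      (tendsto_atTop_add_const_right _ _ tendsto_natCast_atTop_atTop)
  have h2 : Tendsto (fun j : ℕ => 2 * R * ((j : ℝ) + 1 + a.re)⁻¹) atTop (𝓝 0) := by
    simpa using h1.inv_tendsto_atTop.const_mul (2 * R)
  refine squeeze_zero (fun j => by positivity) (fun j => ?_) h2
  rw [Real.norm_of_nonneg (hpos _).le, Real.norm_of_nonneg (hpos _).le, div_le_iff₀ (hpos j),
    coeffBound_succ ha]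
  have hj : (0 : ℝ) ≤ j := j.cast_nonneg
  have h3 : (j : ℝ) + 1 + a.re ≤ ‖(j : ℂ) + a + 1‖ := by
    refine le_trans (le_of_eq ?_) (Complex.re_le_norm _)
    simp; ring
  have h4 : 0 < (j : ℝ) + 1 + a.re := by linarith
  have h5 : 0 < ‖(j : ℂ) + a + 1‖ := h4.trans_le h3
  have hc := coeffBound_pos ha j
  have h6 : ‖(j : ℂ) + a + 1‖⁻¹ ≤ ((j : ℝ) + 1 + a.re)⁻¹ := inv_anti₀ h4 h3
  have h7 : ((j + 1 : ℕ) + 1 : ℝ) ≤ 2 * ((j : ℝ) + 1) := by push_cast; linarith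
  calc ((j + 1 : ℕ) + 1 : ℝ) * (coeffBound a j * (‖(j : ℂ) + a + 1‖ * (j + 1))⁻¹ * R ^ (j + 1))
      ≤ (2 * ((j : ℝ) + 1)) * (coeffBound a j
        * (((j : ℝ) + 1 + a.re)⁻¹ * ((j : ℝ) + 1)⁻¹) * R ^ (j + 1)) := by
        rw [mul_inv]
        gcongr
    _ ≤ 2 * R * ((j : ℝ) + 1 + a.re)⁻¹ * (((j : ℝ) + 1) * (coeffBound a j * R ^ j)) := by
        have h9 : ((j : ℝ) + 1)⁻¹ ≤ 1 := inv_le_one_of_one_le₀ (by linarith)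
        rw [pow_succ]
        have h10 : 0 ≤ 2 * R * ((j : ℝ) + 1 + a.re)⁻¹ * (((j : ℝ) + 1) * (coeffBound a j * R ^ j)) := by
          positivity
        calc _ = (2 * R * ((j : ℝ) + 1 + a.re)⁻¹ * (((j : ℝ) + 1) * (coeffBound a j * R ^ j)))
              * ((j : ℝ) + 1)⁻¹ := by ring
          _ ≤ _ := mul_le_of_le_one_right h10 h9

lemma norm_besselCoeff_le {a : ℂ} (ha : -1 < a.re) :
    ∃ C : ℝ, 0 ≤ C ∧ ∀ j m : ℕ, ‖besselCoeff a j m‖ ≤ C * (coeffBound a j * coeffBound a m) := by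
  obtain ⟨C, hC0, hC⟩ := exists_norm_scaledInv_le ha
  refine ⟨C, hC0, fun j m => le_of_tendsto (tendsto_scaledInv ha j m).norm ?_⟩
  filter_upwards [eventually_gt_atTop 0] with n hn using hC n j m hn

/-- The limiting kernel matrix. -/
def kernelInf (a s : ℂ) (j k : ℕ) : ℂ :=
  ∑' m : ℕ, besselCoeff a j m * (s ^ (m + k) * (1 / (((m + k : ℕ) : ℂ) + a + 1)))

lemma kernelN_eq_tsum (a : ℂ) (n : ℕ) (s : ℂ) (j k : ℕ) :
    kernelN a n s j k = ∑' m : ℕ,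
      scaledInv a n j m * (s ^ (m + k) * expMoment ((m + k : ℕ) + a) (s / (4 * n))) := by
  rw [kernelN, tsum_eq_sum]
  intro m hm
  rw [scaledInv_eq_zero (Or.inr (by simpa [Nat.lt_succ_iff] using hm)), zero_mul]

lemma norm_div_four_mul_le (n : ℕ) (s : ℂ) : ‖s / (4 * n)‖ ≤ ‖s‖ := by
  rcases Nat.eq_zero_or_pos n with rfl | hn
  · simp
  · rw [norm_div]
    refine div_le_self (norm_nonneg _) ?_
    have : (1 : ℝ) ≤ n := by exact_mod_cast hn
    simp; linarith

lemma norm_expMoment_shift_le {a : ℂ} (ha : -1 < a.re) (p n : ℕ) {s : ℂ} {R : ℝ} (hs : ‖s‖ ≤ R) :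
    ‖expMoment ((p : ℕ) + a) (s / (4 * n))‖ ≤ Real.exp R / (a.re + 1) := by
  refine (norm_expMoment_le (re_natCast_add ha p) _).trans ?_
  have hp : (0 : ℝ) ≤ p := p.cast_nonneg
  have h1 : ((p : ℂ) + a).re = p + a.re := by simp
  have h0 : 0 < a.re + 1 := by linarith
  rw [h1]
  refine div_le_div₀ (Real.exp_pos _).le (Real.exp_le_exp.2 ?_) h0 (by linarith)
  exact (norm_div_four_mul_le n s).trans hs

lemma summable_coeffBound_mul_pow {a : ℂ} (ha : -1 < a.re) {R : ℝ} (hR : 0 < R) :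
    Summable fun j : ℕ => coeffBound a j * R ^ j := by
  refine Summable.of_nonneg_of_le (fun j => ?_) (fun j => ?_) (summable_coeffBound ha hR)
  · have := coeffBound_pos ha j; positivity
  · have := coeffBound_pos ha j
    have hj : (0 : ℝ) ≤ j := j.cast_nonneg
    exact le_mul_of_one_le_left (by positivity) (by linarith)

lemma exists_norm_kernelN_le {a : ℂ} (ha : -1 < a.re) {R : ℝ} (hR : 0 < R) :
    ∃ C : ℝ, 0 ≤ C ∧ ∀ n : ℕ, 0 < n → ∀ s : ℂ, ‖s‖ ≤ R → ∀ j k : ℕ,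
      ‖kernelN a n s j k‖ ≤ C * coeffBound a j * ‖s‖ ^ k := by
  obtain ⟨C, hC0, hC⟩ := exists_norm_scaledInv_le ha
  have hS := summable_coeffBound_mul_pow ha hR
  have ha1 : 0 < a.re + 1 := by linarith
  have hT0 : 0 ≤ ∑' m : ℕ, coeffBound a m * R ^ m := tsum_nonneg fun j => by
    have := coeffBound_pos ha j; positivity
  refine ⟨C * (Real.exp R / (a.re + 1)) * ∑' m : ℕ, coeffBound a m * R ^ m, by positivity,
    fun n hn s hs j k => ?_⟩
  have hcj := coeffBound_pos ha j
  calc ‖kernelN a n s j k‖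
      ≤ ∑ m ∈ Finset.range (n + 1), (C * (Real.exp R / (a.re + 1)) * coeffBound a j * ‖s‖ ^ k)
        * (coeffBound a m * R ^ m) := by
        refine (norm_sum_le _ _).trans (Finset.sum_le_sum fun m _ => ?_)
        have hcm := coeffBound_pos ha m
        rw [norm_mul, norm_mul, norm_pow, pow_add]
        calc ‖scaledInv a n j m‖ * (‖s‖ ^ m * ‖s‖ ^ k * ‖expMoment ((m + k : ℕ) + a) (s / (4 * n))‖)
            ≤ (C * (coeffBound a j * coeffBound a m))
              * (R ^ m * ‖s‖ ^ k * (Real.exp R / (a.re + 1))) := by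
              gcongr
              · exact hC n j m hn
              · exact norm_expMoment_shift_le ha _ n hs
          _ = _ := by ring
    _ = (C * (Real.exp R / (a.re + 1)) * coeffBound a j * ‖s‖ ^ k)
        * ∑ m ∈ Finset.range (n + 1), coeffBound a m * R ^ m := by rw [Finset.mul_sum]
    _ ≤ (C * (Real.exp R / (a.re + 1)) * coeffBound a j * ‖s‖ ^ k)
        * ∑' m : ℕ, coeffBound a m * R ^ m := by
        refine mul_le_mul_of_nonneg_left (hS.sum_le_tsum _ fun m _ => ?_) (by positivity)
        have := coeffBound_pos ha m; positivity
    _ = _ := by ring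

lemma tendsto_div_four_mul (s : ℂ) :
    Tendsto (fun p : ℕ × ℂ => p.2 / (4 * (p.1 : ℂ))) (atTop ×ˢ 𝓝 s) (𝓝 0) := by
  have h1 : Tendsto (fun n : ℕ => (4 * (n : ℂ))⁻¹) atTop (𝓝 0) := by
    have := (Complex.continuous_ofReal.tendsto 0).comp (tendsto_inv_atTop_nhds_zero_nat (𝕜 := ℝ))
    have := this.const_mul (4 : ℂ)⁻¹
    simpa [Function.comp_def, mul_comm] using this
  have h2 := (tendsto_snd (f := atTop (α := ℕ)) (g := 𝓝 s)).mul (h1.comp tendsto_fst)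
  rw [mul_zero] at h2
  exact h2.congr fun p => by simp [div_eq_mul_inv]

lemma eventually_prod_norm_le (s : ℂ) :
    ∀ᶠ p : ℕ × ℂ in atTop ×ˢ 𝓝 s, 0 < p.1 ∧ ‖p.2‖ ≤ ‖s‖ + 1 := by
  have h1 : ∀ᶠ z : ℂ in 𝓝 s, ‖z‖ ≤ ‖s‖ + 1 :=
    (continuous_norm.tendsto s).eventually (eventually_le_nhds (by linarith))
  filter_upwards [(eventually_gt_atTop 0).prod_inl _, h1.prod_inr _] with p h1 h2 using ⟨h1, h2⟩

lemma tendsto_kernelN {a : ℂ} (ha : -1 < a.re) (s : ℂ) (j k : ℕ) :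
    Tendsto (fun p : ℕ × ℂ => kernelN a p.1 p.2 j k) (atTop ×ˢ 𝓝 s) (𝓝 (kernelInf a s j k)) := by
  obtain ⟨C, hC0, hC⟩ := exists_norm_scaledInv_le ha
  have hR : 0 < ‖s‖ + 1 := by positivity
  have ha1 : 0 < a.re + 1 := by linarith
  simp only [kernelN_eq_tsum]
  refine tendsto_tsum_of_dominated_convergence (bound := fun m =>
    (C * (Real.exp (‖s‖ + 1) / (a.re + 1)) * coeffBound a j * (‖s‖ + 1) ^ k)
      * (coeffBound a m * (‖s‖ + 1) ^ m)) ((summable_coeffBound_mul_pow ha hR).mul_left _) ?_ ?_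
  · intro m
    refine ((tendsto_scaledInv ha j m).comp tendsto_fst).mul ((tendsto_snd.pow _).mul ?_)
    have h := ((hasDerivAt_expMoment (re_natCast_add ha (m + k)) 0).continuousAt.tendsto).comp
      (tendsto_div_four_mul s)
    rwa [expMoment_zero (re_natCast_add ha (m + k))] at h
  · filter_upwards [eventually_prod_norm_le s] with p hp m
    have hcm := coeffBound_pos ha m
    have hcj := coeffBound_pos ha j
    rw [norm_mul, norm_mul, norm_pow, pow_add]
    calc ‖scaledInv a p.1 j m‖ * (‖p.2‖ ^ m * ‖p.2‖ ^ k
          * ‖expMoment ((m + k : ℕ) + a) (p.2 / (4 * p.1))‖)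
        ≤ (C * (coeffBound a j * coeffBound a m))
          * ((‖s‖ + 1) ^ m * (‖s‖ + 1) ^ k * (Real.exp (‖s‖ + 1) / (a.re + 1))) := by
          gcongr
          · exact hC _ j m hp.1
          · exact hp.2
          · exact hp.2
          · exact norm_expMoment_shift_le ha _ _ hp.2
      _ = _ := by ring

lemma exists_norm_kernelInf_le {a : ℂ} (ha : -1 < a.re) {R : ℝ} (hR : 0 < R) :
    ∃ C : ℝ, 0 ≤ C ∧ ∀ s : ℂ, ‖s‖ ≤ R → ∀ j k : ℕ,
      ‖kernelInf a s j k‖ ≤ C * coeffBound a j * ‖s‖ ^ k := by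
  obtain ⟨C, hC0, hC⟩ := exists_norm_kernelN_le ha hR
  refine ⟨C, hC0, fun s hs j k => ?_⟩
  have hp : Tendsto (fun n : ℕ => (n, s)) atTop (atTop ×ˢ 𝓝 s) :=
    tendsto_id.prodMk tendsto_const_nhds
  have h := (tendsto_kernelN ha s j k).comp hp
  refine le_of_tendsto h.norm ?_
  filter_upwards [eventually_gt_atTop 0] with n hn using hC n hn s hs j k

/-- The Fredholm expansion `det(1 - zY)` of an infinite matrix. -/
def fredholm (Y : ℕ → ℕ → ℂ) (z : ℂ) : ℂ := ∑' J : Finset ℕ, (-z) ^ J.card * minor Y J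

lemma norm_fredholm_term_le {Y : ℕ → ℕ → ℂ} {C R Z : ℝ} {α : ℕ → ℝ} (hα : ∀ j, 0 ≤ α j)
    (hC : 0 ≤ C) (hR : 0 ≤ R) (h : ∀ j k, ‖Y j k‖ ≤ C * α j * R ^ k) {z : ℂ} (hz : ‖z‖ ≤ Z)
    (J : Finset ℕ) :
    ‖(-z) ^ J.card * minor Y J‖ ≤ ∏ j ∈ J, (Z * C * (((j : ℝ) + 1) * (α j * R ^ j))) := by
  have h1 := norm_minor_le (α := fun j => C * α j) (β := fun k => R ^ k)
    (fun j => mul_nonneg hC (hα j)) (fun k => pow_nonneg hR k) h J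
  rw [norm_mul, norm_pow, norm_neg]
  calc ‖z‖ ^ J.card * ‖minor Y J‖
      ≤ Z ^ J.card * ∏ j ∈ J, (((j : ℝ) + 1) * (C * α j * R ^ j)) := by
        exact mul_le_mul (pow_le_pow_left₀ (norm_nonneg _) hz _) h1 (norm_nonneg _)
          (pow_nonneg ((norm_nonneg _).trans hz) _)
    _ = ∏ j ∈ J, (Z * C * (((j : ℝ) + 1) * (α j * R ^ j))) := by
        rw [← Finset.prod_const, ← Finset.prod_mul_distrib]
        exact Finset.prod_congr rfl fun j _ => by ring

lemma summable_prod_coeffBound {a : ℂ} (ha : -1 < a.re) {R : ℝ} (hR : 0 < R) (c : ℝ) :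
    Summable fun J : Finset ℕ => ∏ j ∈ J, (c * (((j : ℝ) + 1) * (coeffBound a j * R ^ j))) :=
  summable_finsetProd_of_summable_norm ((summable_coeffBound ha hR).mul_left c).norm

/-- The hard-edge limit of `detN`. -/
def detInf (a s : ℂ) : ℂ := fredholm (kernelInf a s) (s ^ (a + 1))

lemma tendsto_minor {ι : Type*} {l : Filter ι} {Y : ι → ℕ → ℕ → ℂ} {Y0 : ℕ → ℕ → ℂ}
    (h : ∀ j k, Tendsto (fun i => Y i j k) l (𝓝 (Y0 j k))) (J : Finset ℕ) :
    Tendsto (fun i => minor (Y i) J) l (𝓝 (minor Y0 J)) := by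
  have hc : Continuous fun M : Matrix J J ℂ => M.det := continuous_id.matrix_det
  refine (hc.tendsto (Matrix.of fun i j : J => Y0 i j)).comp ?_
  exact tendsto_pi_nhds.2 fun i => tendsto_pi_nhds.2 fun j => h i j

/-- Dominated convergence over finite subsets of ℕ. Joint convergence in n and in the point is what
yields continuity of the limit and local uniformity. -/
lemma tendsto_detN {a : ℂ} (ha : -1 < a.re) {s : ℂ} (hs : s ∈ Complex.slitPlane) :
    Tendsto (fun p : ℕ × ℂ => detN a p.1 p.2) (atTop ×ˢ 𝓝 s) (𝓝 (detInf a s)) := by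
  have hR : 0 < ‖s‖ + 1 := by positivity
  obtain ⟨C, hC0, hC⟩ := exists_norm_kernelN_le ha hR
  have hz : Tendsto (fun p : ℕ × ℂ => p.2 ^ (a + 1)) (atTop ×ˢ 𝓝 s) (𝓝 (s ^ (a + 1))) :=
    tendsto_snd.cpow tendsto_const_nhds hs
  refine tendsto_tsum_of_dominated_convergence
    (summable_prod_coeffBound ha hR ((‖s ^ (a + 1)‖ + 1) * C)) ?_ ?_
  · intro J
    exact (hz.neg.pow _).mul (tendsto_minor (tendsto_kernelN ha s) J)
  · filter_upwards [eventually_prod_norm_le s,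
      hz.norm.eventually (eventually_le_nhds (lt_add_one _))] with p hp hpz J
    refine norm_fredholm_term_le (fun j => (coeffBound_pos ha j).le) hC0 hR.le (fun j k => ?_) hpz J
    refine (hC _ hp.1 _ hp.2 j k).trans ?_
    have := coeffBound_pos ha j
    gcongr
    exact hp.2

lemma continuousAt_detInf {a : ℂ} (ha : -1 < a.re) {s : ℂ} (hs : s ∈ Complex.slitPlane) :
    ContinuousAt (detInf a) s := by
  rw [ContinuousAt, Metric.tendsto_nhds]
  intro ε hε
  have h1 := (Metric.tendsto_nhds.1 (tendsto_detN ha hs) (ε / 2) (half_pos hε))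
  have h2 := (eventually_swap_iff.1 h1).curry
  filter_upwards [h2, Complex.isOpen_slitPlane.mem_nhds hs] with z hz hzs
  have hp : Tendsto (fun n : ℕ => (n, z)) atTop (atTop ×ˢ 𝓝 z) :=
    tendsto_id.prodMk tendsto_const_nhds
  have h3 := (((tendsto_detN ha hzs).comp hp).dist (tendsto_const_nhds (x := detInf a s)))
  exact (le_of_tendsto h3 (hz.mono fun n hn => hn.le)).trans_lt (half_lt_self hε)

lemma tendstoLocallyUniformlyOn_detN {a : ℂ} (ha : -1 < a.re) :
    TendstoLocallyUniformlyOn (detN a) (detInf a) atTop Complex.slitPlane := by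
  rw [tendstoLocallyUniformlyOn_iff_forall_tendsto]
  intro s hs
  rw [nhdsWithin_eq_nhds.2 (Complex.isOpen_slitPlane.mem_nhds hs)]
  have h := ((continuousAt_detInf ha hs).tendsto.comp
    (tendsto_snd (f := atTop (α := ℕ)))).prodMk_nhds (tendsto_detN ha hs)
  exact h.mono_right (nhds_le_uniformity _)

lemma expMoment_differentiable {b : ℂ} (hb : -1 < b.re) : Differentiable ℂ (expMoment b) :=
  fun z => (hasDerivAt_expMoment hb z).differentiableAt

lemma differentiable_kernelN {a : ℂ} (ha : -1 < a.re) (n j k : ℕ) :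
    Differentiable ℂ fun s => kernelN a n s j k := by
  unfold kernelN
  refine Differentiable.fun_sum fun m _ => ?_
  refine (((differentiable_id.pow _).mul ((expMoment_differentiable
    (re_natCast_add ha (m + k))).comp (differentiable_id.div_const _)))).const_mul _

lemma differentiable_det {n : Type*} [Fintype n] [DecidableEq n] {M : ℂ → Matrix n n ℂ}
    (h : ∀ i j, Differentiable ℂ fun s => M s i j) : Differentiable ℂ fun s => (M s).det := by
  simp only [Matrix.det_apply]
  exact Differentiable.fun_sum fun σ _ =>
    (Differentiable.fun_finsetProd fun i _ => h _ _).const_smul _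

lemma differentiable_minor {Y : ℂ → ℕ → ℕ → ℂ} (h : ∀ j k, Differentiable ℂ fun s => Y s j k)
    (J : Finset ℕ) : Differentiable ℂ fun s => minor (Y s) J :=
  differentiable_det fun i j => h i j

lemma differentiableAt_cpow_left (c : ℂ) {s : ℂ} (hs : s ∈ Complex.slitPlane) :
    DifferentiableAt ℂ (fun s : ℂ => s ^ c) s :=
  differentiableAt_id.cpow_const hs

/-- The series collapses back to a determinant of size n+1, whose entries are analytic off the cut.
-/
lemma differentiableOn_detN {a : ℂ} (ha : -1 < a.re) (n : ℕ) :
    DifferentiableOn ℂ (detN a n) Complex.slitPlane := by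
  have h : detN a n = fun s => (1 - (s ^ (a + 1)) • Matrix.of
      fun i j : Fin (n + 1) => kernelN a n s i j).det := by
    funext s
    rw [det_one_sub_eq_tsum, detN]
    intro i hi k
    refine Finset.sum_eq_zero fun m _ => ?_
    rw [scaledInv_eq_zero (Or.inl hi), zero_mul]
  rw [h]
  intro s hs
  simp only [Matrix.det_apply]
  refine (DifferentiableAt.fun_sum fun σ _ => ?_).differentiableWithinAt
  refine (DifferentiableAt.fun_finsetProd fun i _ => ?_).const_smul _
  exact (differentiableAt_const _).sub ((differentiableAt_cpow_left _ hs).mul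
    (differentiable_kernelN ha n _ _ s))

lemma differentiableOn_detInf {a : ℂ} (ha : -1 < a.re) :
    DifferentiableOn ℂ (detInf a) Complex.slitPlane :=
  (tendstoLocallyUniformlyOn_detN ha).differentiableOn
    (Eventually.of_forall fun n => differentiableOn_detN ha n) Complex.isOpen_slitPlane

/-! ### The limit determinant near s = 0, graded by the size of the minors -/

/-- Taylor remainders of the rows of `kernelInf`. -/
def kernelTail (a : ℂ) (M j k : ℕ) (s : ℂ) : ℂ :=
  ∑' m : ℕ, besselCoeff a j (m + M) * (s ^ m * (1 / (((m + M + k : ℕ) : ℂ) + a + 1)))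

lemma norm_one_div_natCast_add_le {a : ℂ} (ha : -1 < a.re) (p : ℕ) :
    ‖1 / ((p : ℂ) + a + 1)‖ ≤ (a.re + 1)⁻¹ := by
  have h0 : 0 < a.re + 1 := by linarith
  rw [norm_div, norm_one, one_div]
  refine inv_anti₀ h0 (le_trans ?_ (Complex.re_le_norm _))
  simp

lemma exists_kernelTail_bound {a : ℂ} (ha : -1 < a.re) (M j k : ℕ) {R : ℝ} (hR : 1 ≤ R) :
    ∃ u : ℕ → ℝ, Summable u ∧ ∀ s : ℂ, ‖s‖ ≤ R → ∀ m : ℕ,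
      ‖besselCoeff a j (m + M) * (s ^ m * (1 / (((m + M + k : ℕ) : ℂ) + a + 1)))‖ ≤ u m := by
  obtain ⟨C, hC0, hC⟩ := norm_besselCoeff_le ha
  have h0 : 0 < a.re + 1 := by linarith
  have hS := (summable_nat_add_iff M).2 (summable_coeffBound_mul_pow ha (zero_lt_one.trans_le hR))
  refine ⟨_, hS.mul_left (C * coeffBound a j * (a.re + 1)⁻¹), fun s hs m => ?_⟩
  have h1 := coeffBound_pos ha j
  have h2 := coeffBound_pos ha (m + M)
  rw [norm_mul, norm_mul, norm_pow]
  calc ‖besselCoeff a j (m + M)‖ * (‖s‖ ^ m * ‖1 / (((m + M + k : ℕ) : ℂ) + a + 1)‖)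
      ≤ (C * (coeffBound a j * coeffBound a (m + M))) * (R ^ (m + M) * (a.re + 1)⁻¹) := by
        gcongr
        · exact hC _ _
        · exact (pow_le_pow_left₀ (norm_nonneg _) hs m).trans
            (pow_le_pow_right₀ hR (Nat.le_add_right _ _))
        · exact norm_one_div_natCast_add_le ha _
    _ = _ := by ring

lemma differentiable_of_ball {f : ℂ → ℂ}
    (h : ∀ R : ℝ, 1 ≤ R → DifferentiableOn ℂ f (Metric.ball 0 R)) : Differentiable ℂ f := fun s =>
  (h (‖s‖ + 1) (by linarith [norm_nonneg s])).differentiableAt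
    (Metric.isOpen_ball.mem_nhds (by simp))

lemma differentiable_kernelTail {a : ℂ} (ha : -1 < a.re) (M j k : ℕ) :
    Differentiable ℂ (kernelTail a M j k) := by
  refine differentiable_of_ball fun R hR => ?_
  obtain ⟨u, hu, hb⟩ := exists_kernelTail_bound ha M j k hR
  refine Complex.differentiableOn_tsum_of_summable_norm hu (fun m => ?_) Metric.isOpen_ball
    fun m s hs => hb s (by simpa using (Metric.mem_ball.1 hs).le) m
  exact (((differentiable_id.pow m).mul_const _).const_mul _).differentiableOn

lemma kernelTail_eq {a : ℂ} (ha : -1 < a.re) (M j k : ℕ) (s : ℂ) :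
    kernelTail a M j k s = besselCoeff a j M / (((M + k : ℕ) : ℂ) + a + 1)
      + s * kernelTail a (M + 1) j k s := by
  obtain ⟨u, hu, hb⟩ := exists_kernelTail_bound ha M j k (R := ‖s‖ + 1)
    (by linarith [norm_nonneg s])
  have hs : Summable _ := Summable.of_norm_bounded hu (hb s (by linarith))
  rw [kernelTail, hs.tsum_eq_zero_add, kernelTail, ← tsum_mul_left]
  congr 1
  · simp [div_eq_mul_inv]
  · refine tsum_congr fun m => ?_
    rw [show m + 1 + M = m + (M + 1) by ring, pow_succ]
    ring

lemma kernelInf_eq (a s : ℂ) (j k : ℕ) : kernelInf a s j k = s ^ k * kernelTail a 0 j k s := by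
  rw [kernelInf, kernelTail, ← tsum_mul_left]
  refine tsum_congr fun m => ?_
  rw [pow_add, add_zero]; ring

lemma differentiable_kernelInf {a : ℂ} (ha : -1 < a.re) (j k : ℕ) :
    Differentiable ℂ fun s => kernelInf a s j k := by
  simp only [kernelInf_eq]
  exact (differentiable_id.pow k).mul (differentiable_kernelTail ha 0 j k)

lemma minor_eq_det {p : ℕ} (Y : ℕ → ℕ → ℂ) {J : Finset ℕ} (e : Fin p → ℕ)
    (he : Function.Injective e) (hJ : ∀ x, x ∈ J ↔ ∃ i, e i = x) :
    minor Y J = (Matrix.of fun i j : Fin p => Y (e i) (e j)).det := by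
  let f : Fin p ≃ J :=
    Equiv.ofBijective (fun i => ⟨e i, (hJ _).2 ⟨i, rfl⟩⟩)
      ⟨fun i j h => he (congrArg Subtype.val h), fun ⟨x, hx⟩ => by
        obtain ⟨y, rfl⟩ := (hJ x).1 hx
        exact ⟨y, rfl⟩⟩
  rw [minor, ← Matrix.det_submatrix_equiv_self f]
  rfl

lemma minor_singleton (Y : ℕ → ℕ → ℂ) (x : ℕ) : minor Y {x} = Y x x := by
  rw [minor_eq_det Y (fun _ : Fin 1 => x) (fun i j _ => Subsingleton.elim i j)
    (by simp [eq_comm]), Matrix.det_fin_one]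
  rfl

lemma minor_pair (Y : ℕ → ℕ → ℂ) {x y : ℕ} (hxy : x ≠ y) :
    minor Y {x, y} = Y x x * Y y y - Y x y * Y y x := by
  rw [minor_eq_det Y ![x, y] (fun i j h => by fin_cases i <;> fin_cases j <;> simp_all)
    (by simp [Fin.exists_fin_two, eq_comm]), Matrix.det_fin_two]
  rfl

lemma minor_triple (Y : ℕ → ℕ → ℂ) :
    minor Y {0, 1, 2} = (Matrix.of fun i j : Fin 3 => Y i j).det :=
  minor_eq_det Y (fun i : Fin 3 => (i : ℕ)) Fin.val_injective fun x => by
    simp [Fin.exists_fin_succ, eq_comm]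

/-- Column k of the kernel carries s^k, so the minor on J is of order s to the sum of J. The numbers
p and M record how much of |J| and of that sum is to be kept, uniformly in J. -/
lemma norm_sum_minors_bound {a : ℂ} (ha : -1 < a.re) {ρ : ℝ} (hρ : 1 ≤ ρ) :
    ∃ u : Finset ℕ → ℝ, Summable u ∧ (∀ J, 0 ≤ u J) ∧ ∀ (J : Finset ℕ) (p M : ℕ), p ≤ J.card →
      M ≤ ∑ j ∈ J, j → ∀ s : ℂ, ‖s‖ ≤ 1 → ∀ z : ℂ, ‖z‖ ≤ ρ →
        ‖(-z) ^ J.card * minor (kernelInf a s) J‖ ≤ ‖z‖ ^ p * ‖s‖ ^ M * u J := by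
  obtain ⟨C, hC0, hC⟩ := exists_norm_kernelInf_le ha one_pos
  refine ⟨_, summable_prod_coeffBound ha one_pos (ρ * C), fun J => ?_, ?_⟩
  · refine Finset.prod_nonneg fun j _ => ?_
    have := coeffBound_pos ha j
    positivity
  intro J p M hp hM s hs z hz
  have h1 := norm_minor_le (Y := kernelInf a s) (α := fun j => C * coeffBound a j)
    (β := fun k => ‖s‖ ^ k) (fun j => mul_nonneg hC0 (coeffBound_pos ha j).le)
    (fun k => by positivity) (hC s hs) J
  have h2 : ‖z‖ ^ J.card ≤ ‖z‖ ^ p * ρ ^ J.card := by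
    obtain ⟨q, hq⟩ := Nat.exists_eq_add_of_le hp
    rw [hq, pow_add]
    refine mul_le_mul_of_nonneg_left ?_ (by positivity)
    exact (pow_le_pow_left₀ (norm_nonneg _) hz q).trans
      (pow_le_pow_right₀ hρ (Nat.le_add_left _ _))
  have h3 : ∏ j ∈ J, ‖s‖ ^ j ≤ ‖s‖ ^ M := by
    rw [Finset.prod_pow_eq_pow_sum]
    exact pow_le_pow_of_le_one (norm_nonneg _) hs hM
  have h4 : 0 ≤ ∏ j ∈ J, (((j : ℝ) + 1) * (C * coeffBound a j)) :=
    Finset.prod_nonneg fun j _ => by have := coeffBound_pos ha j; positivity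
  rw [norm_mul, norm_pow, norm_neg]
  calc ‖z‖ ^ J.card * ‖minor (kernelInf a s) J‖
      ≤ (‖z‖ ^ p * ρ ^ J.card) * ((∏ j ∈ J, (((j : ℝ) + 1) * (C * coeffBound a j))) * ‖s‖ ^ M) := by
        refine mul_le_mul h2 (h1.trans ?_) (norm_nonneg _) (by positivity)
        simp only [← mul_assoc]
        rw [Finset.prod_mul_distrib]
        simp only [mul_assoc]
        exact mul_le_mul_of_nonneg_left h3 h4
    _ = ‖z‖ ^ p * ‖s‖ ^ M * ∏ j ∈ J, (ρ * C * (((j : ℝ) + 1) * (coeffBound a j * 1 ^ j))) := by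
        have : ρ ^ J.card * ∏ j ∈ J, (((j : ℝ) + 1) * (C * coeffBound a j))
            = ∏ j ∈ J, (ρ * C * (((j : ℝ) + 1) * (coeffBound a j * 1 ^ j))) := by
          rw [← Finset.prod_const, ← Finset.prod_mul_distrib]
          exact Finset.prod_congr rfl fun j _ => by rw [one_pow]; ring
        rw [← this]; ring

/-- The part of the Fredholm expansion of `kernelInf` indexed by a set of minors. -/
def partialFredholm (a : ℂ) (S : Set (Finset ℕ)) (z s : ℂ) : ℂ :=
  ∑' J : Finset ℕ, S.indicator (fun J => (-z) ^ J.card * minor (kernelInf a s) J) J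

lemma exists_fredholm_bound {a : ℂ} (ha : -1 < a.re) {R : ℝ} (hR : 0 < R) (Z : ℝ) :
    ∃ u : Finset ℕ → ℝ, Summable u ∧ ∀ s : ℂ, ‖s‖ ≤ R → ∀ z : ℂ, ‖z‖ ≤ Z → ∀ (S : Set (Finset ℕ)) J,
      ‖S.indicator (fun J => (-z) ^ J.card * minor (kernelInf a s) J) J‖ ≤ u J := by
  obtain ⟨C, hC0, hC⟩ := exists_norm_kernelInf_le ha hR
  refine ⟨_, summable_prod_coeffBound ha hR (Z * C), fun s hs z hz S J => ?_⟩
  refine (norm_indicator_le_norm_self _ _).trans ?_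
  refine norm_fredholm_term_le (fun j => (coeffBound_pos ha j).le) hC0 hR.le (fun j k => ?_) hz J
  refine (hC s hs j k).trans ?_
  have := coeffBound_pos ha j
  gcongr

lemma summable_partialFredholm {a : ℂ} (ha : -1 < a.re) (S : Set (Finset ℕ)) (z s : ℂ) :
    Summable (S.indicator fun J => (-z) ^ J.card * minor (kernelInf a s) J) := by
  obtain ⟨u, hu, hb⟩ := exists_fredholm_bound ha (R := ‖s‖ + 1) (by positivity) ‖z‖
  exact Summable.of_norm_bounded hu (hb s (by linarith) z le_rfl S)

lemma partialFredholm_union {a : ℂ} (ha : -1 < a.re) {S T : Set (Finset ℕ)} (h : Disjoint S T)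
    (z s : ℂ) :
    partialFredholm a (S ∪ T) z s = partialFredholm a S z s + partialFredholm a T z s := by
  rw [partialFredholm, partialFredholm, partialFredholm,
    ← (summable_partialFredholm ha S z s).tsum_add (summable_partialFredholm ha T z s)]
  refine tsum_congr fun J => ?_
  rw [Set.indicator_union_of_disjoint h]

lemma partialFredholm_singleton (a : ℂ) (J : Finset ℕ) (z s : ℂ) :
    partialFredholm a {J} z s = (-z) ^ J.card * minor (kernelInf a s) J := by
  rw [partialFredholm, tsum_eq_single J]
  · simp
  · intro K hK
    simp [hK]

lemma partialFredholm_insert {a : ℂ} (ha : -1 < a.re) {S : Set (Finset ℕ)} {J : Finset ℕ}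
    (hJ : J ∈ S) (z s : ℂ) : partialFredholm a S z s
      = (-z) ^ J.card * minor (kernelInf a s) J + partialFredholm a (S \ {J}) z s := by
  rw [← partialFredholm_singleton, ← partialFredholm_union ha Set.disjoint_sdiff_right,
    Set.union_sdiff_cancel (by simpa using hJ)]

lemma partialFredholm_card {a : ℂ} (p : ℕ) (z s : ℂ) :
    partialFredholm a {J | J.card = p} z s
      = (-z) ^ p * partialFredholm a {J | J.card = p} (-1) s := by
  rw [partialFredholm, partialFredholm, ← tsum_mul_left]
  refine tsum_congr fun J => ?_
  by_cases hJ : J.card = p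
  · simp [Set.indicator, hJ]
  · simp [Set.indicator, hJ]

lemma detInf_eq_partialFredholm (a s : ℂ) :
    detInf a s = partialFredholm a Set.univ (s ^ (a + 1)) s := by
  simp [detInf, fredholm, partialFredholm]

lemma differentiable_partialFredholm {a : ℂ} (ha : -1 < a.re) (S : Set (Finset ℕ)) {φ ψ : ℂ → ℂ}
    (hφ : Differentiable ℂ φ) (hψ : Differentiable ℂ ψ) :
    Differentiable ℂ fun w => partialFredholm a S (φ w) (ψ w) := by
  refine differentiable_of_ball fun R _ => ?_
  obtain ⟨C1, h1⟩ := (isCompact_closedBall (0 : ℂ) R).exists_bound_of_continuousOn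
    hφ.continuous.continuousOn
  obtain ⟨C2, h2⟩ := (isCompact_closedBall (0 : ℂ) R).exists_bound_of_continuousOn
    hψ.continuous.continuousOn
  obtain ⟨u, hu, hb⟩ := exists_fredholm_bound ha (R := max C2 1) (by positivity) C1
  refine Complex.differentiableOn_tsum_of_summable_norm hu (fun J => ?_) Metric.isOpen_ball
    fun J w hw => ?_
  · refine Differentiable.differentiableOn ?_
    by_cases hJ : J ∈ S
    · simp only [Set.indicator_of_mem hJ]
      exact (hφ.neg.pow _).mul ((differentiable_minor (differentiable_kernelInf ha) J).comp hψ)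
    · simp only [Set.indicator_of_notMem hJ]
      exact differentiable_const _
  · have hw' := Metric.ball_subset_closedBall hw
    exact hb _ ((h2 w hw').trans (le_max_left _ _)) _ (h1 w hw') S J

lemma norm_partialFredholm_le {a : ℂ} (ha : -1 < a.re) {ρ : ℝ} (hρ : 1 ≤ ρ)
    {S : Set (Finset ℕ)} {p M : ℕ} (hS : ∀ J ∈ S, p ≤ J.card ∧ M ≤ ∑ j ∈ J, j) :
    ∃ C : ℝ, 0 ≤ C ∧ ∀ s : ℂ, ‖s‖ ≤ 1 → ∀ z : ℂ, ‖z‖ ≤ ρ →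
      ‖partialFredholm a S z s‖ ≤ C * ‖z‖ ^ p * ‖s‖ ^ M := by
  obtain ⟨u, hu, hu0, hb⟩ := norm_sum_minors_bound ha hρ
  refine ⟨∑' J, u J, tsum_nonneg hu0, fun s hs z hz => ?_⟩
  have h1 : ∀ J, ‖S.indicator (fun J => (-z) ^ J.card * minor (kernelInf a s) J) J‖
      ≤ ‖z‖ ^ p * ‖s‖ ^ M * u J := fun J => by
    by_cases hJ : J ∈ S
    · rw [Set.indicator_of_mem hJ]
      exact hb J p M (hS J hJ).1 (hS J hJ).2 s hs z hz
    · rw [Set.indicator_of_notMem hJ, norm_zero]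
      have := hu0 J
      positivity
  refine (tsum_of_norm_bounded ((hu.mul_left _).hasSum) h1).trans (le_of_eq ?_)
  rw [tsum_mul_left]; ring

/-- A function analytic at `0` and `O(s^M)` there is divisible by `s^M`. -/
lemma exists_eq_pow_mul_of_isBigO {f : ℂ → ℂ} (hf : AnalyticAt ℂ f 0) {M : ℕ}
    (h : f =O[𝓝 0] fun s => s ^ M) :
    ∃ g : ℂ → ℂ, AnalyticAt ℂ g 0 ∧ ∀ᶠ s in 𝓝 0, f s = s ^ M * g s := by
  have h1 : (M : ℕ∞) ≤ analyticOrderAt f 0 := by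
    by_contra hcon
    push Not at hcon
    obtain ⟨k, hk⟩ := ENat.ne_top_iff_exists.1 hcon.ne_top
    rw [← hk] at hcon
    have hkM : k < M := by exact_mod_cast hcon
    obtain ⟨g, hg, hg0, hfg⟩ := (hf.analyticOrderAt_eq_natCast (n := k)).1 hk.symm
    obtain ⟨C, hC⟩ := h.bound
    have h2 : ∀ᶠ s : ℂ in 𝓝[≠] 0, ‖g s‖ ≤ C * ‖s‖ ^ (M - k) := by
      filter_upwards [nhdsWithin_le_nhds hC, nhdsWithin_le_nhds hfg, self_mem_nhdsWithin]
        with s h3 h4 h5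
      have h6 : 0 < ‖s‖ ^ k := pow_pos (norm_pos_iff.2 h5) k
      rw [h4, sub_zero, smul_eq_mul, norm_mul, norm_pow, norm_pow,
        ← Nat.sub_add_cancel hkM.le, pow_add, ← mul_assoc, mul_comm] at h3
      exact le_of_mul_le_mul_right h3 h6
    have h7 : Tendsto (fun s : ℂ => C * ‖s‖ ^ (M - k)) (𝓝[≠] 0) (𝓝 0) := by
      have : Continuous fun s : ℂ => C * ‖s‖ ^ (M - k) := by fun_prop
      have := (this.tendsto 0).mono_left (nhdsWithin_le_nhds (s := {0}ᶜ))
      simpa [Nat.sub_ne_zero_of_lt hkM] using this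
    have h8 := squeeze_zero_norm' h2 h7
    exact hg0 (tendsto_nhds_unique (hg.continuousAt.tendsto.mono_left nhdsWithin_le_nhds) h8)
  obtain ⟨g, hg, hfg⟩ := (natCast_le_analyticOrderAt hf).1 h1
  refine ⟨g, hg, hfg.mono fun s hs => ?_⟩
  rw [hs, sub_zero, smul_eq_mul]

lemma isBigO_partialFredholm {a : ℂ} (ha : -1 < a.re) {S : Set (Finset ℕ)} {M : ℕ}
    (hS : ∀ J ∈ S, M ≤ ∑ j ∈ J, j) :
    (fun s => partialFredholm a S (-1) s) =O[𝓝 0] fun s => s ^ M := by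
  obtain ⟨C, hC0, hC⟩ := norm_partialFredholm_le ha le_rfl (p := 0)
    fun J hJ => ⟨Nat.zero_le _, hS J hJ⟩
  refine IsBigO.of_bound C ?_
  filter_upwards [Metric.ball_mem_nhds (0 : ℂ) one_pos] with s hs
  have := hC s (by simpa using (Metric.mem_ball.1 hs).le) (-1) (by simp)
  simpa using this

lemma besselCoeff_symm (a : ℂ) (j m : ℕ) : besselCoeff a j m = besselCoeff a m j := by
  rw [besselCoeff, besselCoeff, add_comm j m]; ring

lemma subset_range_of_sum_lt {J : Finset ℕ} {N : ℕ} (h : ∑ j ∈ J, j < N) : J ⊆ Finset.range N :=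
  fun _ hx => Finset.mem_range.2
    (lt_of_le_of_lt (Finset.single_le_sum (f := fun j => j) (fun _ _ => Nat.zero_le _) hx) h)

/-- Below order s³ only the sets {0}, {1} and {2} contribute. -/
lemma exists_partialFredholm_one {a : ℂ} (ha : -1 < a.re) :
    ∃ g : ℂ → ℂ, AnalyticAt ℂ g 0 ∧ ∀ᶠ s in 𝓝 0,
      partialFredholm a {J | J.card = 1} (-1) s = besselCoeff a 0 0 / (a + 1)
        + 2 * besselCoeff a 0 1 / (a + 2) * s
        + (2 * besselCoeff a 0 2 + besselCoeff a 1 1) / (a + 3) * s ^ 2 + s ^ 3 * g s := by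
  set S : Set (Finset ℕ) := (({J | J.card = 1} \ {{0}}) \ {{1}}) \ {{2}} with hS
  have hSum : ∀ J ∈ S, 3 ≤ ∑ j ∈ J, j := by
    rintro J ⟨⟨⟨hJ, h0⟩, h1⟩, h2⟩
    by_contra hcon
    have hsub := subset_range_of_sum_lt (not_le.1 hcon)
    simp only [Set.mem_ofPred_eq, Set.mem_singleton_iff] at hJ h0 h1 h2
    obtain ⟨x, rfl⟩ := Finset.card_eq_one.1 hJ
    simp only [Finset.singleton_subset_iff, Finset.mem_range, Finset.singleton_inj] at *
    omega
  have hd := differentiable_partialFredholm ha S (φ := fun _ => -1) (ψ := id)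
    (differentiable_const _) differentiable_id
  obtain ⟨g, hg, hfg⟩ := exists_eq_pow_mul_of_isBigO
    (hd.analyticAt 0) (isBigO_partialFredholm ha hSum)
  have ht := fun M j k => (differentiable_kernelTail ha M j k).analyticAt 0
  refine ⟨fun s => kernelTail a 3 0 0 s + kernelTail a 2 1 1 s + kernelTail a 1 2 2 s + g s,
    (((ht 3 0 0).add (ht 2 1 1)).add (ht 1 2 2)).add hg, hfg.mono fun s hs => ?_⟩
  simp only [id] at hs
  rw [partialFredholm_insert ha (J := {0}) (by simp), partialFredholm_insert ha (J := {1}) (by simp),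
    partialFredholm_insert ha (J := {2}) (by simp), ← hS, hs]
  have K00 : kernelInf a s 0 0 = besselCoeff a 0 0 / (a + 1) + s * (besselCoeff a 0 1 / (a + 2)
      + s * (besselCoeff a 0 2 / (a + 3) + s * kernelTail a 3 0 0 s)) := by
    rw [kernelInf_eq, kernelTail_eq ha 0, kernelTail_eq ha 1, kernelTail_eq ha 2]; push_cast; ring_nf
  have K11 : kernelInf a s 1 1 = s * (besselCoeff a 0 1 / (a + 2)
      + s * (besselCoeff a 1 1 / (a + 3) + s * kernelTail a 2 1 1 s)) := by
    rw [kernelInf_eq, kernelTail_eq ha 0, kernelTail_eq ha 1, besselCoeff_symm a 1 0]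
    push_cast; ring_nf
  have K22 : kernelInf a s 2 2 = s ^ 2 * (besselCoeff a 0 2 / (a + 3)
      + s * kernelTail a 1 2 2 s) := by
    rw [kernelInf_eq, kernelTail_eq ha 0, besselCoeff_symm a 2 0]; push_cast; ring_nf
  simp only [minor_singleton, Finset.card_singleton, K00, K11, K22]
  ring

lemma natCast_add_ne_zero {a : ℂ} (ha : -1 < a.re) {x : ℝ} (hx : 1 ≤ x) : a + x ≠ 0 := fun h => by
  have := congrArg Complex.re h
  simp at this; linarith

/-- After removing s^k from column k the kernel has rank one at s = 0. Hence {0,1} loses its term of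
order s and {0,2} its term of order s², and the leading coefficient comes from the next order of
{0,1} alone. -/
lemma exists_partialFredholm_two {a : ℂ} (ha : -1 < a.re) :
    ∃ g : ℂ → ℂ, AnalyticAt ℂ g 0 ∧ (∀ᶠ s in 𝓝 0,
      partialFredholm a {J | J.card = 2} (-1) s = s ^ 2 * g s) ∧
      g 0 = (besselCoeff a 0 0 * besselCoeff a 1 1 - besselCoeff a 0 1 ^ 2)
        / ((a + 1) * (a + 3) * (a + 2) ^ 2) := by
  have e1 : a + 1 ≠ 0 := by exact_mod_cast natCast_add_ne_zero ha (x := 1) le_rfl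
  have e2 : a + 2 ≠ 0 := by exact_mod_cast natCast_add_ne_zero ha (x := 2) (by norm_num)
  have e3 : a + 3 ≠ 0 := by exact_mod_cast natCast_add_ne_zero ha (x := 3) (by norm_num)
  set S : Set (Finset ℕ) := ({J | J.card = 2} \ {{0, 1}}) \ {{0, 2}} with hS
  have hSum : ∀ J ∈ S, 3 ≤ ∑ j ∈ J, j := by
    rintro J ⟨⟨hJ, h0⟩, h1⟩
    by_contra hcon
    have hsub := subset_range_of_sum_lt (not_le.1 hcon)
    simp only [Set.mem_ofPred_eq, Set.mem_singleton_iff] at hJ h0 h1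
    have : ∀ J ∈ (Finset.range 3).powerset, J.card = 2 → J ≠ {0, 1} → J ≠ {0, 2} →
        3 ≤ ∑ j ∈ J, j := by decide
    exact hcon (this J (Finset.mem_powerset.2 hsub) hJ h0 h1)
  have hd := differentiable_partialFredholm ha S (φ := fun _ => -1) (ψ := id)
    (differentiable_const _) differentiable_id
  obtain ⟨g, hg, hfg⟩ := exists_eq_pow_mul_of_isBigO
    (hd.analyticAt 0) (isBigO_partialFredholm ha hSum)
  have ht := fun M j k => (differentiable_kernelTail ha M j k).analyticAt 0
  let x0 := besselCoeff a 0 0 / (a + 1)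
  let x1 := besselCoeff a 0 1 / (a + 2)
  let y1 := besselCoeff a 1 1 / (a + 3)
  let z0 := besselCoeff a 0 0 / (a + 2)
  let z1 := besselCoeff a 0 1 / (a + 3)
  let w0 := besselCoeff a 0 1 / (a + 1)
  let w1 := besselCoeff a 1 1 / (a + 2)
  let p0 := besselCoeff a 0 2 / (a + 3)
  let q0 := besselCoeff a 0 0 / (a + 3)
  let v0 := besselCoeff a 0 2 / (a + 1)
  let h : ℂ → ℂ := fun s => x0 * kernelTail a 2 1 1 s + x1 * y1 + kernelTail a 2 0 0 s * x1
    + s * (x1 * kernelTail a 2 1 1 s + kernelTail a 2 0 0 s * y1)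
    + s ^ 2 * (kernelTail a 2 0 0 s * kernelTail a 2 1 1 s)
    - (z0 * kernelTail a 2 1 0 s + z1 * w1 + kernelTail a 2 0 1 s * w0
    + s * (z1 * kernelTail a 2 1 0 s + kernelTail a 2 0 1 s * w1)
    + s ^ 2 * (kernelTail a 2 0 1 s * kernelTail a 2 1 0 s))
    + (x0 * kernelTail a 1 2 2 s + kernelTail a 1 0 0 s * p0
    + s * (kernelTail a 1 0 0 s * kernelTail a 1 2 2 s))
    - (q0 * kernelTail a 1 2 0 s + kernelTail a 1 0 2 s * v0
    + s * (kernelTail a 1 0 2 s * kernelTail a 1 2 0 s)) + g s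
  have hh : AnalyticAt ℂ h 0 := by
    have t1 := ht 2 1 1
    have t2 := ht 2 0 0
    have t3 := ht 2 1 0
    have t4 := ht 2 0 1
    have t5 := ht 1 2 2
    have t6 := ht 1 0 0
    have t7 := ht 1 2 0
    have t8 := ht 1 0 2
    fun_prop
  refine ⟨fun s => (besselCoeff a 0 0 * besselCoeff a 1 1 - besselCoeff a 0 1 ^ 2)
        / ((a + 1) * (a + 3) * (a + 2) ^ 2) + s * h s, by fun_prop, ?_, by simp⟩
  filter_upwards [hfg] with s hs
  simp only [id] at hs
  rw [partialFredholm_insert ha (J := {0, 1}) (by simp),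
    partialFredholm_insert ha (J := {0, 2}) (by constructor <;> decide), ← hS, hs, minor_pair _ (by norm_num),
    minor_pair _ (by norm_num)]
  have K00 : kernelInf a s 0 0 = x0 + s * (x1 + s * kernelTail a 2 0 0 s) := by
    rw [kernelInf_eq, kernelTail_eq ha 0, kernelTail_eq ha 1]; push_cast; simp only [x0, x1]; ring_nf
  have K00' : kernelInf a s 0 0 = x0 + s * kernelTail a 1 0 0 s := by
    rw [kernelInf_eq, kernelTail_eq ha 0]; push_cast; simp only [x0]; ring_nf
  have K11 : kernelInf a s 1 1 = s * (x1 + s * (y1 + s * kernelTail a 2 1 1 s)) := by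
    rw [kernelInf_eq, kernelTail_eq ha 0, kernelTail_eq ha 1, besselCoeff_symm a 1 0]
    push_cast; simp only [x1, y1]; ring_nf
  have K01 : kernelInf a s 0 1 = s * (z0 + s * (z1 + s * kernelTail a 2 0 1 s)) := by
    rw [kernelInf_eq, kernelTail_eq ha 0, kernelTail_eq ha 1]; push_cast; simp only [z0, z1]; ring_nf
  have K10 : kernelInf a s 1 0 = w0 + s * (w1 + s * kernelTail a 2 1 0 s) := by
    rw [kernelInf_eq, kernelTail_eq ha 0, kernelTail_eq ha 1, besselCoeff_symm a 1 0]
    push_cast; simp only [w0, w1]; ring_nf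
  have K22 : kernelInf a s 2 2 = s ^ 2 * (p0 + s * kernelTail a 1 2 2 s) := by
    rw [kernelInf_eq, kernelTail_eq ha 0, besselCoeff_symm a 2 0]; push_cast; simp only [p0]; ring_nf
  have K02 : kernelInf a s 0 2 = s ^ 2 * (q0 + s * kernelTail a 1 0 2 s) := by
    rw [kernelInf_eq, kernelTail_eq ha 0]; push_cast; simp only [q0]; ring_nf
  have K20 : kernelInf a s 2 0 = v0 + s * kernelTail a 1 2 0 s := by
    rw [kernelInf_eq, kernelTail_eq ha 0, besselCoeff_symm a 2 0]; push_cast; simp only [v0]; ring_nf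
  -- The two rank-one cancellations `c1` and `c2`, then the surviving coefficient.
  have c1 : x0 * x1 = z0 * w0 := by simp only [x0, x1, z0, w0]; field_simp
  have c2 : x0 * p0 = q0 * v0 := by simp only [x0, p0, q0, v0]; field_simp
  have c3 : x0 * y1 + x1 * x1 - z0 * w1 - z1 * w0
      = (besselCoeff a 0 0 * besselCoeff a 1 1 - besselCoeff a 0 1 ^ 2)
        / ((a + 1) * (a + 3) * (a + 2) ^ 2) := by
    simp only [x0, y1, x1, z0, w1, z1, w0]; field_simp; ring
  have hpair : ({0, 1} : Finset ℕ).card = 2 ∧ ({0, 2} : Finset ℕ).card = 2 := by decide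
  rw [hpair.1, hpair.2, ← c3]
  have m1 : kernelInf a s 0 0 * kernelInf a s 2 2 = (x0 + s * kernelTail a 1 0 0 s)
      * (s ^ 2 * (p0 + s * kernelTail a 1 2 2 s)) := by rw [K00', K22]
  rw [m1, K00, K11, K01, K10, K02, K20]
  simp only [h]
  linear_combination s * c1 + s ^ 2 * c2

/-- The columns give s^{0+1+2}, and the remaining 3×3 determinant vanishes at 0, where its matrix
has rank one; this supplies the fourth power. -/
lemma exists_norm_minor_triple_le {a : ℂ} (ha : -1 < a.re) :
    ∃ C : ℝ, 0 ≤ C ∧ ∀ s : ℂ, ‖s‖ ≤ 1 → ‖minor (kernelInf a s) {0, 1, 2}‖ ≤ C * ‖s‖ ^ 4 := by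
  let G : ℂ → ℂ := fun s => (Matrix.of fun j k : Fin 3 => kernelTail a 0 j k s).det
  have hG : Differentiable ℂ G := differentiable_det fun j k => differentiable_kernelTail ha 0 j k
  have hG0 : G 0 = 0 := by
    have h : ∀ j k, kernelTail a 0 j k 0 = besselCoeff a j 0 * (((0 + k : ℕ) : ℂ) + a + 1)⁻¹ :=
      fun j k => by rw [kernelTail_eq ha]; simp [div_eq_mul_inv]
    simp only [G, Matrix.det_fin_three, Matrix.of_apply, h]
    ring
  have hds : ContinuousOn (dslope G 0) (Metric.closedBall 0 1) :=
    (continuousOn_dslope (Metric.closedBall_mem_nhds 0 one_pos)).2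
      ⟨hG.continuous.continuousOn, hG 0⟩
  obtain ⟨C, hC⟩ := (isCompact_closedBall (0 : ℂ) 1).exists_bound_of_continuousOn hds
  have hC0 : 0 ≤ C := (norm_nonneg _).trans (hC 0 (by simp))
  refine ⟨C, hC0, fun s hs => ?_⟩
  have h1 : minor (kernelInf a s) {0, 1, 2} = s ^ 3 * G s := by
    rw [minor_triple]
    have : (Matrix.of fun i j : Fin 3 => kernelInf a s i j)
        = Matrix.of fun i j : Fin 3 => s ^ (j : ℕ) * (Matrix.of fun j k : Fin 3 =>
          kernelTail a 0 j k s) i j := by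
      ext i j; simp [kernelInf_eq]
    rw [this, Matrix.det_mul_row, Fin.prod_univ_three]
    simp only [Fin.val_zero, Fin.val_one, Fin.val_two]
    rw [← pow_add, ← pow_add]
  have h2 : G s = s * dslope G 0 s := by
    have := sub_smul_dslope G 0 s
    rw [hG0, sub_zero, sub_zero, smul_eq_mul] at this
    exact this.symm
  rw [h1, h2, norm_mul, norm_mul, norm_pow]
  have := hC s (by simpa using hs)
  calc ‖s‖ ^ 3 * (‖s‖ * ‖dslope G 0 s‖) = ‖dslope G 0 s‖ * ‖s‖ ^ 4 := by ring
    _ ≤ _ := by gcongr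

/-- The contribution to `detInf` of minors of size at least three, on the universal cover. -/
def tailLog (a w : ℂ) : ℂ :=
  partialFredholm a {J | 3 ≤ J.card} (Complex.exp ((a + 1) * w)) (Complex.exp w)

lemma differentiable_tailLog {a : ℂ} (ha : -1 < a.re) : Differentiable ℂ (tailLog a) :=
  differentiable_partialFredholm ha _ (by fun_prop) (by fun_prop)

/-- The exponent is 3(a+1) + 4: any set of at least three indices other than {0,1,2} has sum at
least 4, and {0,1,2} gains one power by `exists_norm_minor_triple_le`. The strip of half-width 2π
leaves room for unit discs around log s. -/
lemma exists_norm_tailLog_le {a : ℂ} (ha : -1 < a.re) :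
    ∃ C : ℝ, 0 ≤ C ∧ ∀ w : ℂ, w.re ≤ 0 → |w.im| ≤ 2 * Real.pi →
      ‖tailLog a w‖ ≤ C * Real.exp ((3 * a.re + 7) * w.re) := by
  set ρ : ℝ := Real.exp (|a.im| * (2 * Real.pi)) with hρ
  have hρ1 : 1 ≤ ρ := Real.one_le_exp (by positivity)
  set S : Set (Finset ℕ) := {J | 3 ≤ J.card} \ {{0, 1, 2}} with hS
  have hSum : ∀ J ∈ S, 3 ≤ J.card ∧ 4 ≤ ∑ j ∈ J, j := by
    rintro J ⟨hJ, h0⟩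
    refine ⟨hJ, ?_⟩
    by_contra hcon
    have hsub := subset_range_of_sum_lt (not_le.1 hcon)
    simp only [Set.mem_ofPred_eq, Set.mem_singleton_iff] at hJ h0
    have : ∀ J ∈ (Finset.range 4).powerset, 3 ≤ J.card → J ≠ {0, 1, 2} → 4 ≤ ∑ j ∈ J, j := by
      decide
    exact hcon (this J (Finset.mem_powerset.2 hsub) hJ h0)
  obtain ⟨C1, hC10, hC1⟩ := norm_partialFredholm_le ha hρ1 hSum
  obtain ⟨C2, hC20, hC2⟩ := exists_norm_minor_triple_le ha
  refine ⟨(C1 + C2) * ρ ^ 3, by positivity, fun w hw1 hw2 => ?_⟩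
  have hs : ‖Complex.exp w‖ = Real.exp w.re := Complex.norm_exp w
  have hs1 : ‖Complex.exp w‖ ≤ 1 := by rw [hs]; exact Real.exp_le_one_iff.2 hw1
  have hz : ‖Complex.exp ((a + 1) * w)‖ ≤ ρ * Real.exp ((a.re + 1) * w.re) := by
    rw [Complex.norm_exp, hρ, ← Real.exp_add]
    refine Real.exp_le_exp.2 ?_
    simp only [Complex.mul_re, Complex.add_re, Complex.one_re, Complex.add_im, Complex.one_im,
      add_zero]
    have : -(a.im * w.im) ≤ |a.im| * (2 * Real.pi) :=
      (neg_le_abs _).trans (by rw [abs_mul]; gcongr)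
    linarith
  have hz1 : ‖Complex.exp ((a + 1) * w)‖ ≤ ρ := by
    refine hz.trans (mul_le_of_le_one_right (by positivity) (Real.exp_le_one_iff.2 ?_))
    exact mul_nonpos_of_nonneg_of_nonpos (by linarith) hw1
  have hcard : ({0, 1, 2} : Finset ℕ).card = 3 := by decide
  rw [tailLog, partialFredholm_insert ha (J := {0, 1, 2}) (by simp [hcard]), ← hS, hcard]
  have h1 := hC1 _ hs1 _ hz1
  have h2 := hC2 _ hs1
  have h3 : ‖Complex.exp ((a + 1) * w)‖ ^ 3 * ‖Complex.exp w‖ ^ 4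
      ≤ ρ ^ 3 * Real.exp ((3 * a.re + 7) * w.re) := by
    calc ‖Complex.exp ((a + 1) * w)‖ ^ 3 * ‖Complex.exp w‖ ^ 4
        ≤ (ρ * Real.exp ((a.re + 1) * w.re)) ^ 3 * Real.exp w.re ^ 4 := by rw [hs]; gcongr
      _ = ρ ^ 3 * Real.exp ((3 * a.re + 7) * w.re) := by
        rw [mul_pow, mul_assoc, ← Real.exp_nat_mul ((a.re + 1) * w.re), ← Real.exp_nat_mul w.re,
          ← Real.exp_add]
        congr 2; push_cast; ring
  calc _ ≤ ‖Complex.exp ((a + 1) * w)‖ ^ 3 * (C2 * ‖Complex.exp w‖ ^ 4)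
        + C1 * ‖Complex.exp ((a + 1) * w)‖ ^ 3 * ‖Complex.exp w‖ ^ 4 := by
        refine (norm_add_le _ _).trans (add_le_add ?_ h1)
        rw [norm_mul, norm_pow, norm_neg]
        gcongr
    _ = (C1 + C2) * (‖Complex.exp ((a + 1) * w)‖ ^ 3 * ‖Complex.exp w‖ ^ 4) := by ring
    _ ≤ (C1 + C2) * (ρ ^ 3 * Real.exp ((3 * a.re + 7) * w.re)) := by gcongr
    _ = _ := by ring

/-- In the coordinate log s the function is entire, so Cauchy's estimate on a unit disc costs only a
constant, uniformly up to the cut; discs in the s-plane would cross it. -/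
lemma exists_norm_iteratedDeriv_tailLog_le {a : ℂ} (ha : -1 < a.re) (n : ℕ) :
    ∃ C : ℝ, 0 ≤ C ∧ ∀ s : ℂ, s ≠ 0 → ‖s‖ ≤ Real.exp (-1) →
      ‖iteratedDeriv n (tailLog a) (Complex.log s)‖ ≤ C * ‖s‖ ^ (3 * a.re + 7) := by
  obtain ⟨C, hC0, hC⟩ := exists_norm_tailLog_le ha
  refine ⟨n.factorial * (C * Real.exp (3 * a.re + 7)) / 1 ^ n, by positivity, fun s hs0 hs => ?_⟩
  have hpos : 0 < ‖s‖ := norm_pos_iff.2 hs0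
  have hre : (Complex.log s).re ≤ -1 := by
    rw [Complex.log_re, ← Real.log_exp (-1)]
    exact Real.log_le_log hpos hs
  have him : |(Complex.log s).im| ≤ Real.pi := by
    rw [Complex.log_im]; exact Complex.abs_arg_le_pi s
  have hb : ∀ z ∈ Metric.sphere (Complex.log s) 1, ‖tailLog a z‖
      ≤ C * Real.exp (3 * a.re + 7) * ‖s‖ ^ (3 * a.re + 7) := by
    intro z hz
    rw [mem_sphere_iff_norm] at hz
    have e1 : |z.re - (Complex.log s).re| ≤ 1 := by
      rw [← Complex.sub_re, ← hz]; exact Complex.abs_re_le_norm _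
    have e2 : |z.im - (Complex.log s).im| ≤ 1 := by
      rw [← Complex.sub_im, ← hz]; exact Complex.abs_im_le_norm _
    have e3 := abs_le.1 e1
    have e4 : |z.im| ≤ 2 * Real.pi := by
      have h5 : |z.im| ≤ |z.im - (Complex.log s).im| + |(Complex.log s).im| := by
        have := abs_add_le (z.im - (Complex.log s).im) (Complex.log s).im
        simpa using this
      have := Real.pi_gt_three
      linarith
    refine (hC z (by linarith) e4).trans ?_
    rw [Real.rpow_def_of_pos hpos, mul_assoc, ← Real.exp_add]
    refine mul_le_mul_of_nonneg_left (Real.exp_le_exp.2 ?_) hC0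
    have h6 : z.re ≤ (Complex.log s).re + 1 := by linarith
    rw [Complex.log_re] at h6
    have h7 : 0 ≤ 3 * a.re + 7 := by linarith
    nlinarith [mul_le_mul_of_nonneg_left h6 h7]
  refine (Complex.norm_iteratedDeriv_le_of_forall_mem_sphere_norm_le n one_pos
    (differentiable_tailLog ha).diffContOnCl hb).trans (le_of_eq ?_)
  ring

lemma detInf_decomposition {a : ℂ} (ha : -1 < a.re) {s : ℂ} (hs : s ≠ 0) :
    detInf a s = 1 - s ^ (a + 1) * partialFredholm a {J | J.card = 1} (-1) s
      + s ^ (2 * a + 2) * partialFredholm a {J | J.card = 2} (-1) s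
      + tailLog a (Complex.log s) := by
  have hu : (Set.univ : Set (Finset ℕ)) = (({∅} ∪ {J | J.card = 1}) ∪ {J | J.card = 2})
      ∪ {J | 3 ≤ J.card} := by
    ext J
    simp only [Set.mem_univ, Set.mem_union, Set.mem_singleton_iff, Set.mem_ofPred_eq, true_iff,
      ← Finset.card_eq_zero]
    omega
  have hz : Complex.exp ((a + 1) * Complex.log s) = s ^ (a + 1) := by
    rw [Complex.cpow_def_of_ne_zero hs, mul_comm]
  rw [detInf_eq_partialFredholm, hu, partialFredholm_union ha, partialFredholm_union ha,
    partialFredholm_union ha, partialFredholm_singleton, partialFredholm_card 1,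
    partialFredholm_card 2, tailLog, hz, Complex.exp_log hs,
    show s ^ (2 * a + 2) = (s ^ (a + 1)) ^ 2 by
      rw [← Complex.cpow_nat_mul]; congr 1; push_cast; ring]
  · simp [minor]
    ring
  all_goals
    rw [Set.disjoint_left]
    intro J hJ hJ2
    simp only [Set.mem_union, Set.mem_singleton_iff, Set.mem_ofPred_eq,
      ← Finset.card_eq_zero] at hJ hJ2
    omega

lemma hasDerivAt_cpow_mul {c s f' : ℂ} {f : ℂ → ℂ} (hs : s ∈ Complex.slitPlane)
    (hf : HasDerivAt f f' s) :
    HasDerivAt (fun s => s ^ c * f s) (s ^ (c - 1) * (c * f s + s * f')) s := by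
  refine (((hasDerivAt_id s).cpow_const (c := c) hs).mul hf).congr_deriv ?_
  have h0 := Complex.slitPlane_ne_zero hs
  simp only [id]
  rw [Complex.cpow_sub _ _ h0, Complex.cpow_one]
  field_simp

lemma hasDerivAt_comp_log {f : ℂ → ℂ} (hf : Differentiable ℂ f) {s : ℂ} (hs : s ∈ Complex.slitPlane) :
    HasDerivAt (fun s => f (Complex.log s)) (deriv f (Complex.log s) / s) s := by
  have := (hf (Complex.log s)).hasDerivAt.comp s (Complex.hasDerivAt_log hs)
  rwa [← div_eq_mul_inv] at this

/-- `(c + s d/ds) f`. -/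
def eulerOp (c : ℂ) (f : ℂ → ℂ) (s : ℂ) : ℂ := c * f s + s * deriv f s

lemma differentiable_eulerOp (c : ℂ) {f : ℂ → ℂ} (hf : Differentiable ℂ f) :
    Differentiable ℂ (eulerOp c f) := by
  have h : Differentiable ℂ (deriv f) := fun s =>
    (hf.analyticAt s).deriv.differentiableAt
  exact (hf.const_mul c).add (differentiable_id.mul h)

lemma analyticAt_eulerOp (c : ℂ) {f : ℂ → ℂ} {s : ℂ} (hf : AnalyticAt ℂ f s) :
    AnalyticAt ℂ (eulerOp c f) s := by
  have h := hf.deriv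
  unfold eulerOp
  fun_prop

lemma hasDerivAt_cpow_mul_eulerOp {c s : ℂ} {f : ℂ → ℂ} (hs : s ∈ Complex.slitPlane)
    (hf : DifferentiableAt ℂ f s) :
    HasDerivAt (fun s => s ^ c * f s) (s ^ (c - 1) * eulerOp c f s) s :=
  hasDerivAt_cpow_mul hs hf.hasDerivAt

/-- The sum of the minors of size one. -/
def levelOne (a s : ℂ) : ℂ := partialFredholm a {J | J.card = 1} (-1) s
/-- The sum of the minors of size two. -/
def levelTwo (a s : ℂ) : ℂ := partialFredholm a {J | J.card = 2} (-1) s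

lemma differentiable_levelOne {a : ℂ} (ha : -1 < a.re) : Differentiable ℂ (levelOne a) :=
  differentiable_partialFredholm ha _ (φ := fun _ => -1) (differentiable_const _) differentiable_id

lemma differentiable_levelTwo {a : ℂ} (ha : -1 < a.re) : Differentiable ℂ (levelTwo a) :=
  differentiable_partialFredholm ha _ (φ := fun _ => -1) (differentiable_const _) differentiable_id

lemma hasDerivAt_detInf {a : ℂ} (ha : -1 < a.re) {s : ℂ} (hs : s ∈ Complex.slitPlane) :
    HasDerivAt (detInf a) (-(s ^ a * eulerOp (a + 1) (levelOne a) s)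
      + s ^ (2 * a + 1) * eulerOp (2 * a + 2) (levelTwo a) s
      + deriv (tailLog a) (Complex.log s) / s) s := by
  have h := (((hasDerivAt_const s (1 : ℂ)).sub (hasDerivAt_cpow_mul_eulerOp (c := a + 1) hs
    (differentiable_levelOne ha s))).add (hasDerivAt_cpow_mul_eulerOp (c := 2 * a + 2) hs
    (differentiable_levelTwo ha s))).add (hasDerivAt_comp_log (differentiable_tailLog ha) hs)
  rw [zero_sub, add_sub_cancel_right, show 2 * a + 2 - 1 = 2 * a + 1 by ring] at h
  refine h.congr_of_eventuallyEq ?_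
  filter_upwards [Complex.isOpen_slitPlane.mem_nhds hs] with z hz
  exact detInf_decomposition ha (Complex.slitPlane_ne_zero hz)

lemma hasDerivAt_deriv_detInf {a : ℂ} (ha : -1 < a.re) {s : ℂ} (hs : s ∈ Complex.slitPlane) :
    HasDerivAt (deriv (detInf a)) (-(s ^ (a - 1) * eulerOp a (eulerOp (a + 1) (levelOne a)) s)
      + s ^ (2 * a) * eulerOp (2 * a + 1) (eulerOp (2 * a + 2) (levelTwo a)) s
      + (deriv (deriv (tailLog a)) (Complex.log s) - deriv (tailLog a) (Complex.log s)) / s ^ 2)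
      s := by
  have hs0 := Complex.slitPlane_ne_zero hs
  have hT : Differentiable ℂ (deriv (tailLog a)) := fun s =>
    ((differentiable_tailLog ha).analyticAt s).deriv.differentiableAt
  have h := ((hasDerivAt_cpow_mul_eulerOp (c := a) hs
    (differentiable_eulerOp (a + 1) (differentiable_levelOne ha) s)).neg.add
    (hasDerivAt_cpow_mul_eulerOp (c := 2 * a + 1) hs
    (differentiable_eulerOp (2 * a + 2) (differentiable_levelTwo ha) s))).add
    ((hasDerivAt_comp_log hT hs).div (hasDerivAt_id s) hs0)
  rw [add_sub_cancel_right] at h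
  refine (h.congr_of_eventuallyEq ?_).congr_deriv ?_
  · filter_upwards [Complex.isOpen_slitPlane.mem_nhds hs] with z hz
    exact (hasDerivAt_detInf ha hz).deriv
  · simp only [id]; field_simp

lemma besselCoeff_values {a : ℂ} (ha : -1 < a.re) :
    besselCoeff a 0 0 ≠ 0 ∧ besselCoeff a 0 1 = -besselCoeff a 0 0 / (4 * (a + 2)) ∧
    besselCoeff a 0 2 = besselCoeff a 0 0 / (32 * (a + 2) * (a + 3)) ∧
    besselCoeff a 1 1 = besselCoeff a 0 0 / (16 * (a + 1) * (a + 3)) := by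
  have e1 : a + 1 ≠ 0 := by exact_mod_cast natCast_add_ne_zero ha (x := 1) le_rfl
  have e2 : a + 2 ≠ 0 := by exact_mod_cast natCast_add_ne_zero ha (x := 2) (by norm_num)
  have e3 : a + 3 ≠ 0 := by exact_mod_cast natCast_add_ne_zero ha (x := 3) (by norm_num)
  have hG0 := gamma_ne_zero ha 0
  have hG1 := gamma_succ ha 0
  have hG2 := gamma_succ ha 1
  have h4 : (4 : ℂ) ≠ 0 := by norm_num
  have hf : (4 : ℂ) ^ (a + 1) ≠ 0 := by rw [Ne, Complex.cpow_eq_zero_iff]; tauto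
  have hf1 : (4 : ℂ) ^ (((1 : ℕ) : ℂ) + a + 1) = 4 * 4 ^ (a + 1) := by
    rw [add_assoc, Complex.cpow_add _ _ h4, Complex.cpow_natCast]; ring
  have hf2 : (4 : ℂ) ^ (((2 : ℕ) : ℂ) + a + 1) = 16 * 4 ^ (a + 1) := by
    rw [add_assoc, Complex.cpow_add _ _ h4, Complex.cpow_natCast]; ring
  have c0 : ((0 : ℕ) : ℂ) + a + 1 = a + 1 := by push_cast; ring
  have c1 : ((1 : ℕ) : ℂ) + a + 1 = a + 2 := by push_cast; ring
  have c2 : ((2 : ℕ) : ℂ) + a + 1 = a + 3 := by push_cast; ring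
  simp only [besselCoeff, zero_add, add_zero, Nat.factorial, hf1, hf2, hG2, hG1,
    Nat.reduceAdd] at *
  simp only [c0, c1, c2] at *
  set G := Complex.Gamma (a + 1)
  push_cast
  refine ⟨?_, ?_, ?_, ?_⟩
  · simp only [pow_zero, mul_one, one_div]
    exact inv_ne_zero (by positivity)
  all_goals
    field_simp
    try norm_num

/-- For complex c the modulus of s^c differs from |s|^{Re c} by a factor bounded in both directions,
as the argument is bounded. -/
lemma isBigO_cpow_of_norm_le {f : ℂ → ℂ} {c : ℂ} {C : ℝ} (hC : 0 ≤ C)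
    (h : ∀ᶠ s in 𝓝[Complex.slitPlane] 0, ‖f s‖ ≤ C * ‖s‖ ^ c.re) :
    f =O[𝓝[Complex.slitPlane] 0] fun s => s ^ c := by
  refine IsBigO.of_bound (C * Real.exp (Real.pi * |c.im|)) ?_
  filter_upwards [h, self_mem_nhdsWithin] with s hs hss
  refine hs.trans ?_
  rw [Complex.norm_cpow_of_ne_zero (Complex.slitPlane_ne_zero hss), mul_assoc]
  refine mul_le_mul_of_nonneg_left ?_ hC
  rw [mul_div_assoc', le_div_iff₀ (Real.exp_pos _), mul_comm]
  refine mul_le_mul_of_nonneg_right (Real.exp_le_exp.2 ?_) (by positivity)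
  refine (le_abs_self _).trans ?_
  rw [abs_mul]
  exact mul_le_mul_of_nonneg_right (Complex.abs_arg_le_pi s) (abs_nonneg _)

lemma eulerOp_pow_mul {f g : ℂ → ℂ} (c : ℂ) (k : ℕ) (hg : AnalyticAt ℂ g 0)
    (h : ∀ᶠ s in 𝓝 0, f s = s ^ k * g s) :
    ∀ᶠ s in 𝓝 0, eulerOp c f s = s ^ k * eulerOp (c + k) g s := by
  filter_upwards [h.eventually_nhds, hg.eventually_analyticAt] with s hs hgs
  have h1 : HasDerivAt f (k * s ^ (k - 1) * g s + s ^ k * deriv g s) s :=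
    (((hasDerivAt_pow k s).mul hgs.differentiableAt.hasDerivAt)).congr_of_eventuallyEq hs
  rw [eulerOp, eulerOp, h1.deriv, hs.self_of_nhds]
  rcases k with _ | k
  · simp
  · simp only [Nat.add_sub_cancel]; push_cast; ring

lemma eulerOp_const_mul (c k : ℂ) (f : ℂ → ℂ) (s : ℂ) :
    eulerOp c (fun s => k * f s) s = k * eulerOp c f s := by
  rw [eulerOp, eulerOp, deriv_const_mul_field']; ring

/-- The coefficient of `-s^{a+3}` in the small-`s` expansion. -/
def nonanalyticCoeff (a : ℂ) : ℂ :=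
  2 / ((4 : ℂ) ^ (a + 3) * (a + 2) * (a + 1) * Complex.Gamma (a + 3) * Complex.Gamma (a + 4))

/-- Identifies the constant of (**) with the one produced by the minors of size two: differentiating
s^{2a+4} gives 2(a+2), and the factor a+3 comes from taking a logarithmic derivative of s^{a+3}. -/
lemma nonanalyticCoeff_eq {a : ℂ} (ha : -1 < a.re) :
    nonanalyticCoeff a = 2 * (a + 3) * (a + 2)
      * ((besselCoeff a 0 0 * besselCoeff a 1 1 - besselCoeff a 0 1 ^ 2)
        / ((a + 1) * (a + 3) * (a + 2) ^ 2)) / besselCoeff a 0 0 ∧ nonanalyticCoeff a ≠ 0 := by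
  have e1 : a + 1 ≠ 0 := by exact_mod_cast natCast_add_ne_zero ha (x := 1) le_rfl
  have e2 : a + 2 ≠ 0 := by exact_mod_cast natCast_add_ne_zero ha (x := 2) (by norm_num)
  have e3 : a + 3 ≠ 0 := by exact_mod_cast natCast_add_ne_zero ha (x := 3) (by norm_num)
  have hG0 : Complex.Gamma (a + 1) ≠ 0 := by simpa using gamma_ne_zero ha 0
  have g1 : Complex.Gamma (a + 2) = (a + 1) * Complex.Gamma (a + 1) := by
    rw [← Complex.Gamma_add_one _ e1]; congr 1; ring
  have g2 : Complex.Gamma (a + 3) = (a + 2) * Complex.Gamma (a + 2) := by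
    rw [← Complex.Gamma_add_one _ e2]; congr 1; ring
  have g3 : Complex.Gamma (a + 4) = (a + 3) * Complex.Gamma (a + 3) := by
    rw [← Complex.Gamma_add_one _ e3]; congr 1; ring
  have h4 : (4 : ℂ) ≠ 0 := by norm_num
  have hf : (4 : ℂ) ^ (a + 1) ≠ 0 := by rw [Ne, Complex.cpow_eq_zero_iff]; tauto
  have hf3 : (4 : ℂ) ^ (a + 3) = 16 * 4 ^ (a + 1) := by
    rw [show a + 3 = (a + 1) + (2 : ℕ) by push_cast; ring, Complex.cpow_add _ _ h4,
      Complex.cpow_natCast]; ring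
  obtain ⟨b0, b01, -, b11⟩ := besselCoeff_values ha
  have b00 : besselCoeff a 0 0
      = 1 / (Complex.Gamma (a + 1) * Complex.Gamma (a + 1) * (a + 1) * 4 ^ (a + 1)) := by
    simp [besselCoeff]
  rw [b01, b11]
  refine ⟨?_, ?_⟩
  · have : 2 * (a + 3) * (a + 2) * ((besselCoeff a 0 0 * (besselCoeff a 0 0
        / (16 * (a + 1) * (a + 3))) - (-besselCoeff a 0 0 / (4 * (a + 2))) ^ 2)
        / ((a + 1) * (a + 3) * (a + 2) ^ 2)) / besselCoeff a 0 0
        = besselCoeff a 0 0 / (8 * (a + 1) ^ 2 * (a + 2) ^ 3 * (a + 3)) := by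
      field_simp; ring
    rw [this, b00, nonanalyticCoeff, g3, g2, g1, hf3]
    field_simp
    norm_num
  · rw [nonanalyticCoeff, g3, g2, g1, hf3]
    have hG2 := mul_ne_zero e2 (mul_ne_zero e1 hG0)
    exact div_ne_zero two_ne_zero (mul_ne_zero (mul_ne_zero (mul_ne_zero (mul_ne_zero
      (mul_ne_zero (by norm_num) hf) e2) e1) hG2) (mul_ne_zero e3 hG2))

lemma exists_levelOne_expansion {a : ℂ} (ha : -1 < a.re) :
    ∃ g : ℂ → ℂ, AnalyticAt ℂ g 0 ∧ ∀ᶠ s in 𝓝 0,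
      (besselCoeff a 0 0)⁻¹ * eulerOp (a + 1) (levelOne a) s = 1 - 1 / (2 * (a + 2)) * s
        + (2 * a + 3) / (16 * (a + 1) * (a + 2) * (a + 3)) * s ^ 2 + s ^ 3 * g s := by
  have e1 : a + 1 ≠ 0 := by exact_mod_cast natCast_add_ne_zero ha (x := 1) le_rfl
  have e2 : a + 2 ≠ 0 := by exact_mod_cast natCast_add_ne_zero ha (x := 2) (by norm_num)
  have e3 : a + 3 ≠ 0 := by exact_mod_cast natCast_add_ne_zero ha (x := 3) (by norm_num)
  obtain ⟨b0, b01, b02, b11⟩ := besselCoeff_values ha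
  obtain ⟨g, hg, h⟩ := exists_partialFredholm_one ha
  have hg' := analyticAt_eulerOp (a + 1 + (3 : ℕ)) hg
  refine ⟨fun s => (besselCoeff a 0 0)⁻¹ * eulerOp (a + 1 + (3 : ℕ)) g s, by fun_prop, ?_⟩
  filter_upwards [h.eventually_nhds, eulerOp_pow_mul (f := fun s => s ^ 3 * g s) (a + 1) 3 hg
    (Eventually.of_forall fun s => rfl), hg.eventually_analyticAt] with s hs hs3 hgs
  set c0 := besselCoeff a 0 0 / (a + 1) with hc0
  set c1 := 2 * besselCoeff a 0 1 / (a + 2) with hc1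
  set c2 := (2 * besselCoeff a 0 2 + besselCoeff a 1 1) / (a + 3) with hc2
  have hd3 : HasDerivAt (fun s => s ^ 3 * g s) (deriv (fun s => s ^ 3 * g s) s) s :=
    ((differentiableAt_pow 3).mul hgs.differentiableAt).hasDerivAt
  have h1 : HasDerivAt (levelOne a)
      (c1 + c2 * (2 * s) + deriv (fun s => s ^ 3 * g s) s) s := by
    have := ((((hasDerivAt_id s).const_mul c1).const_add c0).add
      ((hasDerivAt_pow 2 s).const_mul c2)).add hd3
    refine (this.congr_of_eventuallyEq hs).congr_deriv ?_
    simp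
  have h2 : levelOne a s = c0 + c1 * s + c2 * s ^ 2 + s ^ 3 * g s := hs.self_of_nhds
  have h3 : eulerOp (a + 1) (levelOne a) s = (a + 1) * c0 + (a + 2) * c1 * s
      + (a + 3) * c2 * s ^ 2 + eulerOp (a + 1) (fun s => s ^ 3 * g s) s := by
    rw [eulerOp, eulerOp, h1.deriv, h2]; ring
  rw [h3, hs3, hc0, hc1, hc2, b01, b02, b11]
  field_simp
  ring

/-- After division by the leading behaviour s^a, sizes one, two and at least three give P, s^{a+3}Q
and the remainder, of order s^{3a+7}/s^{a+1}. Both derivatives are expanded separately, each with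
its own remainder, since an O-term cannot be differentiated as such. -/
lemma exists_deriv_detInf_expansion {a : ℂ} (ha : -1 < a.re) :
    ∃ P Q τ₁ τ₂ : ℂ → ℂ, AnalyticAt ℂ P 0 ∧ AnalyticAt ℂ Q 0 ∧
      (∃ g : ℂ → ℂ, AnalyticAt ℂ g 0 ∧ ∀ᶠ s in 𝓝 0, P s = 1 - 1 / (2 * (a + 2)) * s
        + (2 * a + 3) / (16 * (a + 1) * (a + 2) * (a + 3)) * s ^ 2 + s ^ 3 * g s) ∧
      (a + 3) * Q 0 = -nonanalyticCoeff a ∧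
      τ₁ =O[𝓝[Complex.slitPlane] 0] (fun s => s ^ (2 * a + 6)) ∧
      τ₂ =O[𝓝[Complex.slitPlane] 0] (fun s => s ^ (2 * a + 6)) ∧
      ∀ᶠ s in 𝓝[Complex.slitPlane] 0,
        deriv (detInf a) s = -(besselCoeff a 0 0 * s ^ a) * (P s + s ^ (a + 3) * Q s + τ₁ s) ∧
        s * deriv (deriv (detInf a)) s = -(besselCoeff a 0 0 * s ^ a)
          * (eulerOp a P s + s ^ (a + 3) * eulerOp (2 * a + 3) Q s + τ₂ s) := by
  have e1 : a + 1 ≠ 0 := by exact_mod_cast natCast_add_ne_zero ha (x := 1) le_rfl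
  have e2 : a + 2 ≠ 0 := by exact_mod_cast natCast_add_ne_zero ha (x := 2) (by norm_num)
  have e3 : a + 3 ≠ 0 := by exact_mod_cast natCast_add_ne_zero ha (x := 3) (by norm_num)
  have b0 := (besselCoeff_values ha).1
  obtain ⟨Ψ, hΨ, h2, hΨ0⟩ := exists_partialFredholm_two ha
  set ω := besselCoeff a 0 0
  have hP : AnalyticAt ℂ (eulerOp (a + 1) (levelOne a)) 0 :=
    (differentiable_eulerOp _ (differentiable_levelOne ha)).analyticAt 0
  have hQ : AnalyticAt ℂ (eulerOp (2 * a + 4) Ψ) 0 := analyticAt_eulerOp _ hΨ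
  set P : ℂ → ℂ := fun s => ω⁻¹ * eulerOp (a + 1) (levelOne a) s with hPdef
  set Q : ℂ → ℂ := fun s => -ω⁻¹ * eulerOp (2 * a + 4) Ψ s with hQdef
  have hQan : AnalyticAt ℂ Q 0 := by fun_prop
  let T1 : ℂ → ℂ := fun s => deriv (tailLog a) (Complex.log s)
  let T2 : ℂ → ℂ := fun s => deriv (deriv (tailLog a)) (Complex.log s)
  have hsmall : ∀ᶠ s : ℂ in 𝓝[Complex.slitPlane] 0, ‖s‖ ≤ Real.exp (-1) := by
    refine nhdsWithin_le_nhds ?_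
    have : ∀ᶠ s : ℂ in 𝓝 0, ‖s‖ < Real.exp (-1) := by
      have := (continuous_norm (E := ℂ)).tendsto 0
      rw [norm_zero] at this
      exact this.eventually (gt_mem_nhds (Real.exp_pos _))
    exact this.mono fun s hs => hs.le
  have hre : (3 * a + 7).re = 3 * a.re + 7 := by simp
  have hT1 : T1 =O[𝓝[Complex.slitPlane] 0] fun s => s ^ (3 * a + 7) := by
    obtain ⟨C, hC0, hC⟩ := exists_norm_iteratedDeriv_tailLog_le ha 1
    refine isBigO_cpow_of_norm_le hC0 ?_
    filter_upwards [hsmall, self_mem_nhdsWithin] with s hs hss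
    rw [hre]
    simpa [iteratedDeriv_one, T1] using hC s (Complex.slitPlane_ne_zero hss) hs
  have hT2 : T2 =O[𝓝[Complex.slitPlane] 0] fun s => s ^ (3 * a + 7) := by
    obtain ⟨C, hC0, hC⟩ := exists_norm_iteratedDeriv_tailLog_le ha 2
    refine isBigO_cpow_of_norm_le hC0 ?_
    filter_upwards [hsmall, self_mem_nhdsWithin] with s hs hss
    rw [hre]
    simpa [iteratedDeriv_succ, iteratedDeriv_one, T2] using hC s (Complex.slitPlane_ne_zero hss) hs
  have hdiv : ∀ T : ℂ → ℂ, (T =O[𝓝[Complex.slitPlane] 0] fun s => s ^ (3 * a + 7)) →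
      (fun s => T s / s / (-(ω * s ^ a))) =O[𝓝[Complex.slitPlane] 0] fun s => s ^ (2 * a + 6) := by
    intro T hT
    have h := (hT.mul (isBigO_refl (fun s : ℂ => (s * s ^ a)⁻¹) _)).const_mul_left (-ω⁻¹)
    refine h.congr' ?_ ?_
    · filter_upwards [self_mem_nhdsWithin] with s hss
      have hs0 := Complex.slitPlane_ne_zero hss
      have hsa : s ^ a ≠ 0 := by rw [Ne, Complex.cpow_eq_zero_iff]; tauto
      field_simp
    · filter_upwards [self_mem_nhdsWithin] with s hss
      have hs0 := Complex.slitPlane_ne_zero hss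
      have hsa : s ^ a ≠ 0 := by rw [Ne, Complex.cpow_eq_zero_iff]; tauto
      rw [show 3 * a + 7 = (2 * a + 6) + a + 1 by ring, Complex.cpow_add _ _ hs0,
        Complex.cpow_add _ _ hs0, Complex.cpow_one]
      field_simp
  refine ⟨P, Q, fun s => T1 s / s / (-(ω * s ^ a)), fun s => (T2 s - T1 s) / s / (-(ω * s ^ a)),
    by fun_prop, hQan, exists_levelOne_expansion ha, ?_, hdiv _ hT1,
    hdiv _ (hT2.sub hT1), ?_⟩
  · rw [(nonanalyticCoeff_eq ha).1, ← hΨ0]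
    simp only [hQdef, eulerOp, zero_mul, add_zero]
    ring
  have hE2 := eulerOp_pow_mul (2 * a + 2) 2 hΨ h2
  have hE3 : ∀ᶠ s in 𝓝 0, eulerOp (2 * a + 2) (levelTwo a) s = s ^ 2 * (-ω * Q s) := by
    filter_upwards [hE2] with s hs
    rw [show eulerOp (2 * a + 2) (levelTwo a) s = _ from hs, hQdef,
      show 2 * a + 2 + ((2 : ℕ) : ℂ) = 2 * a + 4 by push_cast; ring]
    field_simp
  have hQ' : AnalyticAt ℂ (fun s => -ω * Q s) 0 := by fun_prop
  have hE4 := eulerOp_pow_mul (2 * a + 1) 2 hQ' hE3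
  filter_upwards [self_mem_nhdsWithin, nhdsWithin_le_nhds hE3, nhdsWithin_le_nhds hE4]
    with s hss h3 h4
  have hs0 := Complex.slitPlane_ne_zero hss
  have hsa : s ^ a ≠ 0 := by rw [Ne, Complex.cpow_eq_zero_iff]; tauto
  have ca3 : s ^ (a + 3) = s ^ a * s ^ 3 := by
    rw [Complex.cpow_add _ _ hs0, show (3 : ℂ) = ((3 : ℕ) : ℂ) by norm_num, Complex.cpow_natCast]
  have c2a : s ^ (2 * a) = s ^ a * s ^ a := by
    rw [two_mul, Complex.cpow_add _ _ hs0]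
  have ca1 : s ^ (a - 1) = s ^ a / s := by rw [Complex.cpow_sub _ _ hs0, Complex.cpow_one]
  constructor
  · rw [(hasDerivAt_detInf ha hss).deriv, h3, Complex.cpow_add _ _ hs0, Complex.cpow_one, c2a, ca3]
    simp only [hPdef, T1]
    field_simp
    ring
  · have hEP : eulerOp a P s = ω⁻¹ * eulerOp a (eulerOp (a + 1) (levelOne a)) s :=
      eulerOp_const_mul _ _ _ _
    have hEQ : eulerOp (2 * a + 3) (fun s => -ω * Q s) s = -ω * eulerOp (2 * a + 3) Q s :=
      eulerOp_const_mul _ _ _ _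
    rw [show 2 * a + 1 + ((2 : ℕ) : ℂ) = 2 * a + 3 by push_cast; ring, hEQ] at h4
    rw [(hasDerivAt_deriv_detInf ha hss).deriv, h4, c2a, ca3, ca1, hEP]
    simp only [T1, T2]
    field_simp
    ring

/-- `((s/4 - a) 𝓔' + s 𝓔'') / 𝓔'`, where `𝓔` is the hard-edge determinant. -/
def nuFun (a s : ℂ) : ℂ :=
  ((s / 4 - a) * deriv (detInf a) s + s * deriv (deriv (detInf a)) s) / deriv (detInf a) s

lemma isBigO_cpow_norm_rpow (c : ℂ) :
    (fun s : ℂ => s ^ c) =O[𝓝[Complex.slitPlane] 0] fun s => ‖s‖ ^ c.re := by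
  refine IsBigO.of_bound (Real.exp (Real.pi * |c.im|)) ?_
  filter_upwards [self_mem_nhdsWithin] with s hss
  rw [Complex.norm_cpow_of_ne_zero (Complex.slitPlane_ne_zero hss),
    Real.norm_of_nonneg (by positivity), div_eq_mul_inv, mul_comm, ← Real.exp_neg]
  refine mul_le_mul_of_nonneg_right (Real.exp_le_exp.2 ?_) (by positivity)
  refine (neg_le_abs _).trans ?_
  rw [abs_mul]
  exact mul_le_mul_of_nonneg_right (Complex.abs_arg_le_pi s) (abs_nonneg _)

lemma tendsto_cpow_zero {c : ℂ} (hc : 0 < c.re) :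
    Tendsto (fun s : ℂ => s ^ c) (𝓝[Complex.slitPlane] 0) (𝓝 0) := by
  refine (isBigO_cpow_norm_rpow c).trans_tendsto ?_
  have := (continuous_norm (E := ℂ)).tendsto 0
  rw [norm_zero] at this
  have := (this.rpow_const (p := c.re) (Or.inr hc.le)).mono_left
    (nhdsWithin_le_nhds (s := Complex.slitPlane))
  rwa [Real.zero_rpow hc.ne'] at this

/-- Up to remainders, ν - s/4 is s times the logarithmic derivative of P + XQ with X = s^{a+3}.
Expanding in X, order 0 gives A, order 1 gives B, and X² is already O(s^{2a+6}). -/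
lemma hasSmallExpansion_of_nuFun {a : ℂ} (ha : -1 < a.re) {ν : ℂ → ℂ}
    (hν : ∀ s ∈ Complex.slitPlane, ν s = nuFun a s) : HasSmallExpansion a ν := by
  have e1 : a + 1 ≠ 0 := by exact_mod_cast natCast_add_ne_zero ha (x := 1) le_rfl
  have e2 : a + 2 ≠ 0 := by exact_mod_cast natCast_add_ne_zero ha (x := 2) (by norm_num)
  have e3 : a + 3 ≠ 0 := by exact_mod_cast natCast_add_ne_zero ha (x := 3) (by norm_num)
  have b0 := (besselCoeff_values ha).1
  obtain ⟨P, Q, τ₁, τ₂, hP, hQ, ⟨g, hg, hPg⟩, hQ0, hτ₁, hτ₂, hF⟩ := exists_deriv_detInf_expansion ha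
  have hc := (nonanalyticCoeff_eq ha).2
  set c := nonanalyticCoeff a with hcdef
  set p₁ : ℂ := -(1 / (2 * (a + 2))) with hp₁
  set p₂ : ℂ := (2 * a + 3) / (16 * (a + 1) * (a + 2) * (a + 3)) with hp₂
  have hP0 : P 0 = 1 := by simpa using hPg.self_of_nhds
  have hPne : ∀ᶠ s in 𝓝 0, P s ≠ 0 := hP.continuousAt.eventually_ne (by simp [hP0])
  -- The coefficient of X; equivalently X·E is s times the derivative of XQ/P.
  let E : ℂ → ℂ := fun s => eulerOp (a + 3) Q s / P s - s * deriv P s * Q s / P s ^ 2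
  have hP' := hP.deriv
  have hE : AnalyticAt ℂ E 0 := by
    have h := analyticAt_eulerOp (a + 3) hQ
    exact (h.div hP (by simp [hP0])).sub (((analyticAt_id.mul hP').mul hQ).div (hP.pow 2)
      (by simp [hP0]))
  have hE0 : E 0 = -c := by simp [E, eulerOp, hP0, hQ0]
  let A : ℂ → ℂ := fun s => s / 4 + s * deriv P s / P s
  have hA : AnalyticAt ℂ A 0 := by
    have h1 : AnalyticAt ℂ (fun s : ℂ => s / 4) 0 := by fun_prop
    exact h1.add ((analyticAt_id.mul hP').div hP (by simp [hP0]))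
  let B : ℂ → ℂ := fun s => -c⁻¹ * E s
  have hB : AnalyticAt ℂ B 0 := by fun_prop
  have hB0 : B 0 = 1 := by simp only [B, hE0]; field_simp
  have hPd : ∀ᶠ s in 𝓝 0, s * deriv P s
      = p₁ * s + 2 * p₂ * s ^ 2 + s ^ 3 * eulerOp 3 g s := by
    filter_upwards [hPg.eventually_nhds, hg.eventually_analyticAt] with s hs hgs
    have h1 : HasDerivAt P (p₁ + p₂ * (2 * s) + (3 * s ^ 2 * g s + s ^ 3 * deriv g s)) s := by
      have := ((((hasDerivAt_id s).const_mul (1 / (2 * (a + 2)))).const_sub 1).add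
        ((hasDerivAt_pow 2 s).const_mul p₂)).add
        ((hasDerivAt_pow 3 s).mul hgs.differentiableAt.hasDerivAt)
      refine (this.congr_of_eventuallyEq hs).congr_deriv ?_
      simp [hp₁]
    rw [h1.deriv, eulerOp]; ring
  refine ⟨A, B, hA, hB, ?_, ?_, ?_⟩
  · let W : ℂ → ℂ := fun s => (eulerOp 3 g s - g s * (p₁ * s + (2 * p₂ - p₁ ^ 2) * s ^ 2)
      - (p₁ * p₂ + (2 * p₂ - p₁ ^ 2) * p₁ + (2 * p₂ - p₁ ^ 2) * p₂ * s)) / P s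
    have hW : ContinuousAt W 0 := by
      have h := (analyticAt_eulerOp 3 hg).continuousAt
      have h2 := hg.continuousAt
      have h3 := hP.continuousAt
      exact ContinuousAt.div (by fun_prop) h3 (by simp [hP0])
    have h1 : (fun s => s ^ 3 * W s) =O[𝓝 0] fun s : ℂ => s ^ 3 := by
      simpa using (isBigO_refl (fun s : ℂ => s ^ 3) (𝓝 0)).mul (hW.isBigO_one ℂ)
    refine h1.congr' ?_ EventuallyEq.rfl
    filter_upwards [hPd, hPg, hPne] with s hs hs2 hs3
    -- The coefficient of s² in sP'/P is 2p₂ - p₁².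
    have key : a / (8 * (a + 3) * (a + 2) ^ 2 * (a + 1)) = -(2 * p₂ - p₁ ^ 2) := by
      rw [hp₁, hp₂]; field_simp; ring
    have key2 : a / (a + 2) * (s / 4) = s / 4 + p₁ * s := by
      rw [hp₁]; field_simp; ring
    have hs4 : P s = 1 + p₁ * s + p₂ * s ^ 2 + s ^ 3 * g s := by rw [hs2, hp₁]; ring
    simp only [W, A]
    rw [key, key2, hs, eq_sub_iff_add_eq, mul_div_assoc', div_add' _ _ _ hs3, add_div' _ _ _ hs3]
    congr 1
    rw [hs4]; ring
  · have h1 := (hB.differentiableAt.isBigO_sub)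
    simpa [hB0] using h1
  · set l := 𝓝[Complex.slitPlane] (0 : ℂ)
    let X : ℂ → ℂ := fun s => s ^ (a + 3)
    have hX0 : Tendsto X l (𝓝 0) := tendsto_cpow_zero (by simp; linarith)
    have hX2 : (fun s => X s ^ 2) =O[l] fun s => s ^ (2 * a + 6) := by
      refine IsBigO.of_bound 1 (Eventually.of_forall fun s => ?_)
      rw [one_mul, ← Complex.cpow_nat_mul]
      apply le_of_eq; congr 2; push_cast; ring
    have hl : l ≤ 𝓝 0 := nhdsWithin_le_nhds
    have hτ0 : Tendsto τ₁ l (𝓝 0) :=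
      hτ₁.trans_tendsto (tendsto_cpow_zero (by simp; linarith))
    let D : ℂ → ℂ := fun s => P s + X s * Q s + τ₁ s
    have hD : Tendsto D l (𝓝 1) := by
      have := ((hP.continuousAt.tendsto.mono_left hl).add
        (hX0.mul (hQ.continuousAt.tendsto.mono_left hl))).add hτ0
      simpa [hP0] using this
    have hDinv : (fun s => (D s)⁻¹) =O[l] fun _ => (1 : ℂ) :=
      (hD.inv₀ one_ne_zero).isBigO_one ℂ
    have hDne : ∀ᶠ s in l, D s ≠ 0 := hD.eventually_ne one_ne_zero
    have hT : (fun s => s * deriv P s / P s + X s * E s) =O[l] fun _ => (1 : ℂ) := by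
      have h1 : ContinuousAt (fun s => s * deriv P s / P s) 0 :=
        ((analyticAt_id.mul hP').div hP (by simp [hP0])).continuousAt
      exact ((h1.tendsto.mono_left hl).add
        (hX0.mul (hE.continuousAt.tendsto.mono_left hl))).isBigO_one ℂ
    have hQE : (fun s => Q s * E s) =O[l] fun _ => (1 : ℂ) :=
      ((hQ.mul hE).continuousAt.tendsto.mono_left hl).isBigO_one ℂ
    have hnum := ((hτ₂.sub (hτ₁.const_mul_left a)).sub
      (by simpa using hX2.mul hQE)).sub (by simpa using hτ₁.mul hT)
    have htot := by simpa using hnum.mul hDinv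
    refine IsBigO.congr' htot ?_ EventuallyEq.rfl
    filter_upwards [hF, hDne, hl hPne, self_mem_nhdsWithin] with s hs hDs hPs hss
    have hs0 := Complex.slitPlane_ne_zero hss
    have hsa : s ^ a ≠ 0 := by rw [Ne, Complex.cpow_eq_zero_iff]; tauto
    rw [hν s hss, nuFun, hs.1, hs.2]
    have hk : -(besselCoeff a 0 0 * s ^ a) ≠ 0 := neg_ne_zero.2 (mul_ne_zero b0 hsa)
    set k := -(besselCoeff a 0 0 * s ^ a)
    have h3 : ((s / 4 - a) * (k * (P s + s ^ (a + 3) * Q s + τ₁ s)) + k * (eulerOp a P s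
        + s ^ (a + 3) * eulerOp (2 * a + 3) Q s + τ₂ s)) / (k * (P s + s ^ (a + 3) * Q s + τ₁ s))
        = s / 4 - a + (eulerOp a P s + X s * eulerOp (2 * a + 3) Q s + τ₂ s) / D s := by
      simp only [D, X] at hDs ⊢
      field_simp
    rw [h3]
    have h4 : 2 / ((4 : ℂ) ^ (a + 3) * (a + 2) * (a + 1) * Complex.Gamma (a + 3)
            * Complex.Gamma (a + 4)) * s ^ (a + 3) * B s = -(X s * E s) := by
      change c * X s * (-c⁻¹ * E s) = _
      field_simp
    rw [h4]
    have h5 : eulerOp (2 * a + 3) Q s = eulerOp (a + 3) Q s + a * Q s := by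
      simp only [eulerOp]; ring
    have h6 : P s * E s = eulerOp (a + 3) Q s - s * deriv P s * Q s / P s := by
      simp only [E]; field_simp
    have h7 : eulerOp (a + 3) Q s = P s * E s + s * deriv P s * Q s / P s := by rw [h6]; ring
    rw [h5, h7]
    simp only [A, eulerOp]
    rw [← div_eq_mul_inv, div_eq_iff hDs, sub_mul, add_mul, div_mul_cancel₀ _ hDs]
    simp only [D]
    field_simp
    ring

/-! ### From the finite-n relations to the hard-edge limit -/

/-- `c x - a + x F''(x) / F'(x)`. -/
def hardH (c a : ℂ) (F : ℂ → ℂ) (x : ℂ) : ℂ := c * x - a + x * (deriv (deriv F) x / deriv F x)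

/-- The derivative of `hardH`. -/
def hardH' (c : ℂ) (F : ℂ → ℂ) (x : ℂ) : ℂ :=
  c + deriv (deriv F) x / deriv F x
    + x * (deriv (deriv (deriv F)) x / deriv F x - (deriv (deriv F) x / deriv F x) ^ 2)

/-- The second derivative of `hardH`. -/
def hardH'' (F : ℂ → ℂ) (x : ℂ) : ℂ :=
  2 * (deriv (deriv (deriv F)) x / deriv F x - (deriv (deriv F) x / deriv F x) ^ 2)
    + x * (deriv (deriv (deriv (deriv F))) x / deriv F x
      - 3 * (deriv (deriv F) x / deriv F x) * (deriv (deriv (deriv F)) x / deriv F x)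
      + 2 * (deriv (deriv F) x / deriv F x) ^ 3)

lemma hasDerivAt_hardH {F : ℂ → ℂ} {x : ℂ} (c a : ℂ) (hF : AnalyticAt ℂ F x) (h : deriv F x ≠ 0) :
    HasDerivAt (hardH c a F) (hardH' c F x) x := by
  have h1 := hF.deriv.differentiableAt.hasDerivAt
  have h2 := hF.deriv.deriv.differentiableAt.hasDerivAt
  refine ((((hasDerivAt_id x).const_mul c).sub_const a).add
    ((hasDerivAt_id x).mul (h2.div h1 h))).congr_deriv ?_
  simp only [hardH', id, Pi.div_apply]
  field_simp
  ring

lemma hasDerivAt_hardH' {F : ℂ → ℂ} {x : ℂ} (c : ℂ) (hF : AnalyticAt ℂ F x) (h : deriv F x ≠ 0) :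
    HasDerivAt (hardH' c F) (hardH'' F x) x := by
  have h1 := hF.deriv.differentiableAt.hasDerivAt
  have h2 := hF.deriv.deriv.differentiableAt.hasDerivAt
  have h3 := hF.deriv.deriv.deriv.differentiableAt.hasDerivAt
  refine (((h2.div h1 h).const_add c).add ((hasDerivAt_id x).mul ((h3.div h1 h).sub
    ((h2.div h1 h).pow 2)))).congr_deriv ?_
  simp only [hardH'', id, Pi.div_apply, Pi.sub_apply, Pi.pow_apply, Nat.cast_ofNat,
    Nat.add_one_sub_one, pow_one]
  field_simp
  ring

lemma analyticOnNhd_detInf {a : ℂ} (ha : -1 < a.re) :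
    AnalyticOnNhd ℂ (detInf a) Complex.slitPlane :=
  (differentiableOn_detInf ha).analyticOnNhd Complex.isOpen_slitPlane

lemma analyticOnNhd_detN {a : ℂ} (ha : -1 < a.re) (n : ℕ) :
    AnalyticOnNhd ℂ (detN a n) Complex.slitPlane :=
  (differentiableOn_detN ha n).analyticOnNhd Complex.isOpen_slitPlane

lemma tendstoLocallyUniformlyOn_deriv_of {F : ℕ → ℂ → ℂ} {f : ℂ → ℂ} {U : Set ℂ}
    (hU : IsOpen U) (h : TendstoLocallyUniformlyOn F f atTop U)
    (hF : ∀ n, AnalyticOnNhd ℂ (F n) U) :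
    TendstoLocallyUniformlyOn (fun n => deriv (F n)) (deriv f) atTop U :=
  h.deriv (Eventually.of_forall fun n => (hF n).differentiableOn) hU

lemma TendstoLocallyUniformlyOn.tendsto_seq {F : ℕ → ℂ → ℂ} {f : ℂ → ℂ} {U : Set ℂ}
    (hU : IsOpen U) (h : TendstoLocallyUniformlyOn F f atTop U)
    (hF : ∀ n, AnalyticOnNhd ℂ (F n) U) {s : ℂ} (hs : s ∈ U) {x : ℕ → ℂ}
    (hx : Tendsto x atTop (𝓝 s)) : Tendsto (fun n => F n (x n)) atTop (𝓝 (f s)) := by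
  have hf : ContinuousOn f U :=
    h.continuousOn (Frequently.of_forall fun n => (hF n).continuousOn)
  refine h.tendsto_comp (hf s hs) hs ?_
  exact tendsto_nhdsWithin_iff.2 ⟨hx, hx.eventually (hU.mem_nhds hs)⟩

/-- The Hankel determinants of the weight in terms of `detN`. -/
lemma weightDet_eq {a : ℂ} (ha : -1 < a.re) {n : ℕ} (hn : 0 < n) {t : ℝ} (ht : 0 < t) :
    (t : ℂ) ^ a * ((Real.exp (-t) : ℝ) : ℂ) ^ (n + 1) * weightDet a n t
      = -(4 * n) * (gammaMatrix a n).det * deriv (detN a n) ((4 * n * t : ℝ) : ℂ) := by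
  have hn' : (0 : ℝ) < 4 * n := by positivity
  have h1 := hasDerivAt_det_upperMatrix ha n ht
  have hslit : ((4 * n * t : ℝ) : ℂ) ∈ Complex.slitPlane :=
    Complex.ofReal_mem_slitPlane.2 (by positivity)
  have h2 : HasDerivAt (fun τ : ℝ => (gammaMatrix a n).det * detN a n ((4 * n * τ : ℝ) : ℂ))
      ((gammaMatrix a n).det * (deriv (detN a n) ((4 * n * t : ℝ) : ℂ) * (4 * n))) t := by
    have h3 : HasDerivAt (fun τ : ℝ => ((4 * n * τ : ℝ) : ℂ)) (4 * n) t := by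
      have := ((hasDerivAt_id t).const_mul (4 * n : ℝ)).ofReal_comp
      simpa using this
    exact ((analyticOnNhd_detN ha n _ hslit).differentiableAt.hasDerivAt.comp t h3).const_mul _
  have h4 : (fun τ => (upperMatrix a n τ).det) =ᶠ[𝓝 t]
      fun τ : ℝ => (gammaMatrix a n).det * detN a n ((4 * n * τ : ℝ) : ℂ) := by
    filter_upwards [lt_mem_nhds ht] with τ hτ
    rw [← det_upperMatrix ha hn (by positivity : 0 < 4 * n * τ)]
    congr 2
    field_simp
  have h5 := h1.unique (h2.congr_of_eventuallyEq h4)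
  linear_combination -h5

lemma weightDet_ne_zero_iff {a : ℂ} (ha : -1 < a.re) {n : ℕ} (hn : 0 < n) {t : ℝ} (ht : 0 < t) :
    weightDet a n t ≠ 0 ↔ deriv (detN a n) ((4 * n * t : ℝ) : ℂ) ≠ 0 := by
  have h := weightDet_eq ha hn ht
  have ht0 : (t : ℂ) ≠ 0 := by exact_mod_cast ht.ne'
  have h1 : (t : ℂ) ^ a * ((Real.exp (-t) : ℝ) : ℂ) ^ (n + 1) ≠ 0 := by
    refine mul_ne_zero (by rw [Ne, Complex.cpow_eq_zero_iff]; tauto) (pow_ne_zero _ ?_)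
    exact_mod_cast (Real.exp_pos _).ne'
  have h2 : -(4 * (n : ℂ)) * (gammaMatrix a n).det ≠ 0 :=
    mul_ne_zero (neg_ne_zero.2 (mul_ne_zero (by norm_num) (by exact_mod_cast hn.ne')))
      (gammaMatrix_det_ne_zero ha n)
  constructor
  · intro hw hd
    rw [hd, mul_zero] at h
    exact mul_ne_zero h1 hw h
  · intro hd hw
    rw [hw, mul_zero] at h
    exact mul_ne_zero h2 hd h.symm

lemma eventually_weightDet_ne_zero {a : ℂ} (ha : -1 < a.re) {s : ℝ} (hs : 0 < s)
    (h : deriv (detInf a) s ≠ 0) {t : ℕ → ℝ} (ht : Tendsto (fun n : ℕ => 4 * n * t n) atTop (𝓝 s)) :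
    ∀ᶠ n in atTop, weightDet a n (t n) ≠ 0 := by
  have hslit : (s : ℂ) ∈ Complex.slitPlane := Complex.ofReal_mem_slitPlane.2 hs
  have h1 := TendstoLocallyUniformlyOn.tendsto_seq Complex.isOpen_slitPlane
    (tendstoLocallyUniformlyOn_deriv_of Complex.isOpen_slitPlane (tendstoLocallyUniformlyOn_detN ha)
      (analyticOnNhd_detN ha)) (fun n => (analyticOnNhd_detN ha n).deriv) hslit
    (x := fun n => ((4 * n * t n : ℝ) : ℂ)) ((Complex.continuous_ofReal.tendsto s).comp ht)
  filter_upwards [h1.eventually_ne h, ht.eventually (lt_mem_nhds hs), eventually_gt_atTop 0]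
    with n hn hpos hn0
  have hn' : (0 : ℝ) < 4 * n := by positivity
  exact (weightDet_ne_zero_iff ha hn0 (pos_of_mul_pos_right hpos hn'.le)).2 hn

/-- The relations at index n+1 involve determinants of neighbouring orders at one common t. In terms
of the order m = n+k, the product 4m·t still tends to s. -/
lemma eventually_weightDet_shift_ne_zero {a : ℂ} (ha : -1 < a.re) {s : ℝ} (hs : 0 < s)
    (h : deriv (detInf a) s ≠ 0) (k : ℕ) :
    ∀ᶠ n : ℕ in atTop, weightDet a (n + k) (s / (4 * (n + 1 : ℕ))) ≠ 0 := by
  have h1 : Tendsto (fun n : ℕ => 4 * (n : ℝ) * (s / (4 * (n - k + 1)))) atTop (𝓝 s) := by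
    have h2 : Tendsto (fun n : ℕ => ((n : ℝ) - k + 1)) atTop atTop :=
      tendsto_atTop_add_const_right _ _ (tendsto_atTop_add_const_right _ (-(k : ℝ))
        tendsto_natCast_atTop_atTop)
    have h3 := (h2.inv_tendsto_atTop.const_mul (s * (k - 1))).const_add s
    rw [mul_zero, add_zero] at h3
    refine h3.congr' ?_
    filter_upwards [h2.eventually (eventually_gt_atTop 0)] with n hn
    simp only [Pi.inv_apply]
    field_simp
    ring
  have h2 := (tendsto_add_atTop_nat k).eventually (eventually_weightDet_ne_zero ha hs h h1)
  filter_upwards [h2] with n hn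
  convert hn using 3
  push_cast; ring

/-- Apply t d/dt to `weightDet_eq`: the determinant contributes H_N, the power t^a contributes a,
and the exponential contributes -(N+1)t. -/
lemma nextCoeff_eq_hardH {a : ℂ} (ha : -1 < a.re) (n : ℕ) {t : ℝ} (ht : 0 < t)
    (hD : weightDet a (n + 1) t ≠ 0) :
    ((n + 1 : ℕ) : ℂ) * ((n + 1 : ℕ) + a + 2) + (monicOrthPoly (weightMoment a t) (n + 1)).nextCoeff
      = hardH (((n + 1 : ℕ) + 1) / (4 * (n + 1 : ℕ))) a (detN a (n + 1))
        ((4 * (n + 1 : ℕ) * t : ℝ) : ℂ) := by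
  obtain ⟨D', hD1, hD2⟩ := exists_hasDerivAt_weightDet ht a n hD
  set N := n + 1 with hN
  have hNp : 0 < N := hN ▸ n.succ_pos
  have hN0 : (N : ℂ) ≠ 0 := by rw [hN]; exact_mod_cast n.succ_ne_zero
  have hNpos : (0 : ℝ) < N := by rw [hN]; exact_mod_cast n.succ_pos
  have ht0 : (t : ℂ) ≠ 0 := by exact_mod_cast ht.ne'
  have hslit : ((4 * N * t : ℝ) : ℂ) ∈ Complex.slitPlane :=
    Complex.ofReal_mem_slitPlane.2 (by positivity)
  set F := detN a N
  have hF := analyticOnNhd_detN ha N _ hslit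
  have hF1 := (weightDet_ne_zero_iff ha hNp ht).1 hD
  set κ : ℂ := -(4 * N) * (gammaMatrix a N).det with hκ
  have hκ0 : κ ≠ 0 := mul_ne_zero (neg_ne_zero.2 (mul_ne_zero (by norm_num) hN0))
    (gammaMatrix_det_ne_zero ha N)
  have hR : HasDerivAt (fun τ : ℝ => κ * deriv F ((4 * N * τ : ℝ) : ℂ))
      (κ * (deriv (deriv F) ((4 * N * t : ℝ) : ℂ) * (4 * N))) t := by
    have h3 : HasDerivAt (fun τ : ℝ => ((4 * N * τ : ℝ) : ℂ)) (4 * N) t := by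
      have := ((hasDerivAt_id t).const_mul (4 * N : ℝ)).ofReal_comp
      simpa using this
    exact (hF.deriv.differentiableAt.hasDerivAt.comp t h3).const_mul _
  have he : HasDerivAt (fun τ : ℝ => ((Real.exp (-τ) : ℝ) : ℂ)) (-((Real.exp (-t) : ℝ) : ℂ)) t := by
    have := ((hasDerivAt_neg t).exp).ofReal_comp
    simpa using this
  have hL := ((hasDerivAt_ofReal_cpow (b := a) ht).mul (he.pow (N + 1))).mul hD1
  have hEq : (fun τ : ℝ => κ * deriv F ((4 * N * τ : ℝ) : ℂ)) =ᶠ[𝓝 t]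
      fun τ : ℝ => (τ : ℂ) ^ a * ((Real.exp (-τ) : ℝ) : ℂ) ^ (N + 1) * weightDet a N τ := by
    filter_upwards [lt_mem_nhds ht] with τ hτ
    exact (weightDet_eq ha hNp hτ).symm
  have hu := hR.unique (hL.congr_of_eventuallyEq hEq)
  have hval := weightDet_eq ha hNp ht
  rw [← hκ] at hval
  set e : ℂ := ((Real.exp (-t) : ℝ) : ℂ)
  have hpow : (t : ℂ) ^ (a - 1) * t = (t : ℂ) ^ a := by
    rw [Complex.cpow_sub _ _ ht0, Complex.cpow_one]; field_simp
  replace hu : κ * (deriv (deriv F) ((4 * N * t : ℝ) : ℂ) * (4 * N))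
      = (a * (t : ℂ) ^ (a - 1) * e ^ (N + 1) + (t : ℂ) ^ a * ((N + 1) * e ^ N * -e))
        * weightDet a N t + (t : ℂ) ^ a * e ^ (N + 1) * D' :=
    hu.trans (by simp only [Pi.mul_apply, Pi.pow_apply, Nat.add_sub_cancel, Nat.cast_add,
      Nat.cast_one, e])
  have hD2' : t * D' = weightDet a N t
      * ((N : ℂ) * (N + a + 2) + (monicOrthPoly (weightMoment a t) N).nextCoeff) := by
    rw [hD2, hN]; push_cast; ring
  set G := (N : ℂ) * (N + a + 2) + (monicOrthPoly (weightMoment a t) N).nextCoeff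
  have key : κ * (deriv (deriv F) ((4 * N * t : ℝ) : ℂ) * (4 * N * t))
      = κ * (deriv F ((4 * N * t : ℝ) : ℂ) * (a - (N + 1) * t + G)) := by
    linear_combination t * hu + (a - (N + 1) * t + G) * hval + (t : ℂ) ^ a * e ^ (N + 1) * hD2'
      + a * e ^ (N + 1) * weightDet a N t * hpow
  have key2 := mul_left_cancel₀ hκ0 key
  rw [hardH, mul_div_assoc', eq_comm, ← sub_eq_zero]
  set f1 := deriv F ((4 * N * t : ℝ) : ℂ)
  set f2 := deriv (deriv F) ((4 * N * t : ℝ) : ℂ)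
  push_cast
  have h7 : 4 * (N : ℂ) * t * f2 / f1 = a - (N + 1) * t + G := by
    rw [div_eq_iff hF1]; linear_combination key2
  rw [h7]
  field_simp
  ring

/-- The `σ`-form of Painlevé III′ as the hard-edge limit of the finite-`n` relations. -/
lemma limit_relations {a s h h1 h2 : ℂ} {x x1 x2 R R' β : ℕ → ℂ}
    (hx : Tendsto x atTop (𝓝 h)) (hx1 : Tendsto x1 atTop (𝓝 h1)) (hx2 : Tendsto x2 atTop (𝓝 h2))
    (hrel : ∀ᶠ N : ℕ in atTop, β N ≠ 0 ∧ β N = s * x1 N - x N + N * (N + a + 2) ∧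
      4 * N * s * x2 N = β N * (R N - R' N) ∧
      β N * (R N * R' N) = (4 * N * x1 N) ^ 2 + a * (4 * N * x1 N) ∧
      β N * ((1 - R N) * (1 - R' N)) = (N - 4 * N * x1 N) * (N + 2 - 4 * N * x1 N)) :
    Tendsto R atTop (𝓝 (4 * h1)) ∧
      s ^ 2 * h2 ^ 2 - (a + 2) ^ 2 * h1 ^ 2 + h1 * (4 * h1 - 1) * (s * h1 - h)
        + (1 / 2) * a * (a + 2) * h1 - (1 / 16) * a ^ 2 = 0 := by
  have hinv : Tendsto (fun n : ℕ => (n : ℂ)⁻¹) atTop (𝓝 0) := by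
    have := (Complex.continuous_ofReal.tendsto 0).comp (tendsto_inv_atTop_nhds_zero_nat (𝕜 := ℝ))
    simpa [Function.comp_def] using this
  have he : Tendsto (fun N => s * x1 N - x N) atTop (𝓝 (s * h1 - h)) := (hx1.const_mul s).sub hx
  have hp : Tendsto (fun N => a + 4 * (2 + a) * x1 N) atTop (𝓝 (a + 4 * (2 + a) * h1)) :=
    (hx1.const_mul _).const_add a
  have hN0 : ∀ᶠ N : ℕ in atTop, (N : ℂ) ≠ 0 := by
    filter_upwards [eventually_gt_atTop 0] with N hN
    exact_mod_cast hN.ne'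
  -- Expanding (1-R)(1-R') and inserting the value of RR' determines the sum R + R'.
  have hsum : ∀ N : ℕ, (β N ≠ 0 ∧ β N = s * x1 N - x N + N * (N + a + 2) ∧
      4 * N * s * x2 N = β N * (R N - R' N) ∧
      β N * (R N * R' N) = (4 * N * x1 N) ^ 2 + a * (4 * N * x1 N) ∧
      β N * ((1 - R N) * (1 - R' N)) = (N - 4 * N * x1 N) * (N + 2 - 4 * N * x1 N)) →
      β N * (R N + R' N) = 8 * N ^ 2 * x1 N + N * (a + 4 * (2 + a) * x1 N)
        + (s * x1 N - x N) := by
    rintro N ⟨-, h1, -, h3, h4⟩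
    linear_combination h1 + h3 - h4
  constructor
  -- Here β grows like N² and β(R+R') like 8N²h₁, while β(R-R') is only O(N), so R tends to 4h₁.
  · have hβ : Tendsto (fun N : ℕ => 1 + (a + 2) * (N : ℂ)⁻¹
        + (s * x1 N - x N) * ((N : ℂ)⁻¹ * (N : ℂ)⁻¹)) atTop (𝓝 1) := by
      have := ((hinv.const_mul (a + 2)).const_add 1).add (he.mul (hinv.mul hinv))
      simpa using this
    have hnum : Tendsto (fun N : ℕ => 4 * x1 N + (a + 4 * (2 + a) * x1 N) * (N : ℂ)⁻¹ / 2
        + (s * x1 N - x N) * ((N : ℂ)⁻¹ * (N : ℂ)⁻¹) / 2 + 2 * s * x2 N * (N : ℂ)⁻¹) atTop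
        (𝓝 (4 * h1)) := by
      have := (((hx1.const_mul 4).add ((hp.mul hinv).div_const 2)).add
        ((he.mul (hinv.mul hinv)).div_const 2)).add ((hx2.const_mul (2 * s)).mul hinv)
      simpa using this
    have hlim := hnum.div hβ one_ne_zero
    rw [div_one] at hlim
    refine hlim.congr' ?_
    filter_upwards [hrel, hN0] with N hN hN0
    have hs := hsum N hN
    obtain ⟨h0, h1, h2, -, -⟩ := hN
    have e1 : 1 + (a + 2) * (N : ℂ)⁻¹ + (s * x1 N - x N) * ((N : ℂ)⁻¹ * (N : ℂ)⁻¹)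
        = β N * ((N : ℂ)⁻¹ * (N : ℂ)⁻¹) := by
      rw [h1]; field_simp; ring
    have e2 : β N * R N = 4 * N ^ 2 * x1 N + N * (a + 4 * (2 + a) * x1 N) / 2
        + (s * x1 N - x N) / 2 + 2 * N * s * x2 N := by
      linear_combination (hs - h2) / 2
    simp only [Pi.div_apply]
    rw [e1, div_eq_iff (mul_ne_zero h0 (mul_ne_zero (inv_ne_zero hN0) (inv_ne_zero hN0))),
      show R N * (β N * ((N : ℂ)⁻¹ * (N : ℂ)⁻¹)) = β N * R N * ((N : ℂ)⁻¹ * (N : ℂ)⁻¹) by ring, e2]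
    field_simp
  · have hL : Tendsto (fun N => s ^ 2 * x2 N ^ 2 - (a + 2) ^ 2 * x1 N ^ 2
        + x1 N * (4 * x1 N - 1) * (s * x1 N - x N)
        + (1 / 2) * a * (a + 2) * x1 N - (1 / 16) * a ^ 2) atTop
        (𝓝 (s ^ 2 * h2 ^ 2 - (a + 2) ^ 2 * h1 ^ 2 + h1 * (4 * h1 - 1) * (s * h1 - h)
        + (1 / 2) * a * (a + 2) * h1 - (1 / 16) * a ^ 2)) :=
      (((((hx2.pow 2).const_mul _).sub ((hx1.pow 2).const_mul _)).add
        ((hx1.mul ((hx1.const_mul 4).sub_const 1)).mul he)).add (hx1.const_mul _)).sub_const _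
    have h0 : Tendsto (fun N : ℕ => (2 * (a + 4 * (2 + a) * x1 N) * (s * x1 N - x N)
        - 16 * a * x1 N * (s * x1 N - x N)) / 16 * (N : ℂ)⁻¹
        + (s * x1 N - x N) ^ 2 / 16 * ((N : ℂ)⁻¹ * (N : ℂ)⁻¹)) atTop (𝓝 0) := by
      have := (((((hp.const_mul 2).mul he).sub ((hx1.const_mul (16 * a)).mul he)).div_const 16).mul
        hinv).add (((he.pow 2).div_const 16).mul (hinv.mul hinv))
      simpa using this
    refine tendsto_nhds_unique hL (h0.congr' ?_)
    filter_upwards [hrel, hN0] with N hN hN0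
    have hs := hsum N hN
    obtain ⟨-, h1, h2, h3, -⟩ := hN
    -- This is (R-R')² = (R+R')² - 4RR' multiplied by β². The orders N⁴ and N³ cancel, and order N²
    -- is 16 times the equation for ν.
    have hsq : (4 * N * s * x2 N) ^ 2 = (8 * N ^ 2 * x1 N + N * (a + 4 * (2 + a) * x1 N)
        + (s * x1 N - x N)) ^ 2 - 4 * (s * x1 N - x N + N * (N + a + 2))
          * ((4 * N * x1 N) ^ 2 + a * (4 * N * x1 N)) := by
      rw [← hs, ← h3, h2, ← h1]; ring
    have hN2 : (16 * (N : ℂ) ^ 2) ≠ 0 := mul_ne_zero (by norm_num) (pow_ne_zero _ hN0)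
    refine mul_left_cancel₀ hN2 ?_
    have e1 : 16 * (N : ℂ) ^ 2 * ((2 * (a + 4 * (2 + a) * x1 N) * (s * x1 N - x N)
        - 16 * a * x1 N * (s * x1 N - x N)) / 16 * (N : ℂ)⁻¹
        + (s * x1 N - x N) ^ 2 / 16 * ((N : ℂ)⁻¹ * (N : ℂ)⁻¹))
        = N * (2 * (a + 4 * (2 + a) * x1 N) * (s * x1 N - x N)
        - 16 * a * x1 N * (s * x1 N - x N)) + (s * x1 N - x N) ^ 2 := by
      field_simp
    rw [e1]
    linear_combination -hsq

/-- In the variable s = 4Nt every t-derivative contributes a factor 4N. Four consecutive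
determinants enter: the relations use the polynomial of degree N-1, and θ_N involves Γ_{N+1}, which
needs orders N+1 and N+2. -/
lemma exists_relations {a : ℂ} (ha : -1 < a.re) {s : ℝ} (hs : 0 < s) {n : ℕ}
    (h0 : weightDet a n (s / (4 * (n + 1 : ℕ))) ≠ 0)
    (h1 : weightDet a (n + 1) (s / (4 * (n + 1 : ℕ))) ≠ 0)
    (h2 : weightDet a (n + 2) (s / (4 * (n + 1 : ℕ))) ≠ 0)
    (h3 : weightDet a (n + 3) (s / (4 * (n + 1 : ℕ))) ≠ 0) {N : ℕ} (hN : N = n + 1)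
    {x x1 x2 : ℂ} (hx : x = hardH ((N + 1) / (4 * N)) a (detN a N) s)
    (hx1 : x1 = hardH' ((N + 1) / (4 * N)) (detN a N) s) (hx2 : x2 = hardH'' (detN a N) s) :
    (N : ℂ) * (N + a + 2) + bigGamma a (s / (4 * N)) N = x ∧ ∃ R R' β : ℂ,
      4 * (N : ℂ) * theta a (s / (4 * N)) N = s * (R - 1) ∧
      β ≠ 0 ∧ β = s * x1 - x + N * (N + a + 2) ∧ 4 * N * s * x2 = β * (R - R') ∧
      β * (R * R') = (4 * N * x1) ^ 2 + a * (4 * N * x1) ∧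
      β * ((1 - R) * (1 - R')) = (N - 4 * N * x1) * (N + 2 - 4 * N * x1) := by
  rw [← hN] at h0 h1 h2 h3
  have hNp : 0 < N := hN ▸ n.succ_pos
  have hN0 : (N : ℂ) ≠ 0 := by exact_mod_cast hNp.ne'
  have hNr : (0 : ℝ) < N := by exact_mod_cast hNp
  set t : ℝ := s / (4 * N) with ht_def
  have ht : 0 < t := by positivity
  have hst : 4 * N * t = s := by rw [ht_def]; field_simp
  have hstc : (4 : ℂ) * N * t = s := by rw [← hst]; push_cast; ring
  have hslit : (s : ℂ) ∈ Complex.slitPlane := Complex.ofReal_mem_slitPlane.2 hs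
  set F := detN a N with hF_def
  set c : ℂ := (N + 1) / (4 * N) with hc
  have hF := analyticOnNhd_detN ha N
  have hne : ∀ᶠ τ : ℝ in 𝓝 t, weightDet a N τ ≠ 0 := by
    obtain ⟨D', hD', -⟩ := exists_hasDerivAt_weightDet ht a n (hN ▸ h1)
    rw [← hN] at hD'
    exact hD'.continuousAt.eventually_ne h1
  have hderiv : ∀ τ : ℝ, HasDerivAt (fun τ : ℝ => ((4 * N * τ : ℝ) : ℂ)) (4 * N) τ := fun τ => by
    have := ((hasDerivAt_id τ).const_mul (4 * N : ℝ)).ofReal_comp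
    simpa using this
  have hslit' : ∀ τ : ℝ, 0 < τ → ((4 * N * τ : ℝ) : ℂ) ∈ Complex.slitPlane := fun τ hτ =>
    Complex.ofReal_mem_slitPlane.2 (by positivity)
  have hH : ∀ᶠ τ : ℝ in 𝓝 t, hardH c a F ((4 * N * τ : ℝ) : ℂ)
      = (N : ℂ) * (N + a + 2) + (monicOrthPoly (weightMoment a τ) (n + 1)).nextCoeff := by
    filter_upwards [hne, lt_mem_nhds ht] with τ hτ hτ0
    have := nextCoeff_eq_hardH ha n hτ0 (hN ▸ hτ)
    rw [← hN] at this ⊢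
    exact this.symm
  have hH1 : ∀ᶠ τ : ℝ in 𝓝 t, HasDerivAt (fun τ : ℝ => hardH c a F ((4 * N * τ : ℝ) : ℂ))
      (hardH' c F ((4 * N * τ : ℝ) : ℂ) * (4 * N)) τ := by
    filter_upwards [hne, lt_mem_nhds ht] with τ hτ hτ0
    exact (hasDerivAt_hardH c a (hF _ (hslit' τ hτ0))
      ((weightDet_ne_zero_iff ha hNp hτ0).1 hτ)).comp τ (hderiv τ)
  have hH2 : HasDerivAt (fun τ : ℝ => hardH' c F ((4 * N * τ : ℝ) : ℂ) * (4 * N))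
      (hardH'' F ((4 * N * t : ℝ) : ℂ) * (4 * N) * (4 * N)) t :=
    ((hasDerivAt_hardH' c (hF _ (hslit' t ht))
      ((weightDet_ne_zero_iff ha hNp ht).1 h1)).comp t (hderiv t)).mul_const _
  have e2 : n + 2 = N + 1 := by omega
  have e3 : n + 3 = N + 2 := by omega
  have h0' : weightDet a n t ≠ 0 := h0
  obtain ⟨R, R', β, hβ, hβ2, hr1, hr2, hr3, hth⟩ := finite_relations ht h0' (hN ▸ h1) h2 hH hH1 hH2
  have hx_val := hH.self_of_nhds
  simp only [hst] at hβ2 hr1 hr2 hr3 hx_val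
  rw [← hx] at hx_val hβ2
  rw [← hx1] at hβ2 hr2 hr3
  rw [← hx2] at hr1
  have hΓ := bigGamma_eq (a := a) ht (hN ▸ h1 : weightDet a (n + 1) t ≠ 0) h2
  have hΓ' := bigGamma_eq (a := a) ht h2 h3
  rw [← hN] at hΓ hx_val
  have htheta : theta a t N = t * R - t := by
    have h4 := hth _ (monicOrth_monicOrthPoly h2)
    rw [← hΓ', ← hN, ← hΓ, e2] at h4
    rw [theta, recB, h4, hN]
    push_cast; ring
  refine ⟨by rw [hΓ, ← hx_val], R, R', β, ?_, hβ, ?_, ?_, ?_, ?_⟩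
  · rw [htheta, ← hstc]; ring
  · rw [hβ2, ← hstc]; ring
  · rw [← hr1, ← hstc]; ring
  · rw [hr2]; ring
  · rw [hr3, hN]; push_cast; ring

/-- Locally uniform convergence of analytic functions passes to derivatives; the first four suffice
for H and its first two derivatives. -/
lemma hardEdge_limits {a : ℂ} (ha : -1 < a.re) {s : ℝ} (hs : 0 < s)
    (h : deriv (detInf a) s ≠ 0) :
    Tendsto (fun n : ℕ => (n : ℂ) * (n + a + 2) + bigGamma a (s / (4 * n)) n) atTop
      (𝓝 (hardH (1 / 4) a (detInf a) s)) ∧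
    Tendsto (fun n : ℕ => 4 * (n : ℂ) * theta a (s / (4 * n)) n) atTop
      (𝓝 (s * (4 * hardH' (1 / 4) (detInf a) s - 1))) ∧
    (s : ℂ) ^ 2 * hardH'' (detInf a) s ^ 2 - (a + 2) ^ 2 * hardH' (1 / 4) (detInf a) s ^ 2
      + hardH' (1 / 4) (detInf a) s * (4 * hardH' (1 / 4) (detInf a) s - 1)
        * (s * hardH' (1 / 4) (detInf a) s - hardH (1 / 4) a (detInf a) s)
      + (1 / 2) * a * (a + 2) * hardH' (1 / 4) (detInf a) s - (1 / 16) * a ^ 2 = 0 := by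
  have hslit : (s : ℂ) ∈ Complex.slitPlane := Complex.ofReal_mem_slitPlane.2 hs
  have hO := Complex.isOpen_slitPlane
  have u0 := tendstoLocallyUniformlyOn_detN ha
  have a0 := analyticOnNhd_detN ha
  have u1 := tendstoLocallyUniformlyOn_deriv_of hO u0 a0
  have a1 := fun n => (a0 n).deriv
  have u2 := tendstoLocallyUniformlyOn_deriv_of hO u1 a1
  have a2 := fun n => (a1 n).deriv
  have u3 := tendstoLocallyUniformlyOn_deriv_of hO u2 a2
  have a3 := fun n => (a2 n).deriv
  have u4 := tendstoLocallyUniformlyOn_deriv_of hO u3 a3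
  have f1 := u1.tendsto_at hslit
  have f2 := (u2.tendsto_at hslit).div f1 h
  have f3 := (u3.tendsto_at hslit).div f1 h
  have f4 := (u4.tendsto_at hslit).div f1 h
  have hinv : Tendsto (fun n : ℕ => ((n : ℂ) + 1) / (4 * n)) atTop (𝓝 (1 / 4)) := by
    refine ((tendsto_natCast_add_div 1).div_const 4).congr fun n => ?_
    rw [div_div, mul_comm (n : ℂ) 4]
  have hx : Tendsto (fun N : ℕ => hardH (((N : ℂ) + 1) / (4 * N)) a (detN a N) s) atTop
      (𝓝 (hardH (1 / 4) a (detInf a) s)) :=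
    ((hinv.mul_const _).sub_const a).add (f2.const_mul _)
  have hx1 : Tendsto (fun N : ℕ => hardH' (((N : ℂ) + 1) / (4 * N)) (detN a N) s) atTop
      (𝓝 (hardH' (1 / 4) (detInf a) s)) :=
    (hinv.add f2).add ((f3.sub (f2.pow 2)).const_mul _)
  have hx2 : Tendsto (fun N : ℕ => hardH'' (detN a N) s) atTop
      (𝓝 (hardH'' (detInf a) s)) :=
    ((f3.sub (f2.pow 2)).const_mul 2).add
      (((f4.sub ((f2.const_mul 3).mul f3)).add ((f2.pow 3).const_mul 2)).const_mul _)
  have hrel : ∀ᶠ N : ℕ in atTop, (N : ℂ) * (N + a + 2) + bigGamma a (s / (4 * N)) N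
      = hardH (((N : ℂ) + 1) / (4 * N)) a (detN a N) s ∧ ∃ y : ℂ × ℂ × ℂ,
      4 * (N : ℂ) * theta a (s / (4 * N)) N = s * (y.1 - 1) ∧
      y.2.2 ≠ 0 ∧ y.2.2 = s * hardH' (((N : ℂ) + 1) / (4 * N)) (detN a N) s
        - hardH (((N : ℂ) + 1) / (4 * N)) a (detN a N) s + N * (N + a + 2) ∧
      4 * N * s * hardH'' (detN a N) s = y.2.2 * (y.1 - y.2.1) ∧
      y.2.2 * (y.1 * y.2.1) = (4 * N * hardH' (((N : ℂ) + 1) / (4 * N)) (detN a N) s) ^ 2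
        + a * (4 * N * hardH' (((N : ℂ) + 1) / (4 * N)) (detN a N) s) ∧
      y.2.2 * ((1 - y.1) * (1 - y.2.1))
        = (N - 4 * N * hardH' (((N : ℂ) + 1) / (4 * N)) (detN a N) s)
          * (N + 2 - 4 * N * hardH' (((N : ℂ) + 1) / (4 * N)) (detN a N) s) := by
    rw [← map_add_atTop_eq_nat 1, eventually_map]
    filter_upwards [eventually_weightDet_shift_ne_zero ha hs h 0,
      eventually_weightDet_shift_ne_zero ha hs h 1, eventually_weightDet_shift_ne_zero ha hs h 2,
      eventually_weightDet_shift_ne_zero ha hs h 3] with n h0 h1 h2 h3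
    obtain ⟨hΓ, R, R', β, hr⟩ := exists_relations ha hs h0 h1 h2 h3 rfl rfl rfl rfl
    exact ⟨hΓ, (R, R', β), hr⟩
  obtain ⟨y, hy⟩ := (hrel.mono fun N hN => hN.2).choice
  obtain ⟨hR, hode⟩ := limit_relations hx hx1 hx2 (s := s) (a := a) (R := fun N => (y N).1)
    (R' := fun N => (y N).2.1) (β := fun N => (y N).2.2) (hy.mono fun N hN => hN.2)
  refine ⟨hx.congr' (hrel.mono fun N hN => hN.1.symm), ?_, hode⟩
  refine ((hR.sub_const 1).const_mul (s : ℂ)).congr' (hy.mono fun N hN => hN.1.symm)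

/-! ### Continuation to the cut plane and the poles of ν -/

lemma isPreconnected_slitPlane : IsPreconnected Complex.slitPlane :=
  (Complex.starConvex_one_slitPlane.isPathConnected Complex.one_mem_slitPlane).isConnected.2

lemma eventually_deriv_detInf_ne_zero {a : ℂ} (ha : -1 < a.re) :
    ∀ᶠ s in 𝓝[Complex.slitPlane] 0, deriv (detInf a) s ≠ 0 := by
  have b0 := (besselCoeff_values ha).1
  obtain ⟨P, Q, τ₁, τ₂, hP, hQ, ⟨g, hg, hPg⟩, -, hτ₁, -, hF⟩ := exists_deriv_detInf_expansion ha
  have hP0 : P 0 = 1 := by simpa using hPg.self_of_nhds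
  set l := 𝓝[Complex.slitPlane] (0 : ℂ)
  have hl : l ≤ 𝓝 0 := nhdsWithin_le_nhds
  have hX0 : Tendsto (fun s : ℂ => s ^ (a + 3)) l (𝓝 0) := tendsto_cpow_zero (by simp; linarith)
  have hτ0 : Tendsto τ₁ l (𝓝 0) := hτ₁.trans_tendsto (tendsto_cpow_zero (by simp; linarith))
  have hD : Tendsto (fun s => P s + s ^ (a + 3) * Q s + τ₁ s) l (𝓝 1) := by
    have := ((hP.continuousAt.tendsto.mono_left hl).add
      (hX0.mul (hQ.continuousAt.tendsto.mono_left hl))).add hτ0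
    simpa [hP0] using this
  filter_upwards [hF, hD.eventually_ne one_ne_zero, self_mem_nhdsWithin] with s hs hDs hss
  have hs0 := Complex.slitPlane_ne_zero hss
  have hsa : s ^ a ≠ 0 := by rw [Ne, Complex.cpow_eq_zero_iff]; tauto
  rw [hs.1]
  exact mul_ne_zero (neg_ne_zero.2 (mul_ne_zero b0 hsa)) hDs

lemma tendsto_ofReal_slitPlane :
    Tendsto (fun x : ℝ => (x : ℂ)) (𝓝[>] 0) (𝓝[Complex.slitPlane] 0) := by
  refine tendsto_nhdsWithin_iff.2 ⟨?_, ?_⟩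
  · exact (Complex.continuous_ofReal.tendsto' 0 0 (by simp)).mono_left nhdsWithin_le_nhds
  · filter_upwards [self_mem_nhdsWithin] with x hx using Complex.ofReal_mem_slitPlane.2 hx

lemma eqOn_zero_of_eventually_ofReal {h : ℂ → ℂ} {U : Set ℂ} (hU : IsPreconnected U)
    (hmem : ∀ᶠ x : ℝ in 𝓝[>] 0, (x : ℂ) ∈ U) (hh : AnalyticOnNhd ℂ h U)
    (hz : ∀ᶠ x : ℝ in 𝓝[>] 0, h x = 0) : Set.EqOn h 0 U := by
  obtain ⟨δ, hδ, hzero⟩ := mem_nhdsGT_iff_exists_Ioo_subset.1 (hz.and hmem)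
  have hδ0 : (0 : ℝ) < δ := hδ
  -- The origin need not lie in U, so the zeros are made to accumulate at δ/2 instead.
  refine hh.eqOn_zero_of_preconnected_of_frequently_eq_zero hU
    (z₀ := ((δ / 2 : ℝ) : ℂ)) (hzero ⟨half_pos hδ0, half_lt_self hδ0⟩).2 ?_
  have ht : Tendsto (fun x : ℝ => (x : ℂ)) (𝓝[>] (δ / 2)) (𝓝[≠] ((δ / 2 : ℝ) : ℂ)) := by
    refine tendsto_nhdsWithin_iff.2 ⟨(Complex.continuous_ofReal.tendsto (δ / 2)).mono_left
      nhdsWithin_le_nhds, ?_⟩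
    filter_upwards [self_mem_nhdsWithin] with x hx hx'
    exact (ne_of_gt hx) (Complex.ofReal_injective hx')
  refine ht.frequently (Eventually.frequently ?_)
  filter_upwards [Ioo_mem_nhdsGT (half_lt_self hδ0)] with x hx
  exact (hzero ⟨(half_pos hδ0).trans hx.1, hx.2⟩).1

lemma deriv_detInf_not_eventually_zero {a : ℂ} (ha : -1 < a.re) {s : ℂ}
    (hs : s ∈ Complex.slitPlane) : ¬ ∀ᶠ z in 𝓝 s, deriv (detInf a) z = 0 := by
  intro h
  have h1 := (analyticOnNhd_detInf ha).deriv.eqOn_zero_of_preconnected_of_eventuallyEq_zero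
    isPreconnected_slitPlane hs h
  obtain ⟨x, hx, hx0⟩ := ((tendsto_ofReal_slitPlane.eventually
    (eventually_deriv_detInf_ne_zero ha)).and self_mem_nhdsWithin).exists
  exact hx (h1 (Complex.ofReal_mem_slitPlane.2 hx0))

lemma nuFun_eq_hardH {a s : ℂ} (h : deriv (detInf a) s ≠ 0) :
    nuFun a s = hardH (1 / 4) a (detInf a) s := by
  rw [nuFun, hardH]; field_simp

lemma eventually_nuFun_eq_hardH {a : ℂ} (ha : -1 < a.re) {s : ℂ} (hs : s ∈ Complex.slitPlane)
    (h : deriv (detInf a) s ≠ 0) : nuFun a =ᶠ[𝓝 s] hardH (1 / 4) a (detInf a) := by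
  filter_upwards [(analyticOnNhd_detInf ha s hs).deriv.continuousAt.eventually_ne h] with z hz
  exact nuFun_eq_hardH hz

lemma analyticAt_nuFun {a : ℂ} (ha : -1 < a.re) {s : ℂ} (hs : s ∈ Complex.slitPlane)
    (h : deriv (detInf a) s ≠ 0) : AnalyticAt ℂ (nuFun a) s := by
  have h1 := (analyticOnNhd_detInf ha s hs).deriv
  have h2 := h1.deriv
  have h3 : AnalyticAt ℂ (fun s => (s / 4 - a) * deriv (detInf a) s
    + s * deriv (deriv (detInf a)) s) s := by fun_prop
  exact h3.div h1 h

lemma deriv_nuFun {a : ℂ} (ha : -1 < a.re) {s : ℂ} (hs : s ∈ Complex.slitPlane)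
    (h : deriv (detInf a) s ≠ 0) : deriv (nuFun a) =ᶠ[𝓝 s] hardH' (1 / 4) (detInf a) := by
  filter_upwards [(eventually_nuFun_eq_hardH ha hs h).eventually_nhds,
    (analyticOnNhd_detInf ha s hs).deriv.continuousAt.eventually_ne h,
    Complex.isOpen_slitPlane.mem_nhds hs] with z hz hz1 hz2
  rw [EventuallyEq.deriv_eq hz, (hasDerivAt_hardH _ _ (analyticOnNhd_detInf ha z hz2) hz1).deriv]

lemma deriv_deriv_nuFun {a : ℂ} (ha : -1 < a.re) {s : ℂ} (hs : s ∈ Complex.slitPlane)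
    (h : deriv (detInf a) s ≠ 0) : deriv (deriv (nuFun a)) s = hardH'' (detInf a) s := by
  rw [(deriv_nuFun ha hs h).deriv_eq, (hasDerivAt_hardH' _ (analyticOnNhd_detInf ha s hs) h).deriv]

/-- Near a zero of `𝓔'` the function `nuFun` has a simple pole with positive residue ratio. -/
lemma nuFun_pole {a : ℂ} (ha : -1 < a.re) {s : ℂ} (hs : s ∈ Complex.slitPlane)
    (h : deriv (detInf a) s = 0) : ∃ (m : ℕ) (g : ℂ → ℂ), 0 < m ∧ AnalyticAt ℂ g s ∧
      g s = m * s ∧ ∀ᶠ z in 𝓝 s, nuFun a z = (z - s)⁻¹ * g z := by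
  have h1 := (analyticOnNhd_detInf ha s hs).deriv
  have hne := deriv_detInf_not_eventually_zero ha hs
  rw [← analyticOrderAt_eq_top] at hne
  obtain ⟨m, hm⟩ := ENat.ne_top_iff_exists.1 hne
  obtain ⟨u, hu, hu0, hfu⟩ := (h1.analyticOrderAt_eq_natCast (n := m)).1 hm.symm
  have hm0 : m ≠ 0 := by
    rintro rfl
    have := hfu.self_of_nhds
    rw [h] at this
    simp at this
    exact hu0 this.symm
  have hu' := hu.deriv
  -- With E' = (z-s)^m u, the logarithmic derivative of E' is m/(z-s) + u'/u.
  refine ⟨m, fun z => (z / 4 - a) * (z - s) + z * (m + (z - s) * deriv u z / u z),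
    Nat.pos_of_ne_zero hm0, ?_, by simp; ring, ?_⟩
  · have hq : AnalyticAt ℂ (fun z => (z - s) * deriv u z / u z) s :=
      AnalyticAt.div (by fun_prop) hu hu0
    fun_prop
  · filter_upwards [hfu.eventually_nhds, hu.eventually_analyticAt, hu.continuousAt.eventually_ne hu0]
      with z hz hza hz0
    -- At the pole itself both sides are 0 by the conventions for division and inversion by 0, so
    -- the identity holds on a full neighbourhood, as the normal form requires.
    by_cases hzs : z = s
    · rw [hzs, nuFun, h]; simp
    · have hsub : z - s ≠ 0 := sub_ne_zero.2 hzs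
      have hd : HasDerivAt (deriv (detInf a)) (m * (z - s) ^ (m - 1) * u z
          + (z - s) ^ m * deriv u z) z := by
        have h3 : HasDerivAt (fun z => (z - s) ^ m) (m * (z - s) ^ (m - 1)) z := by
          exact (((hasDerivAt_id z).sub_const s).fun_pow m).congr_deriv (by simp)
        exact (h3.mul hza.differentiableAt.hasDerivAt).congr_of_eventuallyEq hz
      rw [nuFun, hd.deriv, hz.self_of_nhds, smul_eq_mul]
      obtain ⟨k, rfl⟩ := Nat.exists_eq_succ_of_ne_zero hm0
      simp only [Nat.succ_eq_add_one, Nat.add_sub_cancel]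
      have hk := pow_ne_zero k hsub
      field_simp
      push_cast
      ring

lemma meromorphicNFOn_nuFun {a : ℂ} (ha : -1 < a.re) :
    MeromorphicNFOn (nuFun a) Complex.slitPlane := by
  intro s hs
  by_cases h : deriv (detInf a) s = 0
  · obtain ⟨m, g, hm, hg, hgs, hν⟩ := nuFun_pole ha hs h
    refine Or.inr ⟨-1, g, hg, ?_, ?_⟩
    · rw [hgs]
      exact mul_ne_zero (by exact_mod_cast hm.ne') (Complex.slitPlane_ne_zero hs)
    · filter_upwards [hν] with z hz
      simp [hz]
  · exact (analyticAt_nuFun ha hs h).meromorphicNFAt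

/-- At a zero of E' the residue m·s would be nonzero, whereas (z-s)f(z) tends to 0. This converts
regularity of ν into nonvanishing of E'. -/
lemma deriv_detInf_ne_zero_of_continuousAt {a : ℂ} (ha : -1 < a.re) {s : ℂ}
    (hs : s ∈ Complex.slitPlane) {f : ℂ → ℂ} (hf : ContinuousAt f s)
    (hfν : nuFun a =ᶠ[𝓝[≠] s] f) : deriv (detInf a) s ≠ 0 := by
  intro h
  obtain ⟨m, g, hm, hg, hgs, hz⟩ := nuFun_pole ha hs h
  have h1 : Tendsto (fun z => (z - s) * f z) (𝓝[≠] s) (𝓝 0) := by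
    have : ContinuousAt (fun z => (z - s) * f z) s :=
      (continuousAt_id.sub continuousAt_const).mul hf
    have := this.tendsto.mono_left (nhdsWithin_le_nhds (s := {s}ᶜ))
    simpa using this
  have h2 : Tendsto g (𝓝[≠] s) (𝓝 (m * s)) := by
    rw [← hgs]; exact hg.continuousAt.tendsto.mono_left nhdsWithin_le_nhds
  have h3 : Tendsto (fun z => (z - s) * f z) (𝓝[≠] s) (𝓝 (m * s)) := by
    refine h2.congr' ?_
    filter_upwards [nhdsWithin_le_nhds hz, hfν, self_mem_nhdsWithin] with z hz1 hzf hz2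
    have : z - s ≠ 0 := sub_ne_zero.2 hz2
    rw [← hzf, hz1]; field_simp
  exact mul_ne_zero (by exact_mod_cast hm.ne') (Complex.slitPlane_ne_zero hs)
    (tendsto_nhds_unique h3 h1)

/-- The `ν`-equation for `nuFun`, with denominators cleared. -/
def clearedEquation (a : ℂ) (F : ℂ → ℂ) (s : ℂ) : ℂ :=
  let f1 := deriv F s
  let f2 := deriv (deriv F) s
  let f3 := deriv (deriv (deriv F)) s
  let f4 := deriv (deriv (deriv (deriv F))) s
  let h0 := (s / 4 - a) * f1 + s * f2
  let h1 := f1 ^ 2 / 4 + f1 * f2 + s * (f3 * f1 - f2 ^ 2)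
  let h2 := 2 * f1 * (f3 * f1 - f2 ^ 2) + s * (f4 * f1 ^ 2 - 3 * f2 * f3 * f1 + 2 * f2 ^ 3)
  s ^ 2 * h2 ^ 2 - (a + 2) ^ 2 * f1 ^ 2 * h1 ^ 2 + h1 * (4 * h1 - f1 ^ 2) * (s * h1 - f1 * h0)
    + (1 / 2) * a * (a + 2) * f1 ^ 4 * h1 - (1 / 16) * a ^ 2 * f1 ^ 6

lemma clearedEquation_eq (a : ℂ) (F : ℂ → ℂ) (s : ℂ) (h : deriv F s ≠ 0) :
    clearedEquation a F s = deriv F s ^ 6 * (s ^ 2 * hardH'' F s ^ 2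
      - (a + 2) ^ 2 * hardH' (1 / 4) F s ^ 2
      + hardH' (1 / 4) F s * (4 * hardH' (1 / 4) F s - 1)
        * (s * hardH' (1 / 4) F s - hardH (1 / 4) a F s)
      + (1 / 2) * a * (a + 2) * hardH' (1 / 4) F s - (1 / 16) * a ^ 2) := by
  have e0 : (s / 4 - a) * deriv F s + s * deriv (deriv F) s
      = deriv F s * hardH (1 / 4) a F s := by
    rw [hardH]; field_simp
  have e1 : deriv F s ^ 2 / 4 + deriv F s * deriv (deriv F) s
      + s * (deriv (deriv (deriv F)) s * deriv F s - deriv (deriv F) s ^ 2)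
      = deriv F s ^ 2 * hardH' (1 / 4) F s := by
    rw [hardH']; field_simp
  have e2 : 2 * deriv F s * (deriv (deriv (deriv F)) s * deriv F s - deriv (deriv F) s ^ 2)
      + s * (deriv (deriv (deriv (deriv F))) s * deriv F s ^ 2
        - 3 * deriv (deriv F) s * deriv (deriv (deriv F)) s * deriv F s
        + 2 * deriv (deriv F) s ^ 3) = deriv F s ^ 3 * hardH'' F s := by
    rw [hardH'']; field_simp
  simp only [clearedEquation]
  rw [e0, e1, e2]
  ring

/-- The limit argument gives the equation only on the positive axis and off the zeros of E'. The
cleared equation is analytic on the whole cut plane, so its vanishing for small positive s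
propagates. -/
lemma nuEquation_hardH {a : ℂ} (ha : -1 < a.re) {s : ℂ} (hs : s ∈ Complex.slitPlane)
    (h : deriv (detInf a) s ≠ 0) : NuEquationAt a (nuFun a) s := by
  have hF := analyticOnNhd_detInf ha
  have hC : AnalyticOnNhd ℂ (clearedEquation a (detInf a)) Complex.slitPlane := by
    intro z hz
    have f1 := (hF z hz).deriv
    have f2 := f1.deriv
    have f3 := f2.deriv
    have f4 := f3.deriv
    unfold clearedEquation
    dsimp only
    fun_prop
  have hreal : ∀ᶠ x : ℝ in 𝓝[>] 0, clearedEquation a (detInf a) x = 0 := by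
    filter_upwards [tendsto_ofReal_slitPlane.eventually (eventually_deriv_detInf_ne_zero ha),
      self_mem_nhdsWithin] with x hx hx0
    rw [clearedEquation_eq _ _ _ hx, (hardEdge_limits ha hx0 hx).2.2, mul_zero]
  have hall := eqOn_zero_of_eventually_ofReal isPreconnected_slitPlane
    (tendsto_ofReal_slitPlane.eventually self_mem_nhdsWithin) hC hreal hs
  have h6 := clearedEquation_eq a (detInf a) s h
  rw [hall, Pi.zero_apply, eq_comm, mul_eq_zero] at h6
  rw [NuEquationAt, (deriv_nuFun ha hs h).eq_of_nhds, deriv_deriv_nuFun ha hs h, nuFun_eq_hardH h]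
  exact h6.resolve_left (pow_ne_zero _ h)

lemma sigmaPIIIPrimeAt_of_nuEquation {a s : ℂ} {ν : ℂ → ℂ} (hν : AnalyticAt ℂ ν s)
    (h : NuEquationAt a ν s) :
    SigmaPIIIPrimeAt (a + 2) (a - 2) (fun z => -ν z + z / 4 - a - 2) s := by
  have hd : ∀ z, AnalyticAt ℂ ν z →
      HasDerivAt (fun z => -ν z + z / 4 - a - 2) (-deriv ν z + 1 / 4) z := fun z hz =>
    ((hz.differentiableAt.hasDerivAt.neg.add ((hasDerivAt_id z).div_const 4)).sub_const
      a).sub_const 2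
  have h1 : deriv (fun z => -ν z + z / 4 - a - 2) =ᶠ[𝓝 s] fun z => -deriv ν z + 1 / 4 := by
    filter_upwards [hν.eventually_analyticAt] with z hz using (hd z hz).deriv
  have h2 : deriv (deriv fun z => -ν z + z / 4 - a - 2) s = -deriv (deriv ν) s := by
    rw [h1.deriv_eq]
    exact (hν.deriv.differentiableAt.hasDerivAt.neg.add_const _).deriv
  rw [SigmaPIIIPrimeAt, h2, h1.eq_of_nhds]
  rw [NuEquationAt] at h
  linear_combination h

/-! ### Real exponents: positivity and absence of positive poles -/

lemma shiftIntegrand_ofReal {t x : ℝ} (h : 0 ≤ x + t) (j : ℕ) (b : ℝ) :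
    shiftIntegrand t j b x = ((x ^ j * (x + t) ^ b * Real.exp (-x) : ℝ) : ℂ) := by
  rw [shiftIntegrand, ← Complex.ofReal_cpow h]; push_cast; rfl

lemma eval_map_conj (p : ℂ[X]) (x : ℝ) :
    (p.map (starRingEnd ℂ)).eval (x : ℂ) = starRingEnd ℂ (p.eval (x : ℂ)) := by
  conv_lhs => rw [← Complex.conj_ofReal x]
  rw [eval_map, eval₂_hom]

lemma shiftFunctional_conj {t : ℝ} (ht : 0 < t) (j : ℕ) (b : ℝ) (p : ℂ[X]) :
    shiftFunctional t j b (p.map (starRingEnd ℂ)) = starRingEnd ℂ (shiftFunctional t j b p) := by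
  rw [shiftFunctional_apply ht, shiftFunctional_apply ht, ← integral_conj]
  refine setIntegral_congr_fun measurableSet_Ioi fun x hx => ?_
  have hx0 : (0 : ℝ) < x := hx
  rw [shiftIntegrand_ofReal (by positivity), eval_map_conj, map_mul, Complex.conj_ofReal]

lemma shiftFunctional_mul_conj {t : ℝ} (ht : 0 < t) (j : ℕ) (b : ℝ) {p : ℂ[X]} (hp : p ≠ 0) :
    ∃ r : ℝ, 0 < r ∧ shiftFunctional t j b (p * p.map (starRingEnd ℂ)) = r := by
  set g : ℝ → ℝ := fun x => x ^ j * (x + t) ^ b * Real.exp (-x) * Complex.normSq (p.eval (x : ℂ))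
  have hg : Set.EqOn (fun x : ℝ => shiftIntegrand t j b x
      * (p * p.map (starRingEnd ℂ)).eval (x : ℂ)) (fun x => ((g x : ℝ) : ℂ)) (Set.Ioi 0) := by
    intro x hx
    have hx0 : (0 : ℝ) < x := hx
    simp only [g]
    rw [shiftIntegrand_ofReal (by positivity), eval_mul, eval_map_conj, Complex.mul_conj]
    push_cast; rfl
  have hgi : IntegrableOn g (Set.Ioi 0) := by
    have h1 : IntegrableOn (fun x : ℝ => shiftIntegrand t j b x
        * (p * p.map (starRingEnd ℂ)).eval (x : ℂ)) (Set.Ioi 0) := by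
      have h : ∀ (q : ℂ[X]) (x : ℝ), shiftIntegrand t j b x * q.eval (x : ℂ)
          = ∑ k ∈ Finset.range (q.natDegree + 1), q.coeff k * shiftIntegrand t (k + j) b x := by
        intro q x
        rw [eval_eq_sum_range, Finset.mul_sum]
        refine Finset.sum_congr rfl fun k _ => ?_
        unfold shiftIntegrand; ring
      simp_rw [h]
      exact integrable_finsetSum _ fun k _ => (integrableOn_shiftIntegrand ht _ _).const_mul _
    have h2 : IntegrableOn (fun x => ((g x : ℝ) : ℂ)) (Set.Ioi 0) :=
      h1.congr_fun hg measurableSet_Ioi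
    have h3 := h2.re
    simp only [RCLike.re_eq_complex_re, Complex.ofReal_re] at h3
    exact h3
  have hnn : ∀ x ∈ Set.Ioi (0 : ℝ), 0 ≤ g x := by
    intro x hx
    have hx0 : (0 : ℝ) < x := hx
    have := Complex.normSq_nonneg (p.eval (x : ℂ))
    simp only [g]
    positivity
  refine ⟨∫ x in Set.Ioi (0 : ℝ), g x, ?_, ?_⟩
  · refine lt_of_le_of_ne (setIntegral_nonneg measurableSet_Ioi hnn) fun h0 => ?_
    have h1 := (setIntegral_eq_zero_iff_of_nonneg_ae
      ((ae_restrict_mem measurableSet_Ioi).mono hnn) hgi).1 h0.symm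
    rw [EventuallyEq, ae_restrict_iff' measurableSet_Ioi] at h1
    have hfin : {x : ℝ | p.eval (x : ℂ) = 0}.Finite := by
      refine Set.Finite.of_finite_image (f := fun x : ℝ => (x : ℂ))
        (p.roots.toFinset.finite_toSet.subset ?_) Complex.ofReal_injective.injOn
      rintro _ ⟨x, hx, rfl⟩
      simpa [hp] using hx
    have h2 : ∀ᵐ x : ℝ, x ∉ {x : ℝ | p.eval (x : ℂ) = 0} := by
      rw [ae_iff]; simpa using hfin.measure_zero volume
    have h3 : ∀ᵐ x : ℝ, x ∉ Set.Ioi (0 : ℝ) := by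
      filter_upwards [h1, h2] with x hx1 hx2 hx
      have hx0 : (0 : ℝ) < x := hx
      have hz : Complex.normSq (p.eval (x : ℂ)) ≠ 0 := fun h => hx2 (Complex.normSq_eq_zero.1 h)
      have := hx1 hx
      simp only [g, Pi.zero_apply] at this
      exact absurd this (by positivity)
    rw [ae_iff] at h3
    simp only [not_not, Set.ofPred_mem_eq, Real.volume_Ioi, ENNReal.top_ne_zero] at h3
  · rw [shiftFunctional_apply ht, setIntegral_congr_fun measurableSet_Ioi hg]
    exact integral_ofReal

/-- A kernel vector of the Hankel matrix is a polynomial p orthogonal to all lower powers, hence to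
its own conjugate, against positivity of the weight. -/
lemma weightDet_ne_zero_of_real {t : ℝ} (ht : 0 < t) (a : ℝ) (n : ℕ) : weightDet a n t ≠ 0 := by
  intro h0
  obtain ⟨v, hv0, hv⟩ := Matrix.exists_mulVec_eq_zero_iff.2 h0
  set p : ℂ[X] := ∑ j, C (v j) * X ^ (j : ℕ) with hp
  have hp0 : p ≠ 0 := by
    intro h
    apply hv0
    funext j
    rw [← coeff_lower v j, ← hp, h]; simp
  have hL : ∀ i : Fin n, shiftFunctional t 2 a (p * X ^ (i : ℕ)) = 0 := by
    intro i
    rw [← Pi.zero_apply (M := fun _ : Fin n => ℂ) i, ← congrFun hv i, ← momentFunctional_weightMoment, hp, Finset.sum_mul, map_sum]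
    simp only [Matrix.mulVec, dotProduct, hankel, Matrix.of_apply]
    refine Finset.sum_congr rfl fun j _ => ?_
    rw [mul_assoc, ← pow_add, ← smul_eq_C_mul, map_smul, momentFunctional_X_pow, smul_eq_mul,
      mul_comm, add_comm (j : ℕ)]
  obtain ⟨r, hr, h⟩ := shiftFunctional_mul_conj ht 2 a hp0
  have : shiftFunctional t 2 a (p * p.map (starRingEnd ℂ)) = 0 := by
    conv_lhs => rw [hp, Polynomial.map_sum, ← hp, Finset.mul_sum, map_sum]
    refine Finset.sum_eq_zero fun i _ => ?_
    rw [Polynomial.map_mul, map_C, Polynomial.map_pow, map_X, mul_left_comm, ← smul_eq_C_mul,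
      map_smul, hL, smul_zero]
  rw [h] at this
  exact hr.ne' (by exact_mod_cast this)

/-- The formula for the recurrence coefficient gives H_{n+1} - H_n = a·t·K(P²)/L(P²), because
(n+1)(n+a+3) - n(n+a+2) = 2n+a+3. For real weights both functionals are positive on P², so the sum
over n has the sign of a. -/
lemma nextCoeff_of_real {t : ℝ} (ht : 0 < t) (a : ℝ) (n : ℕ) :
    ∃ r : ℝ, 0 ≤ r ∧ (n : ℂ) * (n + a + 2) + (monicOrthPoly (weightMoment a t) n).nextCoeff
      = a * r := by
  have hD := weightDet_ne_zero_of_real ht a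
  have hP : ∀ n, MonicOrth (shiftFunctional t 2 a) n (monicOrthPoly (weightMoment a t) n) :=
    fun n => monicOrth_monicOrthPoly (hD n)
  induction n with
  | zero =>
    refine ⟨0, le_rfl, ?_⟩
    rw [(hP 0).eq_one]; simp [nextCoeff]
  | succ n ih =>
    obtain ⟨r, hr, hrn⟩ := ih
    set P := monicOrthPoly (weightMoment a t) n
    have hconj : P.map (starRingEnd ℂ) = P := by
      refine MonicOrth.unique (hD n) ⟨(hP n).monic.map _, ?_, fun k hk => ?_⟩ (hP n)
      · rw [natDegree_map, (hP n).natDegree_eq]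
      · have := shiftFunctional_conj ht 2 a (P * X ^ k)
        rw [(hP n).orth k hk, Polynomial.map_mul, Polynomial.map_pow, map_X, map_zero] at this
        exact this
    obtain ⟨l, hl, hL⟩ := shiftFunctional_mul_conj ht 2 a (hP n).monic.ne_zero
    obtain ⟨k, hk, hK⟩ := shiftFunctional_mul_conj ht 2 (a - 1) (hP n).monic.ne_zero
    change shiftFunctional t 2 a (P * P.map _) = _ at hL
    change shiftFunctional t 2 _ (P * P.map _) = _ at hK
    rw [hconj] at hL hK
    push_cast at hK
    have h1 := (semiclassical_shiftFunctional ht a).X_mul_sq_parts (hP n)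
    rw [(hP n).nextCoeff_sub (hP (n + 1))] at h1
    change _ * shiftFunctional t 2 a (P * P) - t * (a * shiftFunctional t 2 (a - 1) (P * P))
      = (P.nextCoeff - _) * shiftFunctional t 2 a (P * P) at h1
    rw [hL, hK] at h1
    have hl0 : (l : ℂ) ≠ 0 := by exact_mod_cast hl.ne'
    refine ⟨r + t * k / l, by positivity, ?_⟩
    push_cast
    field_simp
    linear_combination h1 + l * hrn

lemma nuFun_re_of_real {a : ℝ} (ha : -1 < a) {s : ℝ} (hs : 0 < s)
    (h : deriv (detInf a) s ≠ 0) :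
    (0 ≤ a → 0 ≤ (nuFun a s).re) ∧ (a ≤ 0 → (nuFun a s).re ≤ 0) := by
  have h1 := (hardEdge_limits (a := a) (by simpa using ha) hs h).1
  rw [← nuFun_eq_hardH h] at h1
  have h2 := (Complex.continuous_re.tendsto _).comp h1
  have hev : ∀ᶠ n : ℕ in atTop, ∃ r : ℝ, 0 ≤ r ∧
      ((n : ℂ) * (n + a + 2) + bigGamma a (s / (4 * n)) n).re = a * r := by
    filter_upwards [eventually_gt_atTop 0] with n hn
    have ht : 0 < s / (4 * n) := by
      have : (0 : ℝ) < n := by exact_mod_cast hn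
      positivity
    obtain ⟨r, hr, hrn⟩ := nextCoeff_of_real ht a n
    have hD := weightDet_ne_zero_of_real ht a
    obtain ⟨k, rfl⟩ := Nat.exists_eq_succ_of_ne_zero hn.ne'
    rw [← bigGamma_eq ht (hD _) (hD _)] at hrn
    exact ⟨r, hr, by rw [hrn, ← Complex.ofReal_mul, Complex.ofReal_re]⟩
  refine ⟨fun h0 => ge_of_tendsto h2 ?_, fun h0 => le_of_tendsto h2 ?_⟩
  · filter_upwards [hev] with n ⟨r, hr, hn⟩
    rw [Function.comp_apply, hn]; positivity
  · filter_upwards [hev] with n ⟨r, hr, hn⟩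
    rw [Function.comp_apply, hn]; exact mul_nonpos_of_nonpos_of_nonneg h0 hr

/-- For real `a`, positivity of the weight excludes poles of `nuFun` on the positive axis. -/
lemma deriv_detInf_ne_zero_of_real {a : ℝ} (ha : -1 < a) {s : ℝ} (hs : 0 < s) :
    deriv (detInf a) s ≠ 0 := by
  have ha' : -1 < (a : ℂ).re := by simpa using ha
  have hslit : (s : ℂ) ∈ Complex.slitPlane := Complex.ofReal_mem_slitPlane.2 hs
  intro h0
  obtain ⟨m, g, hm, hg, hgs, hz⟩ := nuFun_pole ha' hslit h0
  have hmer := (analyticOnNhd_detInf ha' _ hslit).deriv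
  have hne : ∀ᶠ z in 𝓝[≠] (s : ℂ), deriv (detInf a) z ≠ 0 :=
    hmer.eventually_eq_zero_or_eventually_ne_zero.resolve_left
      (deriv_detInf_not_eventually_zero ha' hslit)
  have hcoe : Tendsto (fun x : ℝ => (x : ℂ)) (𝓝[≠] s) (𝓝[≠] (s : ℂ)) :=
    tendsto_nhdsWithin_iff.2 ⟨(Complex.continuous_ofReal.tendsto s).mono_left nhdsWithin_le_nhds,
      by filter_upwards [self_mem_nhdsWithin] with x hx; simpa using hx⟩
  have hsign : ∀ᶠ x : ℝ in 𝓝[≠] s,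
      (0 ≤ a → 0 ≤ (nuFun a x).re) ∧ (a ≤ 0 → (nuFun a x).re ≤ 0) := by
    filter_upwards [hcoe.eventually hne, nhdsWithin_le_nhds (lt_mem_nhds hs)] with x hx hx0
    exact nuFun_re_of_real ha hx0 hx
  -- The residue is positive, so Re ν is negative just left of s and positive just right; one side
  -- contradicts the sign of a.
  have hlim : Tendsto (fun x : ℝ => (x - s) * (nuFun a x).re) (𝓝[≠] s) (𝓝 (m * s)) := by
    have h1 : Tendsto (fun x : ℝ => (g x).re) (𝓝[≠] s) (𝓝 (m * s)) := by
      have := (Complex.continuous_re.tendsto _).comp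
        (hg.continuousAt.tendsto.comp (hcoe.mono_right nhdsWithin_le_nhds))
      have e : ((m : ℂ) * s).re = m * s := by simp
      rw [hgs, e] at this
      exact this
    refine h1.congr' ?_
    filter_upwards [(hcoe.mono_right nhdsWithin_le_nhds).eventually hz, self_mem_nhdsWithin]
      with x hx hxs
    have hne : x - s ≠ 0 := sub_ne_zero.2 hxs
    rw [hx, ← Complex.ofReal_sub, ← Complex.ofReal_inv, Complex.re_ofReal_mul]
    field_simp
  have hpos : (0 : ℝ) < m * s := mul_pos (by exact_mod_cast hm) hs
  have hev := (hlim.eventually_const_lt hpos).and hsign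
  rcases le_total a 0 with h | h
  · have hsub : 𝓝[>] s ≤ 𝓝[≠] s := nhdsWithin_mono _ fun x hx => ne_of_gt hx
    obtain ⟨x, ⟨hx1, hx2⟩, hx⟩ := ((hev.filter_mono hsub).and self_mem_nhdsWithin).exists
    exact absurd hx1 (not_lt.2 (mul_nonpos_of_nonneg_of_nonpos (sub_pos.2 hx).le (hx2.2 h)))
  · have hsub : 𝓝[<] s ≤ 𝓝[≠] s := nhdsWithin_mono _ fun x hx => ne_of_lt hx
    obtain ⟨x, ⟨hx1, hx2⟩, hx⟩ := ((hev.filter_mono hsub).and self_mem_nhdsWithin).exists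
    exact absurd hx1 (not_lt.2 (mul_nonpos_of_nonpos_of_nonneg (sub_neg.2 hx).le (hx2.1 h)))

/-! ### Uniqueness from the boundary condition at the origin -/

lemma isBigO_cpow_pow {c : ℂ} {k : ℕ} (hk : (k : ℝ) ≤ c.re) :
    (fun s : ℂ => s ^ c) =O[𝓝[Complex.slitPlane] 0] fun s => s ^ k := by
  refine (isBigO_cpow_norm_rpow c).trans (IsBigO.of_bound 1 ?_)
  have h1 : ∀ᶠ s : ℂ in 𝓝[Complex.slitPlane] 0, ‖s‖ < 1 :=
    nhdsWithin_le_nhds ((continuous_norm.tendsto' (0 : ℂ) 0 norm_zero).eventually_lt_const one_pos)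
  filter_upwards [h1, self_mem_nhdsWithin] with s hs hss
  have hpos : 0 < ‖s‖ := norm_pos_iff.2 (Complex.slitPlane_ne_zero hss)
  rw [one_mul, Real.norm_of_nonneg (by positivity), norm_pow, ← Real.rpow_natCast]
  exact Real.rpow_le_rpow_of_exponent_ge hpos hs.le hk

/-- Cauchy estimates on the discs `|z - x| ≤ x/2`, `x ↓ 0`. -/
lemma isBigOWith_iteratedDeriv {h : ℂ → ℂ} {r : ℝ} (hr : 0 < r)
    (hh : AnalyticOnNhd ℂ h (Complex.slitPlane ∩ Metric.ball 0 r)) {c : ℝ} (hc : 0 ≤ c) {k : ℕ}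
    (n : ℕ) (hO : IsBigOWith c (𝓝[Complex.slitPlane] 0) h fun s => s ^ k) :
    IsBigOWith (n.factorial * 2 ^ n * (3 / 2) ^ k * c) (𝓝[>] 0)
      (fun x : ℝ => (x : ℂ) ^ n * iteratedDeriv n h x) fun x : ℝ => (x : ℂ) ^ k := by
  obtain ⟨δ, hδ, hsub⟩ := Metric.mem_nhdsWithin_iff.1 hO.bound
  rw [isBigOWith_iff]
  filter_upwards [Ioo_mem_nhdsGT (show 0 < min r δ / 2 by positivity)] with x hx
  have hx0 : 0 < x := hx.1
  have hxr : x < r / 2 := hx.2.trans_le (by gcongr; exact min_le_left _ _)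
  have hxδ : x < δ / 2 := hx.2.trans_le (by gcongr; exact min_le_right _ _)
  have hnorm : ∀ z ∈ Metric.closedBall (x : ℂ) (x / 2), ‖z‖ ≤ 3 / 2 * x := fun z hz => by
    have h1 : ‖z - x‖ ≤ x / 2 := by simpa [dist_eq_norm] using hz
    have h2 := norm_add_le (z - x) x
    rw [sub_add_cancel, Complex.norm_real, Real.norm_of_nonneg hx0.le] at h2
    linarith
  have hslit : ∀ z ∈ Metric.closedBall (x : ℂ) (x / 2), z ∈ Complex.slitPlane := fun z hz => by
    have h1 : ‖z - x‖ ≤ x / 2 := by simpa [dist_eq_norm] using hz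
    have h2 := (abs_le.1 ((Complex.abs_re_le_norm (z - x)).trans h1)).1
    rw [Complex.sub_re, Complex.ofReal_re] at h2
    exact Or.inl (by linarith)
  have hball : ∀ z ∈ Metric.closedBall (x : ℂ) (x / 2),
      z ∈ Complex.slitPlane ∩ Metric.ball 0 r := fun z hz =>
    ⟨hslit z hz, by simpa using (hnorm z hz).trans_lt (by linarith)⟩
  have hd : DiffContOnCl ℂ h (Metric.ball (x : ℂ) (x / 2)) :=
    (hh.mono hball).differentiableOn.diffContOnCl_ball subset_rfl
  have hC : ∀ z ∈ Metric.sphere (x : ℂ) (x / 2), ‖h z‖ ≤ c * (3 / 2 * x) ^ k := fun z hz => by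
    have hz' := Metric.sphere_subset_closedBall hz
    have h1 : ‖h z‖ ≤ c * ‖z ^ k‖ :=
      hsub ⟨by simpa using (hnorm z hz').trans_lt (by linarith), hslit z hz'⟩
    rw [norm_pow] at h1
    exact h1.trans (by gcongr; exact hnorm z hz')
  have h1 := Complex.norm_iteratedDeriv_le_of_forall_mem_sphere_norm_le n (half_pos hx0) hd hC
  rw [norm_mul, norm_pow, norm_pow, Complex.norm_real, Real.norm_of_nonneg hx0.le]
  calc x ^ n * ‖iteratedDeriv n h x‖
      ≤ x ^ n * (n.factorial * (c * (3 / 2 * x) ^ k) / (x / 2) ^ n) := by gcongr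
    _ = n.factorial * 2 ^ n * (3 / 2) ^ k * c * x ^ k := by
        rw [div_pow, mul_pow]; field_simp

lemma isLittleO_iteratedDeriv {h : ℂ → ℂ} {r : ℝ} (hr : 0 < r)
    (hh : AnalyticOnNhd ℂ h (Complex.slitPlane ∩ Metric.ball 0 r)) {k : ℕ} (n : ℕ)
    (ho : h =o[𝓝[Complex.slitPlane] 0] fun s => s ^ k) :
    (fun x : ℝ => (x : ℂ) ^ n * iteratedDeriv n h x) =o[𝓝[>] 0] fun x : ℝ => (x : ℂ) ^ k := by
  rw [isLittleO_iff_forall_isBigOWith] at ho ⊢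
  intro c hc
  have hK : (0 : ℝ) < n.factorial * 2 ^ n * (3 / 2) ^ k := by positivity
  have := isBigOWith_iteratedDeriv hr hh (div_pos hc hK).le n (ho (div_pos hc hK))
  rwa [mul_div_cancel₀ _ hK.ne'] at this

lemma isBigO_iteratedDeriv {h : ℂ → ℂ} {r : ℝ} (hr : 0 < r)
    (hh : AnalyticOnNhd ℂ h (Complex.slitPlane ∩ Metric.ball 0 r)) {k : ℕ} (n : ℕ)
    (hO : h =O[𝓝[Complex.slitPlane] 0] fun s => s ^ k) :
    (fun x : ℝ => (x : ℂ) ^ n * iteratedDeriv n h x) =O[𝓝[>] 0] fun x : ℝ => (x : ℂ) ^ k := by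
  obtain ⟨c, hc, hcO⟩ := hO.exists_nonneg
  exact (isBigOWith_iteratedDeriv hr hh hc n hcO).isBigO

/-- A solution of the perturbed diagonal Euler system `x w_i' = λ_i w_i + o(|w|)` which is
`O(x^M)` with `M` larger than both real parts vanishes near `0`. -/
lemma eulerSystem_eventually_eq_zero {w₁ w₂ e : ℝ → ℂ} {l₁ l₂ : ℂ} {M : ℕ}
    (h₁ : ∀ᶠ x in 𝓝[>] 0, HasDerivAt w₁ ((l₁ * w₁ x + e x) / x) x)
    (h₂ : ∀ᶠ x in 𝓝[>] 0, HasDerivAt w₂ ((l₂ * w₂ x + e x) / x) x)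
    (he : e =o[𝓝[>] 0] fun x => ‖w₁ x‖ + ‖w₂ x‖)
    (hw₁ : w₁ =O[𝓝[>] 0] fun x : ℝ => x ^ M) (hw₂ : w₂ =O[𝓝[>] 0] fun x : ℝ => x ^ M)
    (hl₁ : l₁.re < M) (hl₂ : l₂.re < M) : ∀ᶠ x in 𝓝[>] (0 : ℝ), w₁ x = 0 ∧ w₂ x = 0 := by
  -- The exponent m lies strictly between the growth rates of the system and the decay rate M; η
  -- measures the gap available to absorb the perturbation e.
  obtain ⟨m, hm, hmM⟩ := exists_between (max_lt hl₁ hl₂)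
  obtain ⟨hm₁, hm₂⟩ := max_lt_iff.1 hm
  set η : ℝ := min (m - l₁.re) (m - l₂.re) / 2 with hη
  have hη0 : 0 < η := by
    have := lt_min (sub_pos.2 hm₁) (sub_pos.2 hm₂)
    positivity
  have hη₁ : l₁.re + 2 * η ≤ m := by
    have := min_le_left (m - l₁.re) (m - l₂.re)
    rw [hη]; linarith
  have hη₂ : l₂.re + 2 * η ≤ m := by
    have := min_le_right (m - l₁.re) (m - l₂.re)
    rw [hη]; linarith
  set V : ℝ → ℝ := fun x => ‖w₁ x‖ ^ 2 + ‖w₂ x‖ ^ 2 with hV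
  -- A Lyapunov function: Φ is nonnegative, nonincreasing near 0, and tends to 0 at 0 since m < M,
  -- hence it vanishes.
  set Φ : ℝ → ℝ := fun x => x ^ (-(2 * m)) * V x with hΦ
  have hderiv : ∀ᶠ x in 𝓝[>] (0 : ℝ), ∃ D ≤ 0, HasDerivAt Φ D x := by
    filter_upwards [h₁, h₂, he.bound hη0, self_mem_nhdsWithin] with x hx₁ hx₂ hxe hx
    have hx0 : (0 : ℝ) < x := hx
    have hd := (Real.hasDerivAt_rpow_const (p := -(2 * m)) (Or.inl hx0.ne')).mul
      (hx₁.norm_sq.add hx₂.norm_sq)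
    refine ⟨_, ?_, hd⟩
    have hin : ∀ (l w : ℂ), inner ℝ w ((l * w + e x) / (x : ℂ))
        ≤ (l.re * ‖w‖ ^ 2 + ‖w‖ * ‖e x‖) / x := by
      intro l w
      have h1 : ((l * w + e x) / (x : ℂ)) = (x⁻¹ : ℝ) • (l * w + e x) := by
        rw [Complex.real_smul, Complex.ofReal_inv, div_eq_inv_mul]
      have h2 : inner ℝ w (l * w) = l.re * ‖w‖ ^ 2 := by
        rw [Complex.inner, ← Complex.normSq_eq_norm_sq, Complex.normSq_apply]
        simp; ring
      rw [h1, real_inner_smul_right, inner_add_right, h2, div_eq_inv_mul]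
      gcongr
      exact real_inner_le_norm _ _
    have hxe' : ‖e x‖ ≤ η * (‖w₁ x‖ + ‖w₂ x‖) := by
      rwa [Real.norm_of_nonneg (by positivity)] at hxe
    have hrp : x ^ (-(2 * m) - 1) = x ^ (-(2 * m)) / x := by
      rw [Real.rpow_sub_one hx0.ne']
    have hpos : 0 < x ^ (-(2 * m)) := Real.rpow_pos_of_pos hx0 _
    rw [hrp]
    have hi₁ := hin l₁ (w₁ x)
    have hi₂ := hin l₂ (w₂ x)
    have hkey : l₁.re * ‖w₁ x‖ ^ 2 + ‖w₁ x‖ * ‖e x‖ + (l₂.re * ‖w₂ x‖ ^ 2 + ‖w₂ x‖ * ‖e x‖)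
        ≤ m * (‖w₁ x‖ ^ 2 + ‖w₂ x‖ ^ 2) := by
      have h1 : (‖w₁ x‖ + ‖w₂ x‖) * ‖e x‖
          ≤ (‖w₁ x‖ + ‖w₂ x‖) * (η * (‖w₁ x‖ + ‖w₂ x‖)) := by gcongr
      have h2 := mul_le_mul_of_nonneg_right hη₁ (sq_nonneg ‖w₁ x‖)
      have h3 := mul_le_mul_of_nonneg_right hη₂ (sq_nonneg ‖w₂ x‖)
      have h4 := mul_nonneg hη0.le (sq_nonneg (‖w₁ x‖ - ‖w₂ x‖))
      nlinarith
    have hsum : inner ℝ (w₁ x) ((l₁ * w₁ x + e x) / (x : ℂ))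
        + inner ℝ (w₂ x) ((l₂ * w₂ x + e x) / (x : ℂ))
        ≤ m * (‖w₁ x‖ ^ 2 + ‖w₂ x‖ ^ 2) / x := by
      refine (add_le_add hi₁ hi₂).trans ?_
      rw [← add_div]
      gcongr
    calc _ = x ^ (-(2 * m)) * (2 * (inner ℝ (w₁ x) ((l₁ * w₁ x + e x) / (x : ℂ))
          + inner ℝ (w₂ x) ((l₂ * w₂ x + e x) / (x : ℂ))
          - m * (‖w₁ x‖ ^ 2 + ‖w₂ x‖ ^ 2) / x)) := by
            simp only [Pi.add_apply]; ring
      _ ≤ 0 := mul_nonpos_of_nonneg_of_nonpos hpos.le (by linarith)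
  obtain ⟨δ, hδ, hsub⟩ := mem_nhdsGT_iff_exists_Ioo_subset.1 hderiv
  have hanti : AntitoneOn Φ (Set.Ioo 0 δ) := by
    refine antitoneOn_of_deriv_nonpos (convex_Ioo 0 δ) ?_ ?_ ?_
    · intro x hx
      obtain ⟨D, -, hD⟩ := hsub hx
      exact hD.continuousAt.continuousWithinAt
    · intro x hx
      rw [interior_Ioo] at hx
      obtain ⟨D, -, hD⟩ := hsub hx
      exact hD.differentiableAt.differentiableWithinAt
    · intro x hx
      rw [interior_Ioo] at hx
      obtain ⟨D, hD0, hD⟩ := hsub hx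
      rwa [hD.deriv]
  have hlim : Tendsto Φ (𝓝[>] 0) (𝓝 0) := by
    have h1 : V =O[𝓝[>] 0] fun x : ℝ => (x ^ M) ^ 2 := (hw₁.norm_left.pow 2).add (hw₂.norm_left.pow 2)
    have h2 : Φ =O[𝓝[>] 0] fun x : ℝ => x ^ (-(2 * m)) * (x ^ M) ^ 2 := (isBigO_refl _ _).mul h1
    refine h2.trans_tendsto ?_
    have h3 : Tendsto (fun x : ℝ => x ^ (2 * (M - m))) (𝓝[>] 0) (𝓝 0) := by
      have := (Real.continuousAt_rpow_const 0 (2 * ((M : ℝ) - m)) (Or.inr (by linarith))).tendsto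
      rw [Real.zero_rpow (by linarith)] at this
      exact this.mono_left nhdsWithin_le_nhds
    refine h3.congr' ?_
    filter_upwards [self_mem_nhdsWithin] with x hx
    have hx0 : (0 : ℝ) < x := hx
    rw [← pow_mul, ← Real.rpow_natCast, ← Real.rpow_add hx0]
    congr 1; push_cast; ring
  filter_upwards [Ioo_mem_nhdsGT hδ] with x hx
  have h1 : Φ x ≤ 0 := by
    refine ge_of_tendsto hlim ?_
    filter_upwards [Ioo_mem_nhdsGT hx.1] with y hy
    exact hanti ⟨hy.1, hy.2.trans hx.2⟩ hx hy.2.le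
  have hpos : 0 < x ^ (-(2 * m)) := Real.rpow_pos_of_pos hx.1 _
  have h2 : V x ≤ 0 := by
    by_contra hcon
    exact absurd h1 (not_le.2 (mul_pos hpos (not_le.1 hcon)))
  have h3 := sq_nonneg ‖w₁ x‖
  have h4 := sq_nonneg ‖w₂ x‖
  simp only [hV] at h2
  constructor
  · rw [← norm_eq_zero, ← sq_eq_zero_iff]; linarith
  · rw [← norm_eq_zero, ← sq_eq_zero_iff]; linarith

lemma eventually_ofReal_mem_slitPlane_inter_ball {r : ℝ} (hr : 0 < r) :
    ∀ᶠ x : ℝ in 𝓝[>] 0, (x : ℂ) ∈ Complex.slitPlane ∩ Metric.ball 0 r := by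
  filter_upwards [Ioo_mem_nhdsGT hr] with x hx
  refine ⟨Complex.ofReal_mem_slitPlane.2 hx.1, ?_⟩
  simpa [abs_of_pos hx.1] using hx.2

/-- Asymptotics valid in the cut disc may be differentiated along the positive axis: Cauchy's
estimate on discs of radius x/2 costs one factor 1/x per derivative. -/
lemma isLittleO_sub_deriv {f q : ℂ → ℂ} {r : ℝ} (hr : 0 < r)
    (hf : AnalyticOnNhd ℂ f (Complex.slitPlane ∩ Metric.ball 0 r))
    (hq : AnalyticOnNhd ℂ q Set.univ) {k : ℕ}
    (ho : (fun s => f s - q s) =o[𝓝[Complex.slitPlane] 0] fun s => s ^ k) :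
    ((fun x : ℝ => f x - q x) =o[𝓝[>] 0] fun x : ℝ => (x : ℂ) ^ k) ∧
    ((fun x : ℝ => x * (deriv f x - deriv q x)) =o[𝓝[>] 0] fun x : ℝ => (x : ℂ) ^ k) ∧
    ((fun x : ℝ => (x : ℂ) ^ 2 * (deriv (deriv f) x - deriv (deriv q) x))
      =o[𝓝[>] 0] fun x : ℝ => (x : ℂ) ^ k) := by
  have hd : AnalyticOnNhd ℂ (fun s => f s - q s) (Complex.slitPlane ∩ Metric.ball 0 r) :=
    hf.sub (hq.mono (Set.subset_univ _))
  have e1 : ∀ x ∈ Complex.slitPlane ∩ Metric.ball (0 : ℂ) r,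
      deriv (fun s => f s - q s) x = deriv f x - deriv q x := fun x hx =>
    deriv_fun_sub (hf x hx).differentiableAt (hq x trivial).differentiableAt
  have hopen : IsOpen (Complex.slitPlane ∩ Metric.ball (0 : ℂ) r) :=
    Complex.isOpen_slitPlane.inter Metric.isOpen_ball
  refine ⟨ho.comp_tendsto tendsto_ofReal_slitPlane, ?_, ?_⟩
  · refine (isLittleO_iteratedDeriv hr hd 1 ho).congr' ?_ EventuallyEq.rfl
    filter_upwards [eventually_ofReal_mem_slitPlane_inter_ball hr] with x hx
    rw [pow_one, iteratedDeriv_one, e1 x hx]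
  · refine (isLittleO_iteratedDeriv hr hd 2 ho).congr' ?_ EventuallyEq.rfl
    filter_upwards [eventually_ofReal_mem_slitPlane_inter_ball hr] with x hx
    have e2 : deriv (fun s => f s - q s) =ᶠ[𝓝 (x : ℂ)] fun s => deriv f s - deriv q s := by
      filter_upwards [hopen.mem_nhds hx] with z hz using e1 z hz
    rw [iteratedDeriv_succ, iteratedDeriv_one, e2.deriv_eq,
      deriv_fun_sub (hf x hx).deriv.differentiableAt (hq x trivial).deriv.differentiableAt]

lemma tendsto_of_quadratic_expansion {f : ℂ → ℂ} {r : ℝ} (hr : 0 < r)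
    (hf : AnalyticOnNhd ℂ f (Complex.slitPlane ∩ Metric.ball 0 r)) {α β : ℂ}
    (ho : (fun s => f s - (α * s + β * s ^ 2)) =o[𝓝[Complex.slitPlane] 0] fun s => s ^ 2) :
    Tendsto (fun x : ℝ => f x / x) (𝓝[>] 0) (𝓝 α) ∧
    Tendsto (fun x : ℝ => (deriv f x - α) / x) (𝓝[>] 0) (𝓝 (2 * β)) ∧
    Tendsto (fun x : ℝ => deriv (deriv f) x) (𝓝[>] 0) (𝓝 (2 * β)) := by
  have hq : AnalyticOnNhd ℂ (fun s => α * s + β * s ^ 2) Set.univ := fun s _ => by fun_prop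
  have d1 : deriv (fun s => α * s + β * s ^ 2) = fun s => α + 2 * β * s := by
    funext s
    have := ((hasDerivAt_id s).const_mul α).add (((hasDerivAt_id s).fun_pow 2).const_mul β)
    refine (this.congr_deriv ?_).deriv
    simp; ring
  have d2 : deriv (fun s : ℂ => α + 2 * β * s) = fun s => 2 * β := by
    funext s
    have := ((hasDerivAt_id s).const_mul (2 * β)).const_add α
    refine (this.congr_deriv ?_).deriv
    simp
  obtain ⟨h0, h1, h2⟩ := isLittleO_sub_deriv hr hf hq ho
  rw [d1] at h1 h2
  rw [d2] at h2
  have hx0 : Tendsto (fun x : ℝ => (x : ℂ)) (𝓝[>] 0) (𝓝 0) :=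
    tendsto_ofReal_slitPlane.mono_right nhdsWithin_le_nhds
  have hne : ∀ᶠ x : ℝ in 𝓝[>] 0, (x : ℂ) ≠ 0 := by
    filter_upwards [self_mem_nhdsWithin] with x hx
    exact_mod_cast (ne_of_gt hx)
  refine ⟨?_, ?_, ?_⟩
  · have := ((h0.tendsto_div_nhds_zero.mul hx0).add (hx0.const_mul β)).const_add α
    simp only [mul_zero, add_zero] at this
    refine this.congr' ?_
    filter_upwards [hne] with x hx
    field_simp; ring
  · have := h1.tendsto_div_nhds_zero.const_add (2 * β)
    rw [add_zero] at this
    refine this.congr' ?_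
    filter_upwards [hne] with x hx
    field_simp; ring
  · have := h2.tendsto_div_nhds_zero.const_add (2 * β)
    rw [add_zero] at this
    refine this.congr' ?_
    filter_upwards [hne] with x hx
    field_simp; ring

lemma isLittleO_pow_of_isBigO {l : Filter ℂ} (hl : l ≤ 𝓝 0) {f : ℂ → ℂ} {k m : ℕ} (hkm : k < m)
    (h : f =O[l] fun s => s ^ m) : f =o[l] fun s => s ^ k :=
  h.trans_isLittleO ((isLittleO_pow_pow hkm).mono hl)

/-- Since Re(a+3) > 2, the nonanalytic term is invisible to second order. -/
lemma HasSmallExpansion.isLittleO {a : ℂ} (ha : -1 < a.re) {f : ℂ → ℂ}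
    (hf : HasSmallExpansion a f) :
    (fun s => f s - (a / (4 * (a + 2)) * s
      + -(a / (8 * (a + 3) * (a + 2) ^ 2 * (a + 1))) * s ^ 2))
      =o[𝓝[Complex.slitPlane] 0] fun s => s ^ 2 := by
  obtain ⟨A, B, hA, hB, hA3, hB1, hO⟩ := hf
  have hl : 𝓝[Complex.slitPlane] (0 : ℂ) ≤ 𝓝 0 := nhdsWithin_le_nhds
  have h1 := isLittleO_pow_of_isBigO hl (by norm_num : 2 < 3) (hA3.mono hl)
  have h2 : (fun s : ℂ => s ^ (2 * a + 6)) =o[𝓝[Complex.slitPlane] 0] fun s => s ^ 2 := by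
    refine isLittleO_pow_of_isBigO hl (by norm_num : 2 < 3) (isBigO_cpow_pow ?_)
    simp; linarith
  have h3 : (fun s : ℂ => s ^ (a + 3)) =o[𝓝[Complex.slitPlane] 0] fun s => s ^ 2 := by
    have e : (fun s : ℂ => s ^ (a + 3)) =ᶠ[𝓝[Complex.slitPlane] 0]
        fun s => s ^ (a + 1) * s ^ 2 := by
      filter_upwards [self_mem_nhdsWithin] with s hs
      rw [← Complex.cpow_natCast, ← Complex.cpow_add _ _ (Complex.slitPlane_ne_zero hs)]
      congr 1; push_cast; ring
    have h4 : (fun s : ℂ => s ^ (a + 1)) =o[𝓝[Complex.slitPlane] 0] fun _ => (1 : ℂ) :=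
      (isLittleO_one_iff ℂ).2 (tendsto_cpow_zero (by simp; linarith))
    exact ((h4.mul_isBigO (isBigO_refl (fun s : ℂ => s ^ 2) _)).congr_right (by simp)).congr'
      e.symm EventuallyEq.rfl
  have h5 : B =O[𝓝[Complex.slitPlane] 0] fun _ => (1 : ℂ) :=
    hB.continuousAt.tendsto.isBigO_one ℂ |>.mono hl
  have h6 := ((h3.mul_isBigO h5).const_mul_left (-(2 / ((4 : ℂ) ^ (a + 3) * (a + 2) * (a + 1)
    * Complex.Gamma (a + 3) * Complex.Gamma (a + 4))))).congr_right (g₂ := fun s => s ^ 2) (by simp)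
  refine ((hO.trans_isLittleO h2).add (h1.add h6)).congr_left fun s => ?_
  have e2 : a / (a + 2) * (s / 4) = a / (4 * (a + 2)) * s := by
    rw [div_mul_div_comm, div_mul_eq_mul_div, mul_comm (a + 2)]
  rw [e2]; ring

/-- Subtract the two equations and divide by f'' + g'', which tends to 4β; this is nonzero exactly
because a ≠ 0. The difference then satisfies a linear equation with a regular singularity at 0. -/
lemma exists_difference_equation {a : ℂ} (ha : -1 < a.re) (ha0 : a ≠ 0) {f g : ℂ → ℂ} {r : ℝ}
    (hr : 0 < r) (hf : AnalyticOnNhd ℂ f (Complex.slitPlane ∩ Metric.ball 0 r))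
    (hg : AnalyticOnNhd ℂ g (Complex.slitPlane ∩ Metric.ball 0 r))
    (hfe : ∀ s ∈ Complex.slitPlane ∩ Metric.ball 0 r, NuEquationAt a f s)
    (hge : ∀ s ∈ Complex.slitPlane ∩ Metric.ball 0 r, NuEquationAt a g s)
    (hfx : HasSmallExpansion a f) (hgx : HasSmallExpansion a g) :
    ∃ p q : ℝ → ℂ, Tendsto p (𝓝[>] 0) (𝓝 1) ∧ Tendsto q (𝓝[>] 0) (𝓝 ((a + 1) * (a + 3))) ∧
      ∀ᶠ x : ℝ in 𝓝[>] 0, (x : ℂ) ^ 2 * deriv (deriv fun s => f s - g s) x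
        = p x * (x * deriv (fun s => f s - g s) x) + q x * (f x - g x) := by
  have e1 : a + 1 ≠ 0 := by exact_mod_cast natCast_add_ne_zero ha (x := 1) le_rfl
  have e2 : a + 2 ≠ 0 := by exact_mod_cast natCast_add_ne_zero ha (x := 2) (by norm_num)
  have e3 : a + 3 ≠ 0 := by exact_mod_cast natCast_add_ne_zero ha (x := 3) (by norm_num)
  obtain ⟨f0, f1, f2⟩ := tendsto_of_quadratic_expansion hr hf (hfx.isLittleO ha)
  obtain ⟨g0, g1, g2⟩ := tendsto_of_quadratic_expansion hr hg (hgx.isLittleO ha)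
  set α : ℂ := a / (4 * (a + 2)) with hα
  set β : ℂ := -(a / (8 * (a + 3) * (a + 2) ^ 2 * (a + 1))) with hβ
  have hβ0 : β ≠ 0 := by
    rw [hβ]
    exact neg_ne_zero.2 (div_ne_zero ha0 (by simp [e1, e2, e3]))
  have hx0 : Tendsto (fun x : ℝ => (x : ℂ)) (𝓝[>] 0) (𝓝 0) :=
    tendsto_ofReal_slitPlane.mono_right nhdsWithin_le_nhds
  have hne : ∀ᶠ x : ℝ in 𝓝[>] 0, (x : ℂ) ≠ 0 := by
    filter_upwards [self_mem_nhdsWithin] with x hx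
    exact_mod_cast (ne_of_gt hx)
  have hα' : ∀ h : ℂ → ℂ, Tendsto (fun x : ℝ => (deriv h x - α) / x) (𝓝[>] 0) (𝓝 (2 * β)) →
      Tendsto (fun x : ℝ => deriv h x) (𝓝[>] 0) (𝓝 α) := fun h hh => by
    have := (hh.mul hx0).add_const α
    rw [mul_zero, zero_add] at this
    refine this.congr' ?_
    filter_upwards [hne] with x hx
    field_simp; ring
  have f1' := hα' f f1
  have g1' := hα' g g1
  have hS : Tendsto (fun x : ℝ => deriv (deriv f) x + deriv (deriv g) x) (𝓝[>] 0) (𝓝 (4 * β)) := by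
    have := f2.add g2
    rwa [show 2 * β + 2 * β = 4 * β by ring] at this
  have hS0 : 4 * β ≠ 0 := mul_ne_zero (by norm_num) hβ0
  have hg4 : Tendsto (fun x : ℝ => deriv g x * (4 * deriv g x - 1)) (𝓝[>] 0)
      (𝓝 (α * (4 * α - 1))) := g1'.mul ((g1'.const_mul 4).sub_const 1)
  refine ⟨fun x => ((a + 2) ^ 2 * ((deriv f x - α) / x + (deriv g x - α) / x)
      - (4 * (deriv f x + deriv g x) - 1) * (deriv f x - f x / x)
      - deriv g x * (4 * deriv g x - 1)) / (deriv (deriv f) x + deriv (deriv g) x),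
    fun x => deriv g x * (4 * deriv g x - 1) / (deriv (deriv f) x + deriv (deriv g) x),
    ?_, ?_, ?_⟩
  · have := ((((f1.add g1).const_mul ((a + 2) ^ 2)).sub
      ((((f1'.add g1').const_mul 4).sub_const 1).mul (f1'.sub f0))).sub hg4).div hS hS0
    have hv : ((a + 2) ^ 2 * (2 * β + 2 * β) - (4 * (α + α) - 1) * (α - α) - α * (4 * α - 1))
        / (4 * β) = 1 := by
      rw [div_eq_iff hS0, hβ, hα]
      field_simp; ring
    rw [hv] at this
    exact this
  · have := hg4.div hS hS0
    have hv : α * (4 * α - 1) / (4 * β) = (a + 1) * (a + 3) := by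
      rw [div_eq_iff hS0, hβ, hα]
      field_simp; ring
    rw [hv] at this
    exact this
  · have hopen : IsOpen (Complex.slitPlane ∩ Metric.ball (0 : ℂ) r) :=
      Complex.isOpen_slitPlane.inter Metric.isOpen_ball
    filter_upwards [eventually_ofReal_mem_slitPlane_inter_ball hr, hne, hS.eventually_ne hS0]
      with x hx hx0 hxS
    have d1 : deriv (fun s => f s - g s) =ᶠ[𝓝 (x : ℂ)] fun s => deriv f s - deriv g s := by
      filter_upwards [hopen.mem_nhds hx] with z hz using
        deriv_fun_sub (hf z hz).differentiableAt (hg z hz).differentiableAt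
    rw [d1.deriv_eq, d1.eq_of_nhds,
      deriv_fun_sub (hf x hx).deriv.differentiableAt (hg x hx).deriv.differentiableAt]
    have hF := hfe x hx
    have hG := hge x hx
    rw [NuEquationAt] at hF hG
    -- The value of α makes the coefficient of f' - g' vanish at x = 0, so that dividing it by x
    -- still leaves a limit.
    have hα2 : 2 * (a + 2) ^ 2 * α = 1 / 2 * a * (a + 2) := by rw [hα]; field_simp; norm_num
    have hu : (deriv f x - α) / x * x = deriv f x - α := div_mul_cancel₀ _ hx0
    have hv : (deriv g x - α) / x * x = deriv g x - α := div_mul_cancel₀ _ hx0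
    have hw : f x / x * x = f x := div_mul_cancel₀ _ hx0
    rw [div_mul_eq_mul_div, div_mul_eq_mul_div, ← add_div, eq_div_iff hxS]
    linear_combination hF - hG - (a + 2) ^ 2 * (deriv f x - deriv g x) * (hu + hv)
      - (4 * (deriv f x + deriv g x) - 1) * (deriv f x - deriv g x) * hw
      + (deriv f x - deriv g x) * hα2

/-- Insert the leading term αs^k with k = j+2 into the equation: k(k-1) - k - (a+1)(a+3) =
(k-(a+3))(k+(a+1)). -/
lemma indicial_eq_zero {a α : ℂ} {d : ℂ → ℂ} {r : ℝ} (hr : 0 < r)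
    (hd : AnalyticOnNhd ℂ d (Complex.slitPlane ∩ Metric.ball 0 r)) {p q : ℝ → ℂ}
    (hp : Tendsto p (𝓝[>] 0) (𝓝 1)) (hq : Tendsto q (𝓝[>] 0) (𝓝 ((a + 1) * (a + 3))))
    (heq : ∀ᶠ x : ℝ in 𝓝[>] 0, (x : ℂ) ^ 2 * deriv (deriv d) x
        = p x * (x * deriv d x) + q x * d x) {j : ℕ}
    (ho : (fun s => d s - α * s ^ (j + 2)) =o[𝓝[Complex.slitPlane] 0] fun s => s ^ (j + 2)) :
    α * ((((j + 2 : ℕ) : ℂ) - (a + 3)) * (((j + 2 : ℕ) : ℂ) + (a + 1))) = 0 := by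
  have hqa : AnalyticOnNhd ℂ (fun s => α * s ^ (j + 2)) Set.univ := fun s _ => by fun_prop
  have d1 : deriv (fun s : ℂ => α * s ^ (j + 2)) = fun s => α * (j + 2) * s ^ (j + 1) := by
    funext s
    rw [((hasDerivAt_pow (j + 2) s).const_mul α).deriv]
    rw [show j + 2 - 1 = j + 1 by omega]
    push_cast
    ring
  have d2 : deriv (fun s : ℂ => α * (j + 2) * s ^ (j + 1))
      = fun s => α * (j + 2) * (j + 1) * s ^ j := by
    funext s
    rw [((hasDerivAt_pow (j + 1) s).const_mul (α * (j + 2))).deriv]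
    rw [show j + 1 - 1 = j by omega]
    push_cast
    ring
  obtain ⟨h0, h1, h2⟩ := isLittleO_sub_deriv hr hd hqa ho
  rw [d1] at h1 h2
  rw [d2] at h2
  have hne : ∀ᶠ x : ℝ in 𝓝[>] 0, (x : ℂ) ≠ 0 := by
    filter_upwards [self_mem_nhdsWithin] with x hx
    exact_mod_cast (ne_of_gt hx)
  have t0 := h0.tendsto_div_nhds_zero.add_const α
  have t1 := h1.tendsto_div_nhds_zero.add_const (α * (j + 2))
  have t2 := h2.tendsto_div_nhds_zero.add_const (α * (j + 2) * (j + 1))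
  rw [zero_add] at t0 t1 t2
  have t3 := (t2.sub (hp.mul t1)).sub (hq.mul t0)
  have t4 := tendsto_nhds_unique (t3.congr' (f₂ := fun _ => (0 : ℂ)) ?_) tendsto_const_nhds
  · push_cast
    linear_combination t4
  · filter_upwards [heq, hne] with x hx hx0
    field_simp
    linear_combination hx

/-- The combinations xd' + (a+1)d and xd' - (a+3)d diagonalise the limiting Euler equation, with
exponents a+3 and -(a+1). The decay M exceeds both real parts. -/
lemma eventually_eq_zero_of_difference_equation {a : ℂ} (ha : -1 < a.re) {d : ℂ → ℂ} {r : ℝ}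
    (hr : 0 < r) (hd : AnalyticOnNhd ℂ d (Complex.slitPlane ∩ Metric.ball 0 r)) {p q : ℝ → ℂ}
    (hp : Tendsto p (𝓝[>] 0) (𝓝 1)) (hq : Tendsto q (𝓝[>] 0) (𝓝 ((a + 1) * (a + 3))))
    (heq : ∀ᶠ x : ℝ in 𝓝[>] 0, (x : ℂ) ^ 2 * deriv (deriv d) x
        = p x * (x * deriv d x) + q x * d x) {M : ℕ} (hM : a.re + 3 < M)
    (hO : d =O[𝓝[Complex.slitPlane] 0] fun s => s ^ M) : ∀ᶠ x : ℝ in 𝓝[>] 0, d x = 0 := by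
  have e2 : a + 2 ≠ 0 := by exact_mod_cast natCast_add_ne_zero ha (x := 2) (by norm_num)
  set w₁ : ℝ → ℂ := fun x => x * deriv d x + (a + 1) * d x with hw₁
  set w₂ : ℝ → ℂ := fun x => x * deriv d x - (a + 3) * d x with hw₂
  set e : ℝ → ℂ := fun x => (p x - 1) * (x * deriv d x) + (q x - (a + 1) * (a + 3)) * d x with he
  have hO0 : (fun x : ℝ => d x) =O[𝓝[>] 0] fun x : ℝ => x ^ M :=
    ((hO.comp_tendsto tendsto_ofReal_slitPlane).trans (IsBigO.of_bound 1 (by simp)))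
  have hO1 : (fun x : ℝ => x * deriv d x) =O[𝓝[>] 0] fun x : ℝ => x ^ M := by
    have := isBigO_iteratedDeriv hr hd 1 hO
    simp only [pow_one, iteratedDeriv_one] at this
    exact this.trans (IsBigO.of_bound 1 (by simp))
  have hder : ∀ c : ℂ, ∀ᶠ x : ℝ in 𝓝[>] 0, HasDerivAt (fun x : ℝ => x * deriv d x - c * d x)
      (deriv d x + x * deriv (deriv d) x - c * deriv d x) x := fun c => by
    filter_upwards [eventually_ofReal_mem_slitPlane_inter_ball hr] with x hx
    have h1 := (hd x hx).deriv.differentiableAt.hasDerivAt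
    have h2 := (hd x hx).differentiableAt.hasDerivAt
    have := (((hasDerivAt_id (x : ℂ)).mul h1).sub (h2.const_mul c)).comp_ofReal
    refine this.congr_deriv ?_
    simp
  have hne : ∀ᶠ x : ℝ in 𝓝[>] 0, (x : ℂ) ≠ 0 := by
    filter_upwards [self_mem_nhdsWithin] with x hx
    exact_mod_cast (ne_of_gt hx)
  have hd1 : ∀ x : ℝ, x * deriv d (x : ℂ) = ((a + 3) * w₁ x + (a + 1) * w₂ x) / (2 * (a + 2)) := by
    intro x; rw [hw₁, hw₂]; field_simp; ring
  have hd0 : ∀ x : ℝ, d x = (w₁ x - w₂ x) / (2 * (a + 2)) := by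
    intro x; rw [hw₁, hw₂]; field_simp; ring
  have b₁ : w₁ =O[𝓝[>] 0] fun x => ‖w₁ x‖ + ‖w₂ x‖ := IsBigO.of_bound 1 (by
    refine Eventually.of_forall fun x => ?_
    rw [one_mul, Real.norm_of_nonneg (by positivity)]
    exact le_add_of_nonneg_right (norm_nonneg _))
  have b₂ : w₂ =O[𝓝[>] 0] fun x => ‖w₁ x‖ + ‖w₂ x‖ := IsBigO.of_bound 1 (by
    refine Eventually.of_forall fun x => ?_
    rw [one_mul, Real.norm_of_nonneg (by positivity)]
    exact le_add_of_nonneg_left (norm_nonneg _))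
  have c₁ : (fun x : ℝ => x * deriv d x) =O[𝓝[>] 0] fun x => ‖w₁ x‖ + ‖w₂ x‖ := by
    refine (((b₁.const_mul_left (a + 3)).add (b₂.const_mul_left (a + 1))).const_mul_left
      (2 * (a + 2))⁻¹).congr_left fun x => ?_
    rw [hd1]; ring
  have c₀ : (fun x : ℝ => d x) =O[𝓝[>] 0] fun x => ‖w₁ x‖ + ‖w₂ x‖ := by
    refine ((b₁.sub b₂).const_mul_left (2 * (a + 2))⁻¹).congr_left fun x => ?_
    rw [hd0 x]; ring
  have hp' : (fun x => p x - 1) =o[𝓝[>] 0] fun _ => (1 : ℝ) :=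
    (isLittleO_one_iff ℝ).2 (by simpa using hp.sub_const 1)
  have hq' : (fun x => q x - (a + 1) * (a + 3)) =o[𝓝[>] 0] fun _ => (1 : ℝ) :=
    (isLittleO_one_iff ℝ).2 (by simpa using hq.sub_const ((a + 1) * (a + 3)))
  have heo : e =o[𝓝[>] 0] fun x => ‖w₁ x‖ + ‖w₂ x‖ :=
    ((hp'.mul_isBigO c₁).add (hq'.mul_isBigO c₀)).congr_right (by simp)
  have hz := eulerSystem_eventually_eq_zero (w₁ := w₁) (w₂ := w₂) (e := e) (l₁ := a + 3)
    (l₂ := -(a + 1)) (M := M) ?_ ?_ heo (hO1.add (hO0.const_mul_left _))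
    (hO1.sub (hO0.const_mul_left _)) (by simpa using hM) (by simp; linarith)
  · filter_upwards [hz] with x hx
    rw [hd0, hx.1, hx.2]; simp
  · filter_upwards [hder (-(a + 1)), heq, hne] with x hx hxe hx0
    refine (hx.congr_deriv ?_).congr_of_eventuallyEq (Eventually.of_forall fun y => ?_)
    · rw [eq_div_iff hx0, hw₁, he]
      linear_combination hxe
    · rw [hw₁]; ring
  · filter_upwards [hder (a + 3), heq, hne] with x hx hxe hx0
    refine hx.congr_deriv ?_
    rw [eq_div_iff hx0, hw₂, he]
    linear_combination hxe

lemma eventually_eq_of_hasSmallExpansion {a : ℂ} (ha : -1 < a.re) (hk : ∀ k : ℕ, a ≠ k)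
    {f g : ℂ → ℂ} {r : ℝ} (hr : 0 < r)
    (hf : AnalyticOnNhd ℂ f (Complex.slitPlane ∩ Metric.ball 0 r))
    (hg : AnalyticOnNhd ℂ g (Complex.slitPlane ∩ Metric.ball 0 r))
    (hfe : ∀ s ∈ Complex.slitPlane ∩ Metric.ball 0 r, NuEquationAt a f s)
    (hge : ∀ s ∈ Complex.slitPlane ∩ Metric.ball 0 r, NuEquationAt a g s)
    (hfx : HasSmallExpansion a f) (hgx : HasSmallExpansion a g) :
    ∀ᶠ x : ℝ in 𝓝[>] 0, f x = g x := by
  obtain ⟨p, q, hp, hq, heq⟩ := exists_difference_equation ha (by simpa using hk 0) hr hf hg hfe hge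
    hfx hgx
  have hd : AnalyticOnNhd ℂ (fun s => f s - g s) (Complex.slitPlane ∩ Metric.ball 0 r) := hf.sub hg
  obtain ⟨A, B, hA, hB, hA3, hB1, hAB⟩ := hfx
  obtain ⟨A', B', hA', hB', hA3', hB1', hAB'⟩ := hgx
  set κ : ℂ := 2 / ((4 : ℂ) ^ (a + 3) * (a + 2) * (a + 1) * Complex.Gamma (a + 3)
    * Complex.Gamma (a + 4)) with hκ
  have hl : 𝓝[Complex.slitPlane] (0 : ℂ) ≤ 𝓝 0 := nhdsWithin_le_nhds
  -- The two s^{a+3} terms have the same leading coefficient, so their difference is of order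
  -- s^{a+4}.
  have hR : ∀ m : ℕ, (m : ℝ) ≤ a.re + 4 →
      (fun s => f s - g s - (A s - A' s)) =O[𝓝[Complex.slitPlane] 0] fun s => s ^ m := by
    intro m hm
    have h1 := (hAB.sub hAB').trans
      (isBigO_cpow_pow (c := 2 * a + 6) (k := m) (by simp; linarith))
    have h2 : (fun s => s ^ (a + 3) * (B s - B' s)) =O[𝓝[Complex.slitPlane] 0] fun s => s ^ m := by
      have hBB : (fun s => B s - B' s) =O[𝓝[Complex.slitPlane] 0] fun s => s :=
        ((hB1.sub hB1').congr_left fun s => by ring).mono hl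
      refine ((isBigO_refl (fun s : ℂ => s ^ (a + 3)) _).mul hBB).trans
        (IsBigO.trans (EventuallyEq.isBigO ?_) (isBigO_cpow_pow (c := a + 4) (by simpa using hm)))
      filter_upwards [self_mem_nhdsWithin] with s hs
      have h3 := Complex.cpow_add (a + 3) 1 (Complex.slitPlane_ne_zero hs)
      rw [Complex.cpow_one, show a + 3 + 1 = a + 4 by ring] at h3
      exact h3.symm
    refine (h1.add (h2.const_mul_left (-κ))).congr_left fun s => ?_
    ring
  -- Each Taylor coefficient of A - A' in turn is annihilated by the indicial polynomial at m+3,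
  -- which is nonzero because a ≠ m and Re a > -1.
  have hD : ∀ m : ℕ, ((m + 3 : ℕ) : ℝ) ≤ a.re + 4 →
      (fun s => A s - A' s) =O[𝓝 0] fun s => s ^ (m + 3) := by
    intro m
    induction m with
    | zero =>
      intro _
      exact (hA3.sub hA3').congr_left fun s => by ring
    | succ m ih =>
      intro hm
      push_cast at hm
      obtain ⟨u, hu, hDu⟩ := exists_eq_pow_mul_of_isBigO (hA.sub hA')
        (ih (by push_cast; linarith))
      have hu1 : (fun s => u s - u 0) =O[𝓝 0] fun s => s :=
        hu.differentiableAt.isBigO_sub.congr_right fun s => by simp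
      have ho : (fun s => f s - g s - u 0 * s ^ (m + 1 + 2)) =o[𝓝[Complex.slitPlane] 0]
          fun s => s ^ (m + 1 + 2) := by
        have h1 := isLittleO_pow_of_isBigO hl (Nat.lt_succ_self (m + 1 + 2))
          (hR (m + 1 + 2 + 1) (by push_cast; linarith))
        have h2 : (fun s => s ^ (m + 3) * (u s - u 0)) =o[𝓝[Complex.slitPlane] 0]
            fun s => s ^ (m + 1 + 2) := by
          refine isLittleO_pow_of_isBigO hl (Nat.lt_succ_self (m + 1 + 2)) ?_
          exact (((isBigO_refl (fun s : ℂ => s ^ (m + 3)) _).mul hu1).congr_right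
            fun s => by rw [← pow_succ]).mono hl
        refine (h1.add h2).congr' ?_ EventuallyEq.rfl
        filter_upwards [hl hDu] with s hs
        simp only [Pi.sub_apply] at hs
        rw [hs]; ring
      have hind := indicial_eq_zero hr hd hp hq heq ho
      have hu0 : u 0 = 0 := by
        refine (mul_eq_zero.1 hind).resolve_right (mul_ne_zero ?_ ?_)
        · intro h
          refine hk m ?_
          push_cast at h
          linear_combination -h
        · intro h
          have := congrArg Complex.re h
          simp only [Complex.add_re, Complex.natCast_re, Complex.one_re, Complex.zero_re] at this
          have hm0 : (0 : ℝ) ≤ (m + 1 + 2 : ℕ) := Nat.cast_nonneg _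
          linarith
      have h3 : (fun s => s ^ (m + 3) * u s) =O[𝓝 0] fun s => s ^ (m + 1 + 3) := by
        refine ((isBigO_refl (fun s : ℂ => s ^ (m + 3)) _).mul hu1).congr (fun s => ?_)
          fun s => ?_
        · rw [hu0, sub_zero]
        · rw [← pow_succ]
      exact h3.congr' (by filter_upwards [hDu] with s hs using hs.symm) EventuallyEq.rfl
  -- The integer part of Re a + 4 is within reach of `hD` and exceeds Re a + 3, as the vanishing
  -- lemma demands.
  have hM : a.re + 4 < (⌊a.re + 4⌋₊ : ℝ) + 1 := Nat.lt_floor_add_one _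
  have hM' : (⌊a.re + 4⌋₊ : ℝ) ≤ a.re + 4 := Nat.floor_le (by linarith)
  have hM3 : 3 ≤ ⌊a.re + 4⌋₊ := Nat.le_floor (by push_cast; linarith)
  obtain ⟨m, hm⟩ := Nat.exists_eq_add_of_le' hM3
  rw [hm] at hM hM'
  have hO := (hR _ hM').add ((hD m hM').mono hl)
  have hz := eventually_eq_zero_of_difference_equation ha hr hd hp hq heq (M := m + 3)
    (by linarith) (hO.congr_left fun s => by ring)
  filter_upwards [hz] with x hx using sub_eq_zero.1 hx

/-- Uniqueness of the solution with the given expansion at the origin. -/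
lemma eqOn_nuFun_of_hasSmallExpansion {a : ℂ} (ha : -1 < a.re) (hk : ∀ k : ℕ, a ≠ k) {r : ℝ}
    (hr : 0 < r) {f : ℂ → ℂ} (hf : AnalyticOnNhd ℂ f (Complex.slitPlane ∩ Metric.ball 0 r))
    (hfe : ∀ s ∈ Complex.slitPlane ∩ Metric.ball 0 r, NuEquationAt a f s)
    (hfx : HasSmallExpansion a f) :
    Set.EqOn f (nuFun a) (Complex.slitPlane ∩ Metric.ball 0 r) := by
  obtain ⟨ε, hε, hsub⟩ := Metric.mem_nhdsWithin_iff.1 (eventually_deriv_detInf_ne_zero ha)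
  have hρ : 0 < min r ε := lt_min hr hε
  have hmono : Complex.slitPlane ∩ Metric.ball (0 : ℂ) (min r ε)
      ⊆ Complex.slitPlane ∩ Metric.ball 0 r :=
    Set.inter_subset_inter_right _ (Metric.ball_subset_ball (min_le_left _ _))
  have hne : ∀ s ∈ Complex.slitPlane ∩ Metric.ball (0 : ℂ) (min r ε), deriv (detInf a) s ≠ 0 :=
    fun s hs => hsub ⟨Metric.ball_subset_ball (min_le_right _ _) hs.2, hs.1⟩
  have hev := eventually_eq_of_hasSmallExpansion ha hk hρ (hf.mono hmono)
    (fun s hs => analyticAt_nuFun ha hs.1 (hne s hs)) (fun s hs => hfe s (hmono hs))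
    (fun s hs => nuEquation_hardH ha hs.1 (hne s hs)) hfx
    (hasSmallExpansion_of_nuFun ha fun _ _ => rfl)
  have hpre : IsPreconnected (Complex.slitPlane ∩ Metric.ball (0 : ℂ) r) := by
    have hmem : ((r / 2 : ℝ) : ℂ) ∈ Metric.ball (0 : ℂ) r := by
      rw [mem_ball_zero_iff, Complex.norm_real, Real.norm_of_nonneg (half_pos hr).le]
      exact half_lt_self hr
    exact (((Complex.starConvex_ofReal_slitPlane (half_pos hr)).inter
      ((convex_ball (0 : ℂ) r).starConvex hmem)).isPathConnected
      ⟨Complex.ofReal_mem_slitPlane.2 (half_pos hr), hmem⟩).isConnected.2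
  -- Multiplying by E' removes the possible poles of ν, so the identity theorem applies on the whole
  -- cut disc.
  have hK : AnalyticOnNhd ℂ (fun s => f s * deriv (detInf a) s - ((s / 4 - a) * deriv (detInf a) s
      + s * deriv (deriv (detInf a)) s)) (Complex.slitPlane ∩ Metric.ball 0 r) := by
    intro s hs
    have h0 := hf s hs
    have h1 := (analyticOnNhd_detInf ha s hs.1).deriv
    have h2 := h1.deriv
    fun_prop
  have hzero := eqOn_zero_of_eventually_ofReal hpre
    (eventually_ofReal_mem_slitPlane_inter_ball hr) hK (by
      filter_upwards [hev, eventually_ofReal_mem_slitPlane_inter_ball hρ] with x hx hxm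
      rw [hx, nuFun, div_mul_cancel₀ _ (hne _ hxm), sub_self])
  have heq : ∀ s ∈ Complex.slitPlane ∩ Metric.ball (0 : ℂ) r, deriv (detInf a) s ≠ 0 →
      f s = nuFun a s := fun s hs h => by
    rw [nuFun, eq_div_iff h]
    exact sub_eq_zero.1 (hzero hs)
  intro s hs
  -- The zeros of E' are isolated and f equals ν off them, so continuity of f excludes a pole of ν
  -- in the domain.
  refine heq s hs (deriv_detInf_ne_zero_of_continuousAt ha hs.1 (hf s hs).continuousAt ?_)
  have hopen : IsOpen (Complex.slitPlane ∩ Metric.ball (0 : ℂ) r) :=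
    Complex.isOpen_slitPlane.inter Metric.isOpen_ball
  filter_upwards [(analyticOnNhd_detInf ha s hs.1).deriv.eventually_eq_zero_or_eventually_ne_zero.resolve_left
    (deriv_detInf_not_eventually_zero ha hs.1), nhdsWithin_le_nhds (hopen.mem_nhds hs)] with z hz hzm
  exact (heq z hzm hz).symm

end

end HardEdge

theorem proposition5 (a : ℂ) (ha : -1 < a.re) :
    ∃ μ ν σ : ℂ → ℂ,
      -- `ν` is meromorphic on the cut plane, with no poles on `(0,∞)` when `a` is real
      MeromorphicNFOn ν Complex.slitPlane ∧
      (a.im = 0 → ∀ s : ℝ, 0 < s → AnalyticAt ℂ ν (s : ℂ)) ∧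
      -- `ν` and `μ` are the hard-edge limits, `t = s / 4n`
      (∀ s : ℝ, 0 < s → AnalyticAt ℂ ν (s : ℂ) →
        Tendsto (fun n : ℕ => (n : ℂ) * (n + a + 2) + HardEdge.bigGamma a (s / (4 * n)) n)
          atTop (𝓝 (ν s))) ∧
      (∀ s : ℝ, 0 < s → AnalyticAt ℂ ν (s : ℂ) →
        Tendsto (fun n : ℕ => 4 * (n : ℂ) * HardEdge.theta a (s / (4 * n)) n)
          atTop (𝓝 (μ s))) ∧
      -- the Painlevé III′ characterisation
      (∀ s ∈ Complex.slitPlane, AnalyticAt ℂ ν s →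
        ν s = -σ s + s / 4 - a - 2 ∧
        HardEdge.SigmaPIIIPrimeAt (a + 2) (a - 2) σ s ∧
        HardEdge.NuEquationAt a ν s ∧
        μ s = 4 * s * deriv ν s - s) ∧
      -- the boundary condition at `s = 0`, and its uniqueness
      ((∀ k : ℕ, a ≠ k) →
        HardEdge.HasSmallExpansion a ν ∧
        ∀ r : ℝ, 0 < r → ∀ f : ℂ → ℂ,
          AnalyticOnNhd ℂ f (Complex.slitPlane ∩ Metric.ball 0 r) →
          (∀ s ∈ Complex.slitPlane ∩ Metric.ball 0 r, HardEdge.NuEquationAt a f s) →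
          HardEdge.HasSmallExpansion a f →
          Set.EqOn f ν (Complex.slitPlane ∩ Metric.ball 0 r)) := by
  -- Analyticity of ν at s is used only through nonvanishing of E', under which the limit formulas
  -- hold.
  have hne : ∀ s ∈ Complex.slitPlane, AnalyticAt ℂ (HardEdge.nuFun a) s →
      deriv (HardEdge.detInf a) s ≠ 0 := fun s hs h =>
    HardEdge.deriv_detInf_ne_zero_of_continuousAt ha hs h.continuousAt Filter.EventuallyEq.rfl
  refine ⟨fun s => 4 * s * deriv (HardEdge.nuFun a) s - s, HardEdge.nuFun a,
    fun s => -HardEdge.nuFun a s + s / 4 - a - 2, HardEdge.meromorphicNFOn_nuFun ha,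
    fun him s hs => ?_, fun s hs h => ?_, fun s hs h => ?_, fun s hs h => ?_, fun hk => ?_⟩
  · obtain ⟨x, rfl⟩ : ∃ x : ℝ, (x : ℂ) = a := ⟨a.re, Complex.ext rfl him.symm⟩
    exact HardEdge.analyticAt_nuFun ha (Complex.ofReal_mem_slitPlane.2 hs)
      (HardEdge.deriv_detInf_ne_zero_of_real (by simpa using ha) hs)
  · have hd := hne s (Complex.ofReal_mem_slitPlane.2 hs) h
    rw [HardEdge.nuFun_eq_hardH hd]
    exact (HardEdge.hardEdge_limits ha hs hd).1
  · have hslit := Complex.ofReal_mem_slitPlane.2 hs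
    have hd := hne s hslit h
    have hlim := (HardEdge.hardEdge_limits ha hs hd).2.1
    rw [← (HardEdge.deriv_nuFun ha hslit hd).eq_of_nhds] at hlim
    convert hlim using 2
    ring
  · have hν := HardEdge.nuEquation_hardH ha hs (hne s hs h)
    exact ⟨by ring, HardEdge.sigmaPIIIPrimeAt_of_nuEquation h hν, hν, rfl⟩
  · exact ⟨HardEdge.hasSmallExpansion_of_nuFun ha fun _ _ => rfl, fun r hr f hf hfe hfx =>
      HardEdge.eqOn_nuFun_of_hasSmallExpansion ha hk hr hf hfe hfx⟩
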